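/- \textbf{Setting.} Let $V$ be a finite-dimensional complex Lie group (for instance a linear algebraic group over $\mathbb C$ with its analytic structure) with identity $e$, let $G$ be a finite group acting on $V$ by holomorphic group automorphisms, let $\gimel\subset V$ be a $G$-invariant subgroup and let $v\in V$. Put $W=(G\ltimes\gimel)\cdot v=\{\xi\,(g\cdot v):\xi\in\gimel,\ g\in G\}$. Let $\mathcal O_x$ be the algebra of germs of holomorphic functions at $x\in V$, $\mathcal M_x$ its total ring of fractions, and, for $\xi\in V$, let $\phi_\xi:\mathcal M_x\to\mathcal M_{\xi x}$, $f\mapsto f\circ\xi^{-1}$, be the left translation. The skew-group ring $\mathcal S(\gimel)$ consists of the finite sums $\sum_i f_i\phi_{\xi_i}$ with $f_i$ meromorphic on $V$ and $\xi_i\in\gimel$, with product $f\phi_\xi\circ f'\phi_{\xi'}=f\,\phi_\xi(f')\,\phi_{\xi\xi'}$; it acts on families of meromorphic germs, and $f\phi_\xi$ sends $F$ to $f\cdot\phi_\xi(F)$. \textbf{Invariant germs and $M^*$.} Let $\mathfrak O^G|_W$ be the space of finitely supported $G$-invariant families of holomorphic germs supported in $W$. Let $\mathcal O^G_\xi\subset\mathcal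 O_\xi$ be the algebra of germs at $\xi$ of $G$-invariant families, and let $\mathbb E_\xi$ be the quotient of $\mathcal O^G_\xi$ by the ideal generated by all $\phi_\xi(f)$ with $f\in\mathcal O^G_e$, $f(e)=0$. For a $G$-orbit $\bar\xi$ let $\mathbb E^G_{\bar\xi}$ be the space of $G$-invariant elements of $\bigoplus_{\xi'\in\bar\xi}\mathbb E_{\xi'}$, and put $$M^*(G,W)=\bigoplus_{\bar\xi\in W/G}(\mathbb E^G_{\bar\xi})^* .$$ Elements of $M^*(G,W)$ are evaluated on $F\in\mathfrak O^G|_W$ through the projections $\mathfrak O^G|_W\to\mathbb E^G_{\bar\xi}$; write $\langle\alpha,F\rangle$ for the value. \textbf{Local reflection group.} Assume that there are a $G$-invariant open neighbourhood $U$ of $e$ and a biholomorphic map $\psi$ of $U$ onto an open subset of $\mathbb C\otimes_{\mathbb R}V_{\mathbb R}$ with $\psi(e)=0$, where $V_{\mathbb R}$ is a finite-dimensional real vector space with a nondegenerate symmetric bilinear form $(\,,)$, such that $\psi$ identifies the action of $G$ on $U$ with the action of the group generated by the reflections $\sigma_x(y)=y-\frac{2(y,x)}{(x,x)}x$, $x\in\Phi$,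 where $\Phi\subset V_{\mathbb R}\setminus\{0\}$ is a finite root system ($(x,x)\neq0$ for $x\in\Phi$; $\sigma_x(\Phi)\subset\Phi$ for $x\in\Phi$; $x,kx\in\Phi$ with $k\in\mathbb R$ implies $k=\pm1$). Fix a system of simple roots $\Psi\subset\Phi$ (linearly independent, every root being a combination of $\Psi$ with all coefficients $\ge0$ or all $\le0$), with set $\Theta$ of simple reflections. For $x\in\Psi$ let $\partial_{\sigma_x}f=(f-f\circ\sigma_x^{-1})/\gamma_x$ on $\mathcal O_e$, where $\gamma_x=(x,\psi(\cdot))$, and for $w\in G$ let $\partial_w=\partial_{\sigma_1}\circ\dots\circ\partial_{\sigma_p}$ for a reduced expression $w=\sigma_1\cdots\sigma_p$, $\sigma_i\in\Theta$ (any choice, fixed for each $w$). \textbf{Theorem.} Let $\mathcal A\subset\mathcal S(\gimel)$ be a subalgebra that preserves $\mathfrak O^G|_W$. Suppose that in every $G$-orbit $\bar\xi\in W/G$ a representative $\tilde\xi$ is chosen whose stabilizer $G_{\tilde\xi}$ is parabolic with respect to $\Theta$, i.e. generated by a subset of $\Theta$. Then $M^*(G,W)$ is an $\mathcal A$-module by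 transposition: there is a unique right $\mathcal A$-module structure, compatible with the vector space structure over $\mathbb C$, with $\langle\alpha\cdot A,F\rangle=\langle\alpha,A(F)\rangle$ for all $A\in\mathcal A$, $\alpha\in M^*(G,W)$, $F\in\mathfrak O^G|_W$. Moreover, the functionals $$F\longmapsto \big(ev_e\circ\partial_w\circ\phi_{\tilde\xi}^{-1}\big)(F_{\tilde\xi})=\big(\partial_w(F_{\tilde\xi}\circ\tilde\xi)\big)(e),\qquad \bar\xi\in W/G,\quad w\in(G/G_{\tilde\xi})^{short},$$ where $(G/G_{\tilde\xi})^{short}$ is the set of elements $w$ of minimal length, with respect to $\Theta$, in their coset $wG_{\tilde\xi}$, define elements of $M^*(G,W)$ and form a basis of this vector space over $\mathbb C$. -/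

import Mathlib

open scoped Manifold ContDiff Topology DirectSum

noncomputable section

namespace LocRefl

/-! ### Germs of holomorphic functions -/

/-- Germs of complex functions along a filter form a complex algebra, with pointwise operations. -/
instance germAlgebra {X : Type*} (l : Filter X) : Algebra ℂ (Filter.Germ l ℂ) :=
  Algebra.ofModule
    (fun r x y => by
      induction x using Filter.Germ.inductionOn
      induction y using Filter.Germ.inductionOn
      rename_i f g
      exact congrArg Filter.Germ.ofFun (funext fun t => smul_mul_assoc r (f t) (g t)))
    (fun r x y => by
      induction x using Filter.Germ.inductionOn
      induction y using Filter.Germ.inductionOn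
      rename_i f g
      exact congrArg Filter.Germ.ofFun (funext fun t => mul_smul_comm r (f t) (g t)))

section Germs

variable (E : Type*) [NormedAddCommGroup E] [NormedSpace ℂ E]
  {V : Type*} [TopologicalSpace V] [ChartedSpace E V]

/-- The germs at `x` of holomorphic functions on the complex manifold `V`, as a subalgebra of the
algebra of germs of all complex functions. -/
def holSubalgebra (x : V) : Subalgebra ℂ (Filter.Germ (𝓝 x) ℂ) where
  carrier := {f | ∃ F : V → ℂ, ContMDiffAt 𝓘(ℂ, E) 𝓘(ℂ) ω F x ∧ (F : Filter.Germ (𝓝 x) ℂ) = f}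
  mul_mem' := by
    rintro _ _ ⟨F, hF, rfl⟩ ⟨F', hF', rfl⟩
    exact ⟨F * F', hF.mul hF', rfl⟩
  add_mem' := by
    rintro _ _ ⟨F, hF, rfl⟩ ⟨F', hF', rfl⟩
    exact ⟨F + F', hF.add hF', rfl⟩
  algebraMap_mem' r := by
    refine ⟨fun _ => r, contMDiffAt_const, ?_⟩
    rw [Algebra.algebraMap_eq_smul_one]
    exact congrArg Filter.Germ.ofFun (funext fun t => (mul_one r).symm)

/-- The algebra `𝒪_x` of germs at `x` of holomorphic functions on the complex manifold `V`. -/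
def HolGerm (x : V) : Type _ := holSubalgebra E x

instance (x : V) : CommRing (HolGerm E x) := (holSubalgebra E x).toCommRing

instance (x : V) : Algebra ℂ (HolGerm E x) := (holSubalgebra E x).algebra

variable {E}

/-- The germ at `x` of a function that is holomorphic at `x`. -/
def germAt {x : V} (F : V → ℂ) (h : ContMDiffAt 𝓘(ℂ, E) 𝓘(ℂ) ω F x) : HolGerm E x :=
  ⟨(F : Filter.Germ (𝓝 x) ℂ), F, h, rfl⟩

/-- The value of a germ at its base point. -/
def ev {x : V} (f : HolGerm E x) : ℂ := Filter.Germ.value f.1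

/-- Composition of germs with a biholomorphic map `T` of `V`: if `T x = y`, a germ `f` at `y`
is sent to the germ `f ∘ T` at `x`. -/
def pull (T : V ≃ₘ^ω⟮𝓘(ℂ, E), 𝓘(ℂ, E)⟯ V) {x y : V} (h : T x = y) :
    HolGerm E y ≃ₐ[ℂ] HolGerm E x :=
  AlgEquiv.ofAlgHom
    { toFun := fun f => ⟨f.1.compTendsto T (h ▸ T.continuous.tendsto x), by
        subst h
        obtain ⟨_, F, hF, rfl⟩ := f
        exact ⟨F ∘ T, hF.comp x (T.contMDiff x), rfl⟩⟩
      map_one' := rfl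
      map_zero' := rfl
      map_mul' := by
        rintro ⟨_, F, hF, rfl⟩ ⟨_, F', hF', rfl⟩
        rfl
      map_add' := by
        rintro ⟨_, F, hF, rfl⟩ ⟨_, F', hF', rfl⟩
        rfl
      commutes' := fun r => rfl }
    { toFun := fun f => ⟨f.1.compTendsto T.symm (by
          have h' : T.symm y = x := by rw [← h]; exact T.symm_apply_apply x
          exact h' ▸ T.symm.continuous.tendsto y), by
        have h' : T.symm y = x := by rw [← h]; exact T.symm_apply_apply x
        subst h'
        obtain ⟨_, F, hF, rfl⟩ := f
        exact ⟨F ∘ T.symm, hF.comp y (T.symm.contMDiff y), rfl⟩⟩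
      map_one' := rfl
      map_zero' := rfl
      map_mul' := by
        rintro ⟨_, F, hF, rfl⟩ ⟨_, F', hF', rfl⟩
        rfl
      map_add' := by
        rintro ⟨_, F, hF, rfl⟩ ⟨_, F', hF', rfl⟩
        rfl
      commutes' := fun r => rfl }
    (AlgHom.ext <| by
      rintro ⟨_, F, hF, rfl⟩
      exact Subtype.ext (congrArg (fun H : V → ℂ => (H : Filter.Germ (𝓝 x) ℂ))
        (funext fun t => congrArg F (T.symm_apply_apply t))))
    (AlgHom.ext <| by
      rintro ⟨_, F, hF, rfl⟩
      exact Subtype.ext (congrArg (fun H : V → ℂ => (H : Filter.Germ (𝓝 y) ℂ))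
        (funext fun t => congrArg F (T.apply_symm_apply t))))

theorem pull_germAt (T : V ≃ₘ^ω⟮𝓘(ℂ, E), 𝓘(ℂ, E)⟯ V) {x y : V} (h : T x = y) (F : V → ℂ)
    (hF : ContMDiffAt 𝓘(ℂ, E) 𝓘(ℂ) ω F y) (hF' : ContMDiffAt 𝓘(ℂ, E) 𝓘(ℂ) ω (F ∘ T) x) :
    pull T h (germAt F hF) = germAt (F ∘ T) hF' := rfl

theorem pull_pull (T S U : V ≃ₘ^ω⟮𝓘(ℂ, E), 𝓘(ℂ, E)⟯ V) {x y z : V} (h : T x = y) (h' : S y = z)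
    (h'' : U x = z) (hU : ∀ t, U t = S (T t)) (f : HolGerm E z) :
    pull T h (pull S h' f) = pull U h'' f := by
  obtain ⟨_, F, hF, rfl⟩ := f
  exact Subtype.ext (congrArg (fun H : V → ℂ => (H : Filter.Germ (𝓝 x) ℂ))
    (funext fun t => congrArg F (hU t).symm))

theorem pull_id (T : V ≃ₘ^ω⟮𝓘(ℂ, E), 𝓘(ℂ, E)⟯ V) {x : V} (h : T x = x) (hT : ∀ t, T t = t)
    (f : HolGerm E x) : pull T h f = f := by
  obtain ⟨_, F, hF, rfl⟩ := f
  exact Subtype.ext (congrArg (fun H : V → ℂ => (H : Filter.Germ (𝓝 x) ℂ))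
    (funext fun t => congrArg F (hT t)))

/-! ### Meromorphic germs and meromorphic functions -/

variable (E) in
/-- The algebra `ℳ_x` of germs of meromorphic functions at `x`: the total ring of fractions
of `𝒪_x`. -/
abbrev MeroGerm (x : V) : Type _ := FractionRing (HolGerm E x)

/-- Composition of meromorphic germs with a biholomorphic map `T` of `V`. -/
def pullMero (T : V ≃ₘ^ω⟮𝓘(ℂ, E), 𝓘(ℂ, E)⟯ V) {x y : V} (h : T x = y) :
    MeroGerm E y ≃ₐ[ℂ] MeroGerm E x :=
  IsLocalization.algEquivOfAlgEquiv (MeroGerm E y) (MeroGerm E x) (pull T h)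
    (MulEquivClass.map_nonZeroDivisors (pull T h))

theorem pullMero_algebraMap (T : V ≃ₘ^ω⟮𝓘(ℂ, E), 𝓘(ℂ, E)⟯ V) {x y : V} (h : T x = y)
    (f : HolGerm E y) :
    pullMero T h (algebraMap _ (MeroGerm E y) f) = algebraMap _ (MeroGerm E x) (pull T h f) :=
  IsLocalization.algEquivOfAlgEquiv_eq _ f

theorem pullMero_pullMero (T S U : V ≃ₘ^ω⟮𝓘(ℂ, E), 𝓘(ℂ, E)⟯ V) {x y z : V} (h : T x = y)
    (h' : S y = z) (h'' : U x = z) (hU : ∀ t, U t = S (T t)) (m : MeroGerm E z) :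
    pullMero T h (pullMero S h' m) = pullMero U h'' m := by
  have key : ((pullMero T h : MeroGerm E y →+* MeroGerm E x).comp
      (pullMero S h' : MeroGerm E z →+* MeroGerm E y)) =
      (pullMero U h'' : MeroGerm E z →+* MeroGerm E x) := by
    refine IsLocalization.ringHom_ext (nonZeroDivisors (HolGerm E z)) (RingHom.ext fun f => ?_)
    change pullMero T h (pullMero S h' (algebraMap _ _ f)) = pullMero U h'' (algebraMap _ _ f)
    rw [pullMero_algebraMap, pullMero_algebraMap, pullMero_algebraMap, pull_pull T S U h h' h'' hU]
  exact RingHom.congr_fun key m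

theorem pullMero_id (T : V ≃ₘ^ω⟮𝓘(ℂ, E), 𝓘(ℂ, E)⟯ V) {x : V} (h : T x = x) (hT : ∀ t, T t = t)
    (m : MeroGerm E x) : pullMero T h m = m := by
  have key : (pullMero T h : MeroGerm E x →+* MeroGerm E x) = RingHom.id _ := by
    refine IsLocalization.ringHom_ext (nonZeroDivisors (HolGerm E x)) (RingHom.ext fun f => ?_)
    change pullMero T h (algebraMap _ _ f) = algebraMap _ _ f
    rw [pullMero_algebraMap, pull_id T h hT]
  exact RingHom.congr_fun key m

variable (E V) in
/-- The algebra of global meromorphic functions on `V`: families of meromorphic germs that are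
locally quotients `p / q` of holomorphic functions, the germs of `q` not being zero divisors. -/
def meroFun : Subalgebra ℂ (Π x : V, MeroGerm E x) where
  carrier := {m | ∀ x, ∃ (U : Set V) (p q : V → ℂ) (hp : ∀ y ∈ U, ContMDiffAt 𝓘(ℂ, E) 𝓘(ℂ) ω p y)
    (hq : ∀ y ∈ U, ContMDiffAt 𝓘(ℂ, E) 𝓘(ℂ) ω q y), IsOpen U ∧ x ∈ U ∧ ∀ y (hy : y ∈ U),
      germAt q (hq y hy) ∈ nonZeroDivisors (HolGerm E y) ∧
      m y * algebraMap _ (MeroGerm E y) (germAt q (hq y hy)) =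
        algebraMap _ (MeroGerm E y) (germAt p (hp y hy))}
  mul_mem' := by
    intro m m' hm hm' x
    obtain ⟨U, p, q, hp, hq, hU, hx, H⟩ := hm x
    obtain ⟨U', p', q', hp', hq', hU', hx', H'⟩ := hm' x
    refine ⟨U ∩ U', p * p', q * q', fun y hy => (hp y hy.1).mul (hp' y hy.2),
      fun y hy => (hq y hy.1).mul (hq' y hy.2), hU.inter hU', ⟨hx, hx'⟩, fun y hy => ?_⟩
    obtain ⟨h1, h2⟩ := H y hy.1
    obtain ⟨h1', h2'⟩ := H' y hy.2
    refine ⟨mul_mem h1 h1', ?_⟩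
    change m y * m' y * algebraMap _ (MeroGerm E y)
      (germAt q (hq y hy.1) * germAt q' (hq' y hy.2)) =
      algebraMap _ (MeroGerm E y) (germAt p (hp y hy.1) * germAt p' (hp' y hy.2))
    rw [map_mul, map_mul, ← h2, ← h2']
    ring
  add_mem' := by
    intro m m' hm hm' x
    obtain ⟨U, p, q, hp, hq, hU, hx, H⟩ := hm x
    obtain ⟨U', p', q', hp', hq', hU', hx', H'⟩ := hm' x
    refine ⟨U ∩ U', p * q' + p' * q, q * q',
      fun y hy => ((hp y hy.1).mul (hq' y hy.2)).add ((hp' y hy.2).mul (hq y hy.1)),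
      fun y hy => (hq y hy.1).mul (hq' y hy.2), hU.inter hU', ⟨hx, hx'⟩, fun y hy => ?_⟩
    obtain ⟨h1, h2⟩ := H y hy.1
    obtain ⟨h1', h2'⟩ := H' y hy.2
    refine ⟨mul_mem h1 h1', ?_⟩
    change (m y + m' y) * algebraMap _ (MeroGerm E y)
      (germAt q (hq y hy.1) * germAt q' (hq' y hy.2)) =
      algebraMap _ (MeroGerm E y) (germAt p (hp y hy.1) * germAt q' (hq' y hy.2) +
        germAt p' (hp' y hy.2) * germAt q (hq y hy.1))
    rw [map_add, map_mul, map_mul, map_mul, ← h2, ← h2']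
    ring
  algebraMap_mem' r := by
    intro x
    refine ⟨Set.univ, fun _ => r, fun _ => 1, fun y _ => contMDiffAt_const,
      fun y _ => contMDiffAt_const, isOpen_univ, trivial, fun y _ => ?_⟩
    have h1 : germAt (E := E) (x := y) (fun _ => (1 : ℂ)) contMDiffAt_const = 1 := rfl
    have h2 : germAt (E := E) (x := y) (fun _ => r) contMDiffAt_const = algebraMap ℂ _ r :=
      Subtype.ext (by
        change _ = algebraMap ℂ (Filter.Germ (𝓝 y) ℂ) r
        rw [Algebra.algebraMap_eq_smul_one]
        exact congrArg (fun H : V → ℂ => (H : Filter.Germ (𝓝 y) ℂ))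
          (funext fun t => (mul_one r).symm))
    refine ⟨by rw [h1]; exact one_mem _, ?_⟩
    rw [h1, h2, map_one, mul_one]
    exact IsScalarTower.algebraMap_apply ℂ (HolGerm E y) (MeroGerm E y) r

end Germs

/-! ### Translations and the skew-group ring -/

section Skew

variable {E : Type*} [NormedAddCommGroup E] [NormedSpace ℂ E]
  {V : Type*} [Group V] [TopologicalSpace V] [ChartedSpace E V] [LieGroup 𝓘(ℂ, E) ω V]

variable (E) in
/-- Left translation `x ↦ ξ x` of the complex Lie group `V`. -/
def leftTrans (ξ : V) : V ≃ₘ^ω⟮𝓘(ℂ, E), 𝓘(ℂ, E)⟯ V where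
  toEquiv := Equiv.mulLeft ξ
  contMDiff_toFun := contMDiff_mul_left
  contMDiff_invFun := contMDiff_mul_left (a := ξ⁻¹)

theorem leftTrans_one (ξ : V) : leftTrans E ξ 1 = ξ := mul_one ξ

theorem leftTrans_inv_apply (ξ x : V) : leftTrans E ξ⁻¹ x = ξ⁻¹ * x := rfl

/-- The translation `φ_ξ` on families of meromorphic germs: the germ of `φ_ξ F` at `x` is
`F_{ξ⁻¹ x} ∘ ξ⁻¹`. -/
def phi (ξ : V) (F : Π x : V, MeroGerm E x) (x : V) : MeroGerm E x :=
  pullMero (x := x) (y := ξ⁻¹ * x) (leftTrans E ξ⁻¹) (leftTrans_inv_apply ξ x) (F (ξ⁻¹ * x))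

theorem phi_one (F : Π x : V, MeroGerm E x) : phi 1 F = F := by
  funext x
  have aux : ∀ (z : V) (hz : leftTrans E (1 : V)⁻¹ x = z), z = x →
      pullMero (x := x) (y := z) (leftTrans E (1 : V)⁻¹) hz (F z) = F x := by
    rintro z hz rfl
    exact pullMero_id _ _ (fun t => by rw [leftTrans_inv_apply, inv_one, one_mul]) _
  exact aux _ _ (by rw [inv_one, one_mul])

theorem phi_mul (ξ η : V) (F : Π x : V, MeroGerm E x) : phi (ξ * η) F = phi ξ (phi η F) := by
  funext x
  have aux : ∀ (z : V) (hz : leftTrans E (ξ * η)⁻¹ x = z) (_ : z = η⁻¹ * (ξ⁻¹ * x)),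
      pullMero (x := x) (y := z) (leftTrans E (ξ * η)⁻¹) hz (F z) = phi ξ (phi η F) x := by
    rintro z hz rfl
    refine (pullMero_pullMero _ _ _ _ _ _ (fun t => ?_) _).symm
    simp only [leftTrans_inv_apply]
    group
  exact aux _ _ (by group)

theorem phi_mem (ξ : V) (m : meroFun E V) : phi ξ m.1 ∈ meroFun E V := by
  intro x
  obtain ⟨U, p, q, hp, hq, hU, hx, H⟩ := m.2 (ξ⁻¹ * x)
  refine ⟨leftTrans E ξ⁻¹ ⁻¹' U, p ∘ leftTrans E ξ⁻¹, q ∘ leftTrans E ξ⁻¹,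
    fun y hy => (hp _ hy).comp y ((leftTrans E ξ⁻¹).contMDiff y),
    fun y hy => (hq _ hy).comp y ((leftTrans E ξ⁻¹).contMDiff y),
    hU.preimage (leftTrans E ξ⁻¹).continuous, hx, fun y hy => ?_⟩
  obtain ⟨h1, h2⟩ := H (ξ⁻¹ * y) hy
  refine ⟨?_, ?_⟩
  · have := MulEquivClass.map_nonZeroDivisors
      (pull (E := E) (x := y) (y := ξ⁻¹ * y) (leftTrans E ξ⁻¹) (leftTrans_inv_apply ξ y))
    rw [← this]
    exact ⟨_, h1, rfl⟩
  · have := congrArg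
      (pullMero (x := y) (y := ξ⁻¹ * y) (leftTrans E ξ⁻¹) (leftTrans_inv_apply ξ y)) h2
    rw [map_mul, pullMero_algebraMap, pullMero_algebraMap] at this
    exact this

/-- The action of `V` on the meromorphic functions on `V` by translations `φ_ξ`. -/
instance : MulSemiringAction V (meroFun E V) where
  smul ξ m := ⟨phi ξ m.1, phi_mem ξ m⟩
  one_smul m := Subtype.ext (phi_one m.1)
  mul_smul ξ η m := Subtype.ext (phi_mul ξ η m.1)
  smul_zero ξ := Subtype.ext <| funext fun x =>
    map_zero (pullMero (x := x) (y := ξ⁻¹ * x) (leftTrans E ξ⁻¹) (leftTrans_inv_apply ξ x))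
  smul_add ξ _ _ := Subtype.ext <| funext fun x =>
    map_add (pullMero (x := x) (y := ξ⁻¹ * x) (leftTrans E ξ⁻¹) (leftTrans_inv_apply ξ x)) _ _
  smul_one ξ := Subtype.ext <| funext fun x =>
    map_one (pullMero (x := x) (y := ξ⁻¹ * x) (leftTrans E ξ⁻¹) (leftTrans_inv_apply ξ x))
  smul_mul ξ _ _ := Subtype.ext <| funext fun x =>
    map_mul (pullMero (x := x) (y := ξ⁻¹ * x) (leftTrans E ξ⁻¹) (leftTrans_inv_apply ξ x)) _ _

instance : SMulCommClass V ℂ (meroFun E V) where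
  smul_comm ξ c _ := Subtype.ext <| funext fun x =>
    map_smul (pullMero (x := x) (y := ξ⁻¹ * x) (leftTrans E ξ⁻¹) (leftTrans_inv_apply ξ x)) c _

instance (Gim : Subgroup V) : SMulCommClass Gim ℂ (meroFun E V) where
  smul_comm ξ c m := smul_comm (ξ : V) c m

variable (E) in
/-- The skew-group ring `𝒮(ℷ)` of finite sums `∑ f_i φ_{ξ_i}`, with `f_i` meromorphic on `V` and
`ξ_i ∈ ℷ`, with product `f φ_ξ ∘ f' φ_ξ' = f φ_ξ(f') φ_{ξ ξ'}`. -/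
abbrev SkewRing (Gim : Subgroup V) : Type _ := SkewMonoidAlgebra (meroFun E V) Gim

/-- The action of `𝒮(ℷ)` on families of meromorphic germs: `f φ_ξ` sends `F` to `f ⬝ φ_ξ(F)`. -/
def skewAct {Gim : Subgroup V} (A : SkewRing E Gim) (F : Π x : V, MeroGerm E x) :
    Π x : V, MeroGerm E x :=
  A.sum fun ξ f => f.1 * phi (ξ : V) F

end Skew

/-! ### Invariant germs, the fibration and the spaces `M*` -/

section Invariants

/-- The group `G` acts on the complex manifold `V` by holomorphic maps. -/
class HolAction (E : Type*) [NormedAddCommGroup E] [NormedSpace ℂ E] (G V : Type*)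
    [TopologicalSpace V] [ChartedSpace E V] [SMul G V] : Prop where
  contMDiff_smul (g : G) : ContMDiff 𝓘(ℂ, E) 𝓘(ℂ, E) ω fun x : V => g • x

variable (E : Type*) [NormedAddCommGroup E] [NormedSpace ℂ E]
  {G : Type*} [Group G]
  {V : Type*} [Group V] [TopologicalSpace V] [ChartedSpace E V] [LieGroup 𝓘(ℂ, E) ω V]
  [MulDistribMulAction G V] [HolAction E G V]

/-- The biholomorphic map `x ↦ g ⬝ x`. -/
def groupMap (g : G) : V ≃ₘ^ω⟮𝓘(ℂ, E), 𝓘(ℂ, E)⟯ V where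
  toEquiv := MulAction.toPerm g
  contMDiff_toFun := HolAction.contMDiff_smul g
  contMDiff_invFun := HolAction.contMDiff_smul g⁻¹

variable (G) in
/-- A family of holomorphic germs is `G`-invariant: `F_{g x} ∘ g = F_x` for all `g` and `x`. -/
def IsInvariant (F : Π x : V, HolGerm E x) : Prop :=
  ∀ (g : G) (x y : V) (h : groupMap E g x = y), pull (groupMap E g) h (F y) = F x

variable (G) in
/-- `𝔒^G|_W`: finitely supported `G`-invariant families of holomorphic germs supported in `W`. -/
def invSections (W : Set V) : Submodule ℂ (Π x : V, HolGerm E x) where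
  carrier := {F | IsInvariant E G F ∧ {x | F x ≠ 0}.Finite ∧ ∀ x, x ∉ W → F x = 0}
  zero_mem' := ⟨fun g x y h => map_zero (pull (groupMap E g) h), by simp, fun _ _ => rfl⟩
  add_mem' := by
    rintro F F' ⟨h1, h2, h3⟩ ⟨h1', h2', h3'⟩
    refine ⟨fun g x y h => ?_, (h2.union h2').subset fun x hx => ?_, fun x hx => ?_⟩
    · change pull (groupMap E g) h (F y + F' y) = F x + F' x
      rw [map_add, h1, h1']
    · by_contra hc
      simp only [Set.mem_union, Set.mem_ofPred_eq, not_or, not_not] at hc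
      exact hx (by rw [Pi.add_apply, hc.1, hc.2, add_zero])
    · rw [Pi.add_apply, h3 x hx, h3' x hx, add_zero]
  smul_mem' := by
    rintro c F ⟨h1, h2, h3⟩
    refine ⟨fun g x y h => ?_, h2.subset fun x hx => ?_, fun x hx => ?_⟩
    · change pull (groupMap E g) h (c • F y) = c • F x
      rw [map_smul, h1]
    · intro hc
      exact hx (by rw [Pi.smul_apply, hc, smul_zero])
    · rw [Pi.smul_apply, h3 x hx, smul_zero]

variable {E} in
/-- A family of holomorphic germs, viewed as a family of meromorphic germs. -/
def toMero (F : Π x : V, HolGerm E x) : Π x : V, MeroGerm E x :=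
  fun x => algebraMap (HolGerm E x) (MeroGerm E x) (F x)

variable (G) in
/-- `A ∈ 𝒮(ℷ)` maps `𝔒^G|_W` to itself. -/
def Preserves {Gim : Subgroup V} (W : Set V) (A : SkewRing E Gim) : Prop :=
  ∀ F ∈ invSections E G W, ∃ F' ∈ invSections E G W, skewAct A (toMero F) = toMero F'

variable (G) in
/-- The algebra `𝒪^G_ξ` of the germs at `ξ` of `G`-invariant families of germs. -/
def invGerm (ξ : V) : Subalgebra ℂ (HolGerm E ξ) where
  carrier := {f | ∃ F : Π x : V, HolGerm E x, IsInvariant E G F ∧ F ξ = f}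
  mul_mem' := by
    rintro _ _ ⟨F, hF, rfl⟩ ⟨F', hF', rfl⟩
    refine ⟨F * F', fun g x y h => ?_, rfl⟩
    change pull (groupMap E g) h (F y * F' y) = F x * F' x
    rw [map_mul, hF, hF']
  add_mem' := by
    rintro _ _ ⟨F, hF, rfl⟩ ⟨F', hF', rfl⟩
    refine ⟨F + F', fun g x y h => ?_, rfl⟩
    change pull (groupMap E g) h (F y + F' y) = F x + F' x
    rw [map_add, hF, hF']
  algebraMap_mem' r :=
    ⟨fun x => algebraMap ℂ _ r, fun g x y h => AlgEquiv.commutes (pull (groupMap E g) h) r, rfl⟩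

variable (G) in
/-- The ideal of `𝒪^G_ξ` generated by the elements of the form `φ_ξ(f)`, i.e. `f ∘ ξ⁻¹`, where
`f` is a `G`-invariant germ at the identity with `f(e) = 0`. -/
def fibreIdeal (ξ : V) : Ideal (invGerm E G ξ) :=
  Ideal.span {f | ∃ f' ∈ invGerm E G (1 : V), ev f' = 0 ∧
    pull (leftTrans E ξ) (leftTrans_one ξ) (f : HolGerm E ξ) = f'}

variable (G) in
/-- The fibre `𝔼_ξ`. -/
abbrev Fibre (ξ : V) : Type _ := invGerm E G ξ ⧸ fibreIdeal E G ξ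

/-- `G` acts on invariant germs: for `g ξ = η`, the map `𝒪^G_η → 𝒪^G_ξ`, `f ↦ f ∘ g`. -/
def pullInv (g : G) {ξ η : V} (h : g • ξ = η) : invGerm E G η →ₐ[ℂ] invGerm E G ξ :=
  ((pull (groupMap E g) h : HolGerm E η →ₐ[ℂ] HolGerm E ξ).comp (invGerm E G η).val).codRestrict
    (invGerm E G ξ) (by
      rintro ⟨_, F, hF, rfl⟩
      exact ⟨F, hF, (hF g ξ η h).symm⟩)

/-- `G` acts on the fibration: for `g ξ = η`, the map `𝔼_η → 𝔼_ξ` induced by `f ↦ f ∘ g`. -/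
def fibreMap (g : G) {ξ η : V} (h : g • ξ = η) : Fibre E G η →ₐ[ℂ] Fibre E G ξ :=
  Ideal.quotientMapₐ (fibreIdeal E G ξ) (pullInv E g h) (by
    refine Ideal.span_le.2 ?_
    rintro f ⟨f', ⟨F, hF, rfl⟩, h0, hf⟩
    refine Ideal.subset_span ⟨F 1, ⟨F, hF, rfl⟩, h0, ?_⟩
    have h1 : groupMap E g (1 : V) = 1 := smul_one g
    have h3 : ((leftTrans E ξ).trans (groupMap E g)) 1 = η := by
      rw [← h]
      exact congrArg (g • ·) (mul_one ξ)
    calc pull (leftTrans E ξ) (leftTrans_one ξ) (pull (groupMap E g) h (f : HolGerm E η))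
        = pull ((leftTrans E ξ).trans (groupMap E g)) h3 (f : HolGerm E η) :=
          pull_pull _ _ _ _ _ _ (fun t => rfl) _
      _ = pull (groupMap E g) h1 (pull (leftTrans E η) (leftTrans_one η) (f : HolGerm E η)) :=
          (pull_pull _ _ _ _ _ _ (fun t => by rw [← h]; exact smul_mul' g ξ t) _).symm
      _ = pull (groupMap E g) h1 (F 1) := by rw [hf]
      _ = F 1 := hF g 1 1 h1)

/-- `𝔼^G_ξ̄`, for a `G`-orbit `ξ̄` in `V`: the `G`-invariant elements of the direct sum of the
fibres over the points of the orbit. -/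
def fibreInv (o : MulAction.orbitRel.Quotient G V) :
    Submodule ℂ (Π x : o.orbit, Fibre E G (x : V)) where
  carrier := {e | ∀ (g : G) (x y : o.orbit) (h : g • (x : V) = y), fibreMap E g h (e y) = e x}
  zero_mem' := fun g x y h => map_zero (fibreMap E g h)
  add_mem' := by
    intro e e' he he' g x y h
    change fibreMap E g h (e y + e' y) = e x + e' x
    rw [map_add, he, he']
  smul_mem' := by
    intro c e he g x y h
    change fibreMap E g h (c • e y) = c • e x
    rw [map_smul, he]

variable (G) in
/-- `W / G`: the `G`-orbits contained in `W`. -/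
abbrev OrbitsIn (W : Set V) : Type _ := {o : MulAction.orbitRel.Quotient G V // o.orbit ⊆ W}

variable (G) in
/-- `M*(G, W)`: the direct sum over the orbits `ξ̄ ∈ W / G` of the dual spaces `(𝔼^G_ξ̄)*`. -/
def MStar (W : Set V) : Type _ :=
  ⨁ o : OrbitsIn G W, Module.Dual ℂ (fibreInv E o.1)

instance (W : Set V) : AddCommGroup (MStar E G W) :=
  inferInstanceAs (AddCommGroup (⨁ o : OrbitsIn G W, Module.Dual ℂ (fibreInv E o.1)))

instance (W : Set V) : Module ℂ (MStar E G W) :=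
  inferInstanceAs (Module ℂ (⨁ o : OrbitsIn G W, Module.Dual ℂ (fibreInv E o.1)))

variable (G) in
/-- The projection `𝔒^G|_W → 𝔼^G_ξ̄`. -/
def toFibre (W : Set V) (o : MulAction.orbitRel.Quotient G V) :
    invSections E G W →ₗ[ℂ] fibreInv E o where
  toFun F := ⟨fun x => Ideal.Quotient.mk (fibreIdeal E G (x : V)) ⟨F.1 x, F.1, F.2.1, rfl⟩,
    fun g x y h => congrArg (Ideal.Quotient.mk (fibreIdeal E G (x : V)))
      (Subtype.ext (F.2.1 g x y h))⟩
  map_add' _ _ := rfl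
  map_smul' _ _ := rfl

open Classical in
variable (G) in
/-- The value of an element of `M*(G, W)` on an element of `𝔒^G|_W`. -/
def pairing (W : Set V) : MStar E G W →ₗ[ℂ] invSections E G W →ₗ[ℂ] ℂ :=
  DirectSum.toModule ℂ (OrbitsIn G W) _ fun o => (toFibre E G W o.1).dualMap

end Invariants

/-- The set `(G ⋉ ℷ) ⬝ v`. -/
def semiOrbit (G : Type*) {V : Type*} [Group G] [Group V] [MulDistribMulAction G V]
    (Gim : Subgroup V) (v : V) : Set V :=
  {x | ∃ ξ ∈ Gim, ∃ g : G, x = ξ * g • v}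

/-! ### Local reflection groups and divided differences -/

/-- The structure of a local reflection group on a group `G` acting on the complex Lie group `V`,
together with a system of simple roots.  The real vector space `realForm` carries the root system,
the model space `E` is its complexification, and near the identity of `V` the action of `G`
is identified with that of the reflection group of the root system. -/
structure LocalReflectionGroup (E : Type*) [NormedAddCommGroup E] [NormedSpace ℂ E]
    (G V : Type*) [Group G] [Group V] [TopologicalSpace V] [ChartedSpace E V]
    [MulDistribMulAction G V] where
  /-- the real vector space whose complexification is `E` -/
  realForm : Submodule ℝ E
  existsUnique_re_im (z : E) : ∃! p : realForm × realForm, z = (p.1 : E) + Complex.I • (p.2 : E)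
  /-- the complex bilinear extension of a nondegenerate symmetric form on `realForm` -/
  form : LinearMap.BilinForm ℂ E
  form_symm : ∀ x y, form x y = form y x
  form_nondegenerate : form.Nondegenerate
  form_real : ∀ x ∈ realForm, ∀ y ∈ realForm, (form x y).im = 0
  /-- the root system -/
  roots : Set E
  roots_finite : roots.Finite
  roots_real : roots ⊆ realForm
  roots_ne_zero : ∀ x ∈ roots, x ≠ 0
  form_root_ne_zero : ∀ x ∈ roots, form x x ≠ 0
  reflection_mem : ∀ x ∈ roots, ∀ y ∈ roots, y - (2 * form y x / form x x) • x ∈ roots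
  eq_one_or_neg_one : ∀ x ∈ roots, ∀ k : ℝ, k • x ∈ roots → k = 1 ∨ k = -1
  /-- the simple roots -/
  simple : Set E
  simple_subset : simple ⊆ roots
  simple_linearIndependent : LinearIndependent ℝ (fun x : simple => (x : E))
  pos_or_neg : ∀ x ∈ roots, ∃ c : simple →₀ ℝ, x = c.sum (fun y a => a • (y : E)) ∧
    ((∀ y, 0 ≤ c y) ∨ (∀ y, c y ≤ 0))
  /-- the identification of `G` with the group generated by the reflections in the roots -/
  lin : G →* (E ≃ₗ[ℂ] E)
  lin_injective : Function.Injective lin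
  /-- the element of `G` that acts as the reflection in a root `x`; it has no meaning if `x` is
  not a root -/
  refl : E → G
  lin_refl : ∀ x ∈ roots, ∀ y, lin (refl x) y = y - (2 * form y x / form x x) • x
  closure_refl : Subgroup.closure (refl '' roots) = ⊤
  /-- the coordinates on an invariant neighbourhood of the identity -/
  chart : OpenPartialHomeomorph V E
  one_mem_source : (1 : V) ∈ chart.source
  chart_one : chart 1 = 0
  contMDiffOn_chart : ContMDiffOn 𝓘(ℂ, E) 𝓘(ℂ, E) ω chart chart.source
  contMDiffOn_chart_symm : ContMDiffOn 𝓘(ℂ, E) 𝓘(ℂ, E) ω chart.symm chart.target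
  smul_mem_source : ∀ (g : G), ∀ x ∈ chart.source, g • x ∈ chart.source
  chart_smul : ∀ (g : G), ∀ x ∈ chart.source, chart (g • x) = lin g (chart x)

namespace LocalReflectionGroup

variable {E : Type*} [NormedAddCommGroup E] [NormedSpace ℂ E]
  {G V : Type*} [Group G] [Group V] [TopologicalSpace V] [ChartedSpace E V]
  [MulDistribMulAction G V] (D : LocalReflectionGroup E G V)

/-- `l` is an expression of `w` as a product of simple reflections. -/
def IsWord (l : List E) (w : G) : Prop := (∀ x ∈ l, x ∈ D.simple) ∧ (l.map D.refl).prod = w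

/-- The length of `w` with respect to the simple reflections. -/
def length (w : G) : ℕ := sInf {n | ∃ l, D.IsWord l w ∧ l.length = n}

/-- `l` is a reduced expression of `w` as a product of simple reflections. -/
def IsReducedWord (l : List E) (w : G) : Prop := D.IsWord l w ∧ l.length = D.length w

/-- `H` is a (standard) parabolic subgroup: it is generated by simple reflections. -/
def IsParabolic (H : Subgroup G) : Prop := ∃ I ⊆ D.simple, H = Subgroup.closure (D.refl '' I)

/-- `w` is a shortest representative of its coset `w H`. -/
def IsShort (H : Subgroup G) (w : G) : Prop := ∀ h ∈ H, D.length w ≤ D.length (w * h)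

/-- The germ at the identity of the linear function `γ_x(y) = (x, y)`. -/
def gamma [FiniteDimensional ℂ E] (x : E) : HolGerm E (1 : V) :=
  germAt (fun u => D.form x (D.chart u)) (by
    have h1 : ContMDiffAt 𝓘(ℂ, E) 𝓘(ℂ, E) ω D.chart (1 : V) :=
      (D.contMDiffOn_chart 1 D.one_mem_source).contMDiffAt
        (D.chart.open_source.mem_nhds D.one_mem_source)
    exact (LinearMap.toContinuousLinearMap (D.form x)).contMDiff.contMDiffAt.comp 1 h1)

variable [FiniteDimensional ℂ E] [LieGroup 𝓘(ℂ, E) ω V] [HolAction E G V]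

open Classical in
/-- The divided difference `∂_{σ_x} f = (f - σ_x ⬝ f) / γ_x` of a holomorphic germ at the identity,
where `σ ⬝ f = f ∘ σ⁻¹`.  Since `f - σ_x ⬝ f` vanishes on the mirror `γ_x = 0`, the quotient
exists for every root `x`, and it is unique because germs of holomorphic functions have no
zero divisors. -/
def dividedDiff (x : E) (f : HolGerm E (1 : V)) : HolGerm E (1 : V) :=
  if h : ∃ k, D.gamma x * k =
      f - pull (groupMap E (D.refl x)⁻¹) (smul_one (D.refl x)⁻¹) f then h.choose else 0

/-- The composition `∂_{σ_1} ∘ ⋯ ∘ ∂_{σ_p}` of divided differences along an expression. -/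
def dividedDiffWord (l : List E) (f : HolGerm E (1 : V)) : HolGerm E (1 : V) :=
  l.foldr D.dividedDiff f

/-- The functional `ev_e ∘ ∂_w ∘ φ_ξ⁻¹` on germs at `ξ`, i.e. `f ↦ (∂_w (f ∘ ξ))(e)`, for an
element `w` that is given by an expression in the simple reflections. -/
def functional (l : List E) (ξ : V) (f : HolGerm E ξ) : ℂ :=
  ev (D.dividedDiffWord l (pull (leftTrans E ξ) (leftTrans_one ξ) f))

end LocalReflectionGroup

end LocRefl

end

/-!
The functionals `ev_e ∘ ∂_w`, `w ∈ G`, are treated as coordinates on the coinvariants of `𝒪_e`,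
and everything else is reduced to them.

*Divided differences.*  The exchange property of the reflection group (`strong_exchange`), and the
description of the deletions of letters of a reduced word by the positive roots that its product
makes negative (`nodup_and_mem_deletions`), are obtained from the action on the roots.  The Leibniz
rule for the multiplication by a linear form (`dividedDiffWord_linForm_mul`) then shows that, for two
reduced words with the same product, the difference of the two operators `∂` commutes with the
linear forms up to a twist and annihilates the constants.  Such an operator vanishes
(`eq_zero_of_twisted`), because by Hadamard's lemma its values vanish to every order.  So `∂_w`
depends on `w` only, and `∂_l = 0` for words `l` that are not reduced (`dividedDiffWord_aux`).
No braid relations are needed, and no description of the subgroups of rank two.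

*The local algebra.*  The functionals `ev_e ∘ ∂_w` are linearly independent
(`eq_zero_of_sum_mul_ev_eq_zero`): by descending induction on the length this comes down to the
longest element, for which `∂_w` does not vanish on a power of a linear form that is positive on the
positive roots.  Hence there are germs `b_u` with `ev_e (∂_w b_u) = δ_{wu}`.  The matrix
`(∂_w b_u)` is invertible over the local ring `𝒪_e`, so every germ is `f = ∑ a_u b_u`, and the `a_u`
are invariant since `∂_x` of this system of equations is again part of the system
(`exists_eq_sum_invariant_mul`).  For a parabolic subgroup `H`, the functionals for the shortest
representatives of the cosets `w H` are independent on the `H`-invariants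
(`exists_invariant_ev_eq`), by an application of the divided difference of the longest element of
`H` to the germs `b_u`.  The `H`-invariants that they annihilate lie in the ideal generated by the
`G`-invariant germs vanishing at `e` (`exists_eq_sum_of_ev_eq_zero`), by averaging the expression
`∑ a_u b_u` over `H`.

*The fibres.*  By translation to `e`, the algebra `𝒪^G_ξ` is identified with the invariants of the
stabilizer of `ξ`, and `𝔼_ξ` with their quotient by that ideal.  If the stabilizer is parabolic,
the functionals are therefore a basis of the dual space of `𝔼^G` over the orbit of `ξ`
(`exists_dual_basis`).

*Transposition.*  As functionals on `𝔒^G|_W`, the elements of `M*(G, W)` are exactly those that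
factor through finitely many fibres (`mem_range_pairing_iff`), and they are determined by their
values (`pairing_injective`).  Skew operators are linear over the translates of the `G`-invariant
germs at `e` (`skewAct_translates_mul`), and a value of `A F` depends on finitely many values of
`F`.  Thus the component of `A F` in a fibre depends on the components of `F` in finitely many
fibres (`fibreAt_eq_zero_of_commute`), so the composition with `A` preserves `M*(G, W)`.
-/

noncomputable section

namespace LocRefl

/-! ### Division of analytic functions by linear forms -/

section Analytic

variable {E : Type*} [NormedAddCommGroup E] [NormedSpace ℂ E]

/-- The homogeneous parts of the quotient `(f ∘ A - f ∘ B) / γ`, where `p` is the power series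
of `f` and `A - B = γ ⊗ u`: the telescoping sum for `p (A y, …, A y) - p (B y, …, B y)`, with the
difference `A y - B y` replaced by `u`. -/
def quotientSeries (p : FormalMultilinearSeries ℂ E ℂ) (A B : E →L[ℂ] E) (u : E) :
    FormalMultilinearSeries ℂ E ℂ := fun n =>
  ∑ j : Fin (n + 1), ((p (n + 1)).curryMid j u).compContinuousLinearMap
    (fun i : Fin n => if i.castSucc < j then B else A)

theorem smul_quotientSeries_apply (p : FormalMultilinearSeries ℂ E ℂ) (A B : E →L[ℂ] E) (u : E)
    (c : ℂ) (y : E) (h : A y - B y = c • u) (n : ℕ) :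
    c * quotientSeries p A B u n (fun _ => y) =
      p (n + 1) (fun _ => A y) - p (n + 1) (fun _ => B y) := by
  set t : ℕ → Fin (n + 1) → E := fun j i => if (i : ℕ) < j then B y else A y with ht
  have key : ∀ j : Fin (n + 1),
      c * ((p (n + 1)).curryMid j u).compContinuousLinearMap
        (fun i : Fin n => if i.castSucc < j then B else A) (fun _ => y) =
      p (n + 1) (t j) - p (n + 1) (t (j + 1)) := by
    intro j
    set m : Fin n → E := fun i => if i.castSucc < j then B y else A y with hm
    have h1 : ((p (n + 1)).curryMid j u).compContinuousLinearMap
        (fun i : Fin n => if i.castSucc < j then B else A) (fun _ => y) =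
        p (n + 1) (j.insertNth u m) := by
      rw [ContinuousMultilinearMap.compContinuousLinearMap_apply,
        ContinuousMultilinearMap.curryMid_apply]
      congr 2
      funext i
      simp only [hm]
      split_ifs <;> rfl
    have h2 : t j = j.insertNth (A y) m := by
      funext i
      induction i using j.succAboveCases with
      | x => simp [ht]
      | p i =>
        simp only [ht, hm, Fin.insertNth_apply_succAbove]
        congr 1
        exact propext (Fin.succAbove_lt_iff_castSucc_lt j i)
    have h3 : t (j + 1) = j.insertNth (B y) m := by
      funext i
      induction i using j.succAboveCases with
      | x => simp [ht]
      | p i =>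
        simp only [ht, hm, Fin.insertNth_apply_succAbove]
        congr 1
        rw [← Fin.succAbove_lt_iff_castSucc_lt, Fin.lt_def, Nat.lt_succ_iff]
        have : ((j.succAbove i : Fin (n + 1)) : ℕ) ≠ j := fun h =>
          Fin.succAbove_ne j i (Fin.ext h)
        exact propext ⟨fun h => lt_of_le_of_ne h this, fun h => h.le⟩
    rw [h1, h2, h3]
    have h4 : ∀ z, p (n + 1) (j.insertNth z m) = (p (n + 1)).curryMid j z m := fun z => rfl
    rw [h4, h4, h4, ← sub_apply, ← map_sub, h, map_smul,
      smul_apply, smul_eq_mul]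
  rw [quotientSeries, sum_apply, Finset.mul_sum,
    Finset.sum_congr rfl (fun j _ => key j),
    Fin.sum_univ_eq_sum_range (fun j => p (n + 1) (t j) - p (n + 1) (t (j + 1))) (n + 1),
    Finset.sum_range_sub']
  congr 2
  funext i
  exact if_pos i.is_lt

theorem quotientSeries_radius_pos (p : FormalMultilinearSeries ℂ E ℂ) (hp : 0 < p.radius)
    (A B : E →L[ℂ] E) (u : E) : 0 < (quotientSeries p A B u).radius := by
  obtain ⟨M, r, hM, hr, hb⟩ := p.le_mul_pow_of_radius_pos hp
  set C : ℝ := ‖A‖ + ‖B‖ + 1 with hC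
  have hC0 : 0 < C := by positivity
  have hq : ∀ n, ‖quotientSeries p A B u n‖ ≤ (M * r * ‖u‖) * (2 * r * C) ^ n := by
    intro n
    have h1 : ∀ j : Fin (n + 1), ‖((p (n + 1)).curryMid j u).compContinuousLinearMap
        (fun i : Fin n => if i.castSucc < j then B else A)‖ ≤ M * r ^ (n + 1) * ‖u‖ * C ^ n := by
      intro j
      refine (ContinuousMultilinearMap.norm_compContinuousLinearMap_le _ _).trans ?_
      have h2 : ‖(p (n + 1)).curryMid j u‖ ≤ M * r ^ (n + 1) * ‖u‖ := by
        refine (ContinuousLinearMap.le_opNorm _ _).trans ?_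
        gcongr
        refine le_trans ?_ (hb (n + 1))
        exact MultilinearMap.mkContinuousLinear_norm_le _ (norm_nonneg _) _
      have h3 : ∏ i : Fin n, ‖(if i.castSucc < j then B else A : E →L[ℂ] E)‖ ≤ C ^ n := by
        refine (Finset.prod_le_prod (fun i _ => norm_nonneg _)
          (g := fun _ => C) fun i _ => ?_).trans (by simp)
        split_ifs
        · linarith [norm_nonneg A]
        · linarith [norm_nonneg B]
      exact mul_le_mul h2 h3 (by positivity) (by positivity)
    calc ‖quotientSeries p A B u n‖ ≤ ∑ j : Fin (n + 1), M * r ^ (n + 1) * ‖u‖ * C ^ n :=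
          (norm_sum_le _ _).trans (Finset.sum_le_sum fun j _ => h1 j)
      _ = (n + 1 : ℕ) * (M * r ^ (n + 1) * ‖u‖ * C ^ n) := by simp
      _ ≤ (2 ^ n : ℕ) * (M * r ^ (n + 1) * ‖u‖ * C ^ n) := by
          gcongr
          exact Nat.lt_two_pow_self
      _ = _ := by rw [mul_pow, mul_pow, Nat.cast_pow]; push_cast; ring
  have hpos : 0 < (2 * r * C)⁻¹ := by positivity
  refine lt_of_lt_of_le ?_ (FormalMultilinearSeries.le_radius_of_bound _ (M * r * ‖u‖)
    (r := ⟨(2 * r * C)⁻¹, hpos.le⟩) fun n => ?_)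
  · exact ENNReal.coe_pos.2 (NNReal.coe_pos.1 hpos)
  · change _ * ((2 * r * C)⁻¹) ^ n ≤ _
    refine (mul_le_mul_of_nonneg_right (hq n) (by positivity)).trans_eq ?_
    rw [mul_assoc, ← mul_pow, mul_inv_cancel₀ (by positivity), one_pow, mul_one]

/-- If the linear maps `A` and `B` differ by an operator `γ ⊗ u` of rank one, then the difference
`f ∘ A - f ∘ B` is divisible by `γ`, for every analytic function `f`.  Both Hadamard's lemma and
the existence of divided differences are instances of this. -/
theorem exists_analyticAt_mul_eq_sub_comp {f : E → ℂ} (hf : AnalyticAt ℂ f 0)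
    (A B : E →L[ℂ] E) (γ : E →L[ℂ] ℂ) (u : E) (h : ∀ y, A y - B y = γ y • u) :
    ∃ k : E → ℂ, AnalyticAt ℂ k 0 ∧ ∀ᶠ y in 𝓝 (0 : E), f (A y) - f (B y) = γ y * k y := by
  obtain ⟨p, hp⟩ := hf
  have hr := quotientSeries_radius_pos p hp.radius_pos A B u
  set q := quotientSeries p A B u with hq
  have hk := q.hasFPowerSeriesOnBall hr
  refine ⟨q.sum, hk.analyticAt, ?_⟩
  have hA : Filter.Tendsto A (𝓝 0) (𝓝 0) := by simpa using A.continuous.tendsto 0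
  have hB : Filter.Tendsto B (𝓝 0) (𝓝 0) := by simpa using B.continuous.tendsto 0
  have e1 := hp.eventually_hasSum
  filter_upwards [hA.eventually e1, hB.eventually e1, hk.eventually_hasSum] with y h1 h2 h3
  rw [zero_add] at h1 h2 h3
  have h4 := (hasSum_nat_add_iff' 1).2 (h1.sub h2)
  have h5 := h3.mul_left (γ y)
  have h6 : (fun n => γ y * q n (fun _ => y)) =
      fun n => p (n + 1) (fun _ => A y) - p (n + 1) (fun _ => B y) :=
    funext fun n => smul_quotientSeries_apply p A B u (γ y) y (h y) n
  rw [h6] at h5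
  have h7 := h4.unique h5
  rw [← h7]
  have h8 : p 0 (fun _ => A y) = p 0 (fun _ => B y) := congrArg _ (funext fun i => i.elim0)
  simp [h8]

/-- An analytic function that vanishes at `0` to every order vanishes near `0`. -/
theorem eventually_eq_zero_of_isBigO_pow {f : E → ℂ} (hf : AnalyticAt ℂ f 0)
    (h : ∀ k : ℕ, f =O[𝓝 0] fun y => ‖y‖ ^ k) : ∀ᶠ y in 𝓝 (0 : E), f y = 0 := by
  obtain ⟨p, hp⟩ := hf
  have hz : ∀ n (y : E), p n (fun _ => y) = 0 := by
    intro n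
    induction n using Nat.strong_induction_on with
    | _ n ih =>
      have h1 := hp.isBigO_sub_partialSum_pow (n + 1)
      have h2 : (fun y => p n fun _ => y) =O[𝓝 0] fun y : E => ‖y‖ ^ (n + 1) := by
        have h3 := (h (n + 1)).sub h1
        refine h3.congr_left fun y => ?_
        rw [zero_add, FormalMultilinearSeries.partialSum, Finset.sum_range_succ,
          Finset.sum_eq_zero fun i hi => ih i (Finset.mem_range.1 hi) y]
        ring
      exact h2.continuousMultilinearMap_apply_eq_zero
  filter_upwards [hp.eventually_hasSum] with y hy
  rw [zero_add] at hy
  simp only [hz] at hy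
  exact hy.unique hasSum_zero

theorem eventually_eq_zero_of_mul_eq_zero {f : E → ℂ} (hf : AnalyticAt ℂ f 0) {γ : E →ₗ[ℂ] ℂ}
    (hγ : γ ≠ 0) (h : ∀ᶠ y in 𝓝 (0 : E), γ y * f y = 0) : ∀ᶠ y in 𝓝 (0 : E), f y = 0 := by
  obtain ⟨u, hu⟩ : ∃ u, γ u ≠ 0 := by
    by_contra! hc
    exact hγ (LinearMap.ext hc)
  filter_upwards [h.eventually_nhds, hf.eventually_analyticAt] with y hy hfy
  by_contra hne
  have h1 : ∀ᶠ z in 𝓝 y, γ z = 0 := by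
    filter_upwards [hy, hfy.continuousAt.eventually_ne hne] with z hz hz'
    exact (mul_eq_zero.1 hz).resolve_right hz'
  have h2 : Filter.Tendsto (fun t : ℂ => y + t • u) (𝓝[≠] 0) (𝓝 y) := by
    have : Continuous fun t : ℂ => y + t • u := by fun_prop
    simpa using (this.tendsto 0).mono_left nhdsWithin_le_nhds
  have h3 := (h2.eventually h1).and (self_mem_nhdsWithin : {(0 : ℂ)}ᶜ ∈ 𝓝[≠] 0)
  obtain ⟨t, ht, ht0⟩ := h3.exists
  rw [map_add, h1.self_of_nhds, zero_add, map_smul, smul_eq_mul] at ht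
  exact (mul_ne_zero ht0 hu) ht

end Analytic

/-! ### The local algebra at the identity -/

section Evaluation

variable {E : Type*} [NormedAddCommGroup E] [NormedSpace ℂ E]
  {V : Type*} [TopologicalSpace V] [ChartedSpace E V]

/-- Evaluation at the base point, as a homomorphism of algebras. -/
def evHom (x : V) : HolGerm E x →ₐ[ℂ] ℂ where
  toFun := ev
  map_one' := rfl
  map_zero' := rfl
  map_mul' := by
    rintro ⟨_, F, hF, rfl⟩ ⟨_, F', hF', rfl⟩
    rfl
  map_add' := by
    rintro ⟨_, F, hF, rfl⟩ ⟨_, F', hF', rfl⟩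
    rfl
  commutes' r := mul_one r

theorem evHom_apply {x : V} (f : HolGerm E x) : evHom x f = ev f := rfl

theorem ev_zero {x : V} : ev (0 : HolGerm E x) = 0 := rfl

theorem ev_one {x : V} : ev (1 : HolGerm E x) = 1 := rfl

theorem isUnit_of_ev_ne_zero {x : V} {f : HolGerm E x} (h : ev f ≠ 0) : IsUnit f := by
  obtain ⟨_, F, hF, rfl⟩ := f
  replace h : F x ≠ 0 := h
  refine IsUnit.of_mul_eq_one (germAt (fun y => (F y)⁻¹) (hF.inv₀ h)) (Subtype.ext ?_)
  refine Filter.Germ.coe_eq.2 ?_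
  filter_upwards [hF.continuousAt.eventually_ne h] with y hy
  exact mul_inv_cancel₀ hy

theorem isUnit_of_evHom_ne_zero {x : V} {f : HolGerm E x} (h : evHom x f ≠ 0) : IsUnit f :=
  isUnit_of_ev_ne_zero h

end Evaluation

section Act

variable {E : Type*} [NormedAddCommGroup E] [NormedSpace ℂ E]
  {G : Type*} [Group G]
  {V : Type*} [Group V] [TopologicalSpace V] [ChartedSpace E V]
  [MulDistribMulAction G V] [HolAction E G V]

/-- The action of `g ∈ G` on the holomorphic germs at the identity, `f ↦ f ∘ g⁻¹`. -/
def act (g : G) : HolGerm E (1 : V) ≃ₐ[ℂ] HolGerm E (1 : V) :=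
  pull (groupMap E g⁻¹) (smul_one g⁻¹)

theorem act_one (f : HolGerm E (1 : V)) : act (1 : G) f = f :=
  pull_id _ _ (fun t => by
    change (1 : G)⁻¹ • t = t
    rw [inv_one, one_smul]) f

theorem act_mul (g h : G) (f : HolGerm E (1 : V)) : act (g * h) f = act g (act h f) :=
  (pull_pull _ _ _ _ _ _ (fun t => by
    change (g * h)⁻¹ • t = h⁻¹ • g⁻¹ • t
    rw [mul_inv_rev, mul_smul]) f).symm

end Act

namespace LocalReflectionGroup

variable {E : Type*} [NormedAddCommGroup E] [NormedSpace ℂ E]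
  {G V : Type*} [Group G] [Group V] [TopologicalSpace V] [ChartedSpace E V]
  [MulDistribMulAction G V] (D : LocalReflectionGroup E G V)

/-- The germ at the identity of `Φ ∘ chart`, for a function `Φ` analytic at `0`. -/
def germOf (Φ : E → ℂ) (h : AnalyticAt ℂ Φ 0) : HolGerm E (1 : V) :=
  germAt (Φ ∘ D.chart) (by
    have h1 : ContMDiffAt 𝓘(ℂ, E) 𝓘(ℂ, E) ω D.chart (1 : V) :=
      D.contMDiffOn_chart.contMDiffAt (D.chart.open_source.mem_nhds D.one_mem_source)
    refine ContMDiffAt.comp 1 ?_ h1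
    rw [D.chart_one]
    exact contMDiffAt_iff_contDiffAt.2 h.contDiffAt)

theorem zero_mem_target : (0 : E) ∈ D.chart.target := by
  rw [← D.chart_one]
  exact D.chart.map_source D.one_mem_source

theorem chart_symm_zero : D.chart.symm 0 = 1 := by
  rw [← D.chart_one]
  exact D.chart.left_inv D.one_mem_source

theorem tendsto_chart : Filter.Tendsto D.chart (𝓝 1) (𝓝 0) := by
  have := D.chart.continuousAt D.one_mem_source
  rwa [ContinuousAt, D.chart_one] at this

theorem tendsto_chart_symm : Filter.Tendsto D.chart.symm (𝓝 0) (𝓝 1) := by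
  have := D.chart.symm.continuousAt (x := 0) D.zero_mem_target
  rwa [ContinuousAt, D.chart_symm_zero] at this

theorem exists_germOf (f : HolGerm E (1 : V)) : ∃ Φ h, f = D.germOf Φ h := by
  obtain ⟨_, F, hF, rfl⟩ := f
  have h1 : ContMDiffAt 𝓘(ℂ, E) 𝓘(ℂ, E) ω D.chart.symm (0 : E) :=
    D.contMDiffOn_chart_symm.contMDiffAt (D.chart.open_target.mem_nhds D.zero_mem_target)
  have h2 : ContMDiffAt 𝓘(ℂ, E) 𝓘(ℂ) ω (F ∘ D.chart.symm) (0 : E) := by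
    refine ContMDiffAt.comp 0 ?_ h1
    rwa [D.chart_symm_zero]
  refine ⟨F ∘ D.chart.symm, (contMDiffAt_iff_contDiffAt.1 h2).analyticAt, Subtype.ext ?_⟩
  refine Filter.Germ.coe_eq.2 ?_
  filter_upwards [D.chart.eventually_left_inverse D.one_mem_source] with y hy
  exact congrArg F hy.symm

theorem germOf_eq_germOf {Φ Ψ : E → ℂ} {h : AnalyticAt ℂ Φ 0} {h' : AnalyticAt ℂ Ψ 0} :
    D.germOf Φ h = D.germOf Ψ h' ↔ ∀ᶠ y in 𝓝 (0 : E), Φ y = Ψ y := by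
  refine ⟨fun H => ?_, fun H => Subtype.ext (Filter.Germ.coe_eq.2 ?_)⟩
  · have H1 : (Φ ∘ D.chart) =ᶠ[𝓝 1] (Ψ ∘ D.chart) :=
      Filter.Germ.coe_eq.1 (congrArg Subtype.val H)
    filter_upwards [D.tendsto_chart_symm.eventually H1,
      D.chart.symm.eventually_left_inverse (x := 0) D.zero_mem_target] with y hy hy'
    simp only [OpenPartialHomeomorph.symm_symm, Function.comp_apply] at hy hy'
    rwa [hy'] at hy
  · exact D.tendsto_chart.eventually H

theorem germOf_mul {Φ Ψ : E → ℂ} (h : AnalyticAt ℂ Φ 0) (h' : AnalyticAt ℂ Ψ 0) :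
    D.germOf Φ h * D.germOf Ψ h' = D.germOf (fun y => Φ y * Ψ y) (h.mul h') := rfl

theorem germOf_add {Φ Ψ : E → ℂ} (h : AnalyticAt ℂ Φ 0) (h' : AnalyticAt ℂ Ψ 0) :
    D.germOf Φ h + D.germOf Ψ h' = D.germOf (fun y => Φ y + Ψ y) (h.add h') := rfl

theorem germOf_sub {Φ Ψ : E → ℂ} (h : AnalyticAt ℂ Φ 0) (h' : AnalyticAt ℂ Ψ 0) :
    D.germOf Φ h - D.germOf Ψ h' = D.germOf (fun y => Φ y - Ψ y) (h.sub h') := rfl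

theorem germOf_zero : D.germOf (fun _ => 0) analyticAt_const = 0 := rfl

theorem ev_germOf {Φ : E → ℂ} (h : AnalyticAt ℂ Φ 0) : ev (D.germOf Φ h) = Φ 0 :=
  congrArg Φ D.chart_one

/-- `f` vanishes at the identity to the order `k`. -/
def VanishesToOrder (k : ℕ) (f : HolGerm E (1 : V)) : Prop :=
  ∃ Φ h, f = D.germOf Φ h ∧ Φ =O[𝓝 0] fun y => ‖y‖ ^ k

variable {D}

theorem VanishesToOrder.zero (k : ℕ) : D.VanishesToOrder k 0 :=
  ⟨fun _ => 0, analyticAt_const, D.germOf_zero.symm, Asymptotics.isBigO_zero _ _⟩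

theorem VanishesToOrder.add {k : ℕ} {f g : HolGerm E (1 : V)} (hf : D.VanishesToOrder k f)
    (hg : D.VanishesToOrder k g) : D.VanishesToOrder k (f + g) := by
  obtain ⟨Φ, h, rfl, H⟩ := hf
  obtain ⟨Ψ, h', rfl, H'⟩ := hg
  exact ⟨_, h.add h', D.germOf_add h h', H.add H'⟩

theorem VanishesToOrder.mul {k l : ℕ} {f g : HolGerm E (1 : V)} (hf : D.VanishesToOrder k f)
    (hg : D.VanishesToOrder l g) : D.VanishesToOrder (k + l) (f * g) := by
  obtain ⟨Φ, h, rfl, H⟩ := hf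
  obtain ⟨Ψ, h', rfl, H'⟩ := hg
  refine ⟨_, h.mul h', D.germOf_mul h h', ?_⟩
  simp only [pow_add]
  exact H.mul H'

variable (D)

theorem vanishesToOrder_zero (f : HolGerm E (1 : V)) : D.VanishesToOrder 0 f := by
  obtain ⟨Φ, h, rfl⟩ := D.exists_germOf f
  refine ⟨Φ, h, rfl, ?_⟩
  simpa using h.continuousAt.norm.isBoundedUnder_le.isBigO_one ℝ

theorem eq_zero_of_vanishesToOrder {f : HolGerm E (1 : V)} (H : ∀ k, D.VanishesToOrder k f) :
    f = 0 := by
  obtain ⟨Φ, h, rfl⟩ := D.exists_germOf f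
  rw [← D.germOf_zero, germOf_eq_germOf]
  refine eventually_eq_zero_of_isBigO_pow h fun k => ?_
  obtain ⟨Ψ, h', he, hO⟩ := H k
  exact (Filter.EventuallyEq.isBigO (germOf_eq_germOf D |>.1 he)).trans hO

variable [FiniteDimensional ℂ E]

theorem _root_.LinearMap.analyticAt_zero (lam : E →ₗ[ℂ] ℂ) : AnalyticAt ℂ lam 0 :=
  (LinearMap.toContinuousLinearMap lam).analyticAt 0

/-- The germ at the identity of a linear form, in the coordinates given by the chart. -/
def linForm (lam : E →ₗ[ℂ] ℂ) : HolGerm E (1 : V) :=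
  D.germOf lam lam.analyticAt_zero

theorem gamma_eq_linForm (x : E) : D.gamma x = D.linForm (D.form x) := rfl

theorem linForm_sub (lam mu : E →ₗ[ℂ] ℂ) :
    D.linForm (lam - mu) = D.linForm lam - D.linForm mu := rfl

theorem linForm_smul (c : ℂ) (lam : E →ₗ[ℂ] ℂ) : D.linForm (c • lam) = c • D.linForm lam := rfl

theorem linForm_neg (lam : E →ₗ[ℂ] ℂ) : D.linForm (-lam) = -D.linForm lam := rfl

theorem ev_linForm (lam : E →ₗ[ℂ] ℂ) : ev (D.linForm lam) = 0 :=
  (D.ev_germOf _).trans (map_zero lam)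

theorem vanishesToOrder_linForm (lam : E →ₗ[ℂ] ℂ) : D.VanishesToOrder 1 (D.linForm lam) := by
  refine ⟨lam, _, rfl, ?_⟩
  simp only [pow_one]
  exact ((LinearMap.toContinuousLinearMap lam).isBigO_id _).trans
    (Asymptotics.isBigO_refl _ _).norm_right

theorem eq_zero_of_linForm_mul_eq_zero {lam : E →ₗ[ℂ] ℂ} (hlam : lam ≠ 0) {f : HolGerm E (1 : V)}
    (h : D.linForm lam * f = 0) : f = 0 := by
  obtain ⟨Φ, hΦ, rfl⟩ := D.exists_germOf f
  rw [linForm, germOf_mul, ← D.germOf_zero, germOf_eq_germOf] at h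
  rw [← D.germOf_zero, germOf_eq_germOf]
  exact eventually_eq_zero_of_mul_eq_zero hΦ hlam h

/-- Division of differences by linear forms, for germs at the identity. -/
theorem exists_linForm_mul_eq_sub {Φ : E → ℂ} (hΦ : AnalyticAt ℂ Φ 0) (A B : E →ₗ[ℂ] E)
    (lam : E →ₗ[ℂ] ℂ) (u : E) (h : ∀ y, A y - B y = lam y • u)
    (hA : AnalyticAt ℂ (Φ ∘ A) 0) (hB : AnalyticAt ℂ (Φ ∘ B) 0) :
    ∃ k, D.linForm lam * k = D.germOf (Φ ∘ A) hA - D.germOf (Φ ∘ B) hB := by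
  obtain ⟨k, hk, H⟩ := exists_analyticAt_mul_eq_sub_comp hΦ (LinearMap.toContinuousLinearMap A)
    (LinearMap.toContinuousLinearMap B) (LinearMap.toContinuousLinearMap lam) u h
  refine ⟨D.germOf k hk, ?_⟩
  rw [linForm, germOf_mul, germOf_sub, germOf_eq_germOf]
  filter_upwards [H] with y hy using hy.symm

theorem analyticAt_comp_linear {Φ : E → ℂ} (hΦ : AnalyticAt ℂ Φ 0) (A : E →ₗ[ℂ] E) :
    AnalyticAt ℂ (Φ ∘ A) 0 := by
  refine AnalyticAt.comp ?_ ((LinearMap.toContinuousLinearMap A).analyticAt 0)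
  rwa [map_zero]

/-- Hadamard's lemma: the maximal ideal of `𝒪_e` is generated by the linear forms. -/
theorem mem_span_linForm {f : HolGerm E (1 : V)} (hf : ev f = 0) :
    f ∈ Ideal.span (Set.range D.linForm) := by
  obtain ⟨Φ, hΦ, rfl⟩ := D.exists_germOf f
  set n := Module.finrank ℂ E
  let b := Module.finBasis ℂ E
  -- `P j` is the projection onto the span of the first `j` vectors of a basis
  let P : ℕ → E →ₗ[ℂ] E := fun j =>
    ∑ i : Fin n, if (i : ℕ) < j then (b.coord i).smulRight (b i) else 0
  have hP0 : P 0 = 0 := by simp [P]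
  have hPn : P n = LinearMap.id := by
    ext y
    simp [P, LinearMap.sum_apply]
  have key : ∀ j, j ≤ n → D.germOf (Φ ∘ P j) (analyticAt_comp_linear hΦ _) -
      D.germOf (Φ ∘ P 0) (analyticAt_comp_linear hΦ _) ∈ Ideal.span (Set.range D.linForm) := by
    intro j
    induction j with
    | zero => intro _; rw [sub_self]; exact zero_mem _
    | succ j ih =>
      intro hj
      have h1 : ∀ y, P (j + 1) y - P j y = b.coord ⟨j, hj⟩ y • b ⟨j, hj⟩ := by
        intro y
        rw [← LinearMap.sub_apply, ← Finset.sum_sub_distrib, LinearMap.sum_apply,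
          Finset.sum_eq_single ⟨j, hj⟩]
        · simp
        · intro i _ hi
          have : (i : ℕ) ≠ j := fun h => hi (Fin.ext h)
          by_cases h2 : (i : ℕ) < j
          · simp [h2, Nat.lt_succ_of_lt h2]
          · simp [h2, show ¬ (i : ℕ) < j + 1 by omega]
        · intro h; exact absurd (Finset.mem_univ _) h
      obtain ⟨k, hk⟩ := D.exists_linForm_mul_eq_sub hΦ (P (j + 1)) (P j) _ _ h1
        (analyticAt_comp_linear hΦ _) (analyticAt_comp_linear hΦ _)
      rw [← sub_add_sub_cancel _ (D.germOf (Φ ∘ P j) (analyticAt_comp_linear hΦ _)), ← hk]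
      exact add_mem (Ideal.mul_mem_right _ _ (Ideal.subset_span ⟨_, rfl⟩))
        (ih (Nat.le_of_succ_le hj))
  have h2 := key n le_rfl
  have h3 : D.germOf (Φ ∘ P 0) (analyticAt_comp_linear hΦ _) = 0 := by
    rw [← D.germOf_zero, germOf_eq_germOf]
    refine Filter.Eventually.of_forall fun y => ?_
    rw [ev_germOf] at hf
    simp [hP0, hf]
  have h4 : D.germOf (Φ ∘ P n) (analyticAt_comp_linear hΦ _) = D.germOf Φ hΦ := by
    rw [germOf_eq_germOf]
    refine Filter.Eventually.of_forall fun y => ?_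
    simp [hPn]
  rwa [h3, h4, sub_zero] at h2

variable [HolAction E G V]

theorem act_germOf (g : G) {Φ : E → ℂ} (hΦ : AnalyticAt ℂ Φ 0) :
    act g (D.germOf Φ hΦ) = D.germOf (Φ ∘ (D.lin g⁻¹ : E →ₗ[ℂ] E))
      (analyticAt_comp_linear hΦ _) := by
  refine Subtype.ext (Filter.Germ.coe_eq.2 ?_)
  filter_upwards [D.chart.open_source.mem_nhds D.one_mem_source] with y hy
  exact congrArg Φ (D.chart_smul g⁻¹ y hy)

theorem act_linForm (g : G) (lam : E →ₗ[ℂ] ℂ) :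
    act g (D.linForm lam) = D.linForm (lam ∘ₗ (D.lin g⁻¹ : E →ₗ[ℂ] E)) := D.act_germOf g _

end LocalReflectionGroup

/-! ### Roots and lengths -/

namespace LocalReflectionGroup

variable {E : Type*} [NormedAddCommGroup E] [NormedSpace ℂ E]
  {G V : Type*} [Group G] [Group V] [TopologicalSpace V] [ChartedSpace E V]
  [MulDistribMulAction G V] (D : LocalReflectionGroup E G V)

theorem simple_linearIndependent_complex : LinearIndependent ℂ (fun x : D.simple => (x : E)) := by
  rw [linearIndependent_iff']
  intro s g hg i hi
  set a : E := ∑ j ∈ s, (g j).re • (j : E) with ha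
  set b : E := ∑ j ∈ s, (g j).im • (j : E) with hb
  have hmem : ∀ r : D.simple → ℝ, ∑ j ∈ s, r j • (j : E) ∈ D.realForm := fun r =>
    sum_mem fun j _ => D.realForm.smul_mem _ (D.roots_real (D.simple_subset j.2))
  have hab : (0 : E) = a + Complex.I • b := by
    rw [← hg, ha, hb, Finset.smul_sum, ← Finset.sum_add_distrib]
    refine Finset.sum_congr rfl fun j _ => ?_
    conv_lhs => rw [← Complex.re_add_im (g j)]
    rw [add_smul, mul_comm, mul_smul, Complex.coe_smul, Complex.coe_smul]
  obtain ⟨p, _, hp⟩ := D.existsUnique_re_im 0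
  have h1 : ((⟨a, hmem _⟩, ⟨b, hmem _⟩) : D.realForm × D.realForm) = (0, 0) :=
    (hp _ hab).trans (hp _ (by simp)).symm
  have h2 : a = 0 := congrArg (fun q : D.realForm × D.realForm => (q.1 : E)) h1
  have h3 : b = 0 := congrArg (fun q : D.realForm × D.realForm => (q.2 : E)) h1
  have li := linearIndependent_iff'.1 D.simple_linearIndependent s
  exact Complex.ext (li _ h2 i hi) (li _ h3 i hi)

theorem exists_coord (y : D.simple) :
    ∃ φ : E →ₗ[ℂ] ℂ, φ y = 1 ∧ ∀ z : D.simple, z ≠ y → φ z = 0 := by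
  set B := Module.Basis.span D.simple_linearIndependent_complex
  obtain ⟨φ, hφ⟩ := LinearMap.exists_extend (B.coord y)
  have h1 : ∀ z : D.simple, φ z = B.repr (B z) y := by
    intro z
    have := LinearMap.congr_fun hφ (B z)
    rw [LinearMap.comp_apply, Submodule.subtype_apply, Module.Basis.coord_apply] at this
    rw [← this, Module.Basis.span_apply]
  refine ⟨φ, ?_, fun z hz => ?_⟩
  · rw [h1, B.repr_self, Finsupp.single_eq_same]
  · rw [h1, B.repr_self, Finsupp.single_eq_of_ne hz.symm]

/-- A complex linear form on `E` that gives the coefficient of the simple root `y` in the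
expansion of a root. -/
def coord (y : D.simple) : E →ₗ[ℂ] ℂ := (D.exists_coord y).choose

theorem coord_self (y : D.simple) : D.coord y y = 1 := (D.exists_coord y).choose_spec.1

theorem coord_of_ne {y z : D.simple} (h : z ≠ y) : D.coord y z = 0 :=
  (D.exists_coord y).choose_spec.2 z h

variable {D}

theorem exists_coord_eq {x : E} (hx : x ∈ D.roots) : ∃ c : D.simple →₀ ℝ,
    x = c.sum (fun y a => a • (y : E)) ∧ ((∀ y, 0 ≤ c y) ∨ (∀ y, c y ≤ 0)) ∧
    ∀ y, D.coord y x = c y := by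
  obtain ⟨c, hc, hs⟩ := D.pos_or_neg x hx
  refine ⟨c, hc, hs, fun y => ?_⟩
  rw [hc, map_finsuppSum, Finsupp.sum, Finset.sum_eq_single y]
  · rw [← Complex.coe_smul, map_smul, coord_self, smul_eq_mul, mul_one]
  · intro z _ hz
    rw [← Complex.coe_smul, map_smul, coord_of_ne D hz, smul_zero]
  · intro hy
    rw [Finsupp.notMem_support_iff.1 hy, zero_smul, map_zero]

variable (D) in
/-- `x` is a positive root. -/
def IsPos (x : E) : Prop := x ∈ D.roots ∧ ∀ y, 0 ≤ (D.coord y x).re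

theorem neg_mem_roots {x : E} (hx : x ∈ D.roots) : -x ∈ D.roots := by
  have := D.reflection_mem x hx x hx
  rwa [mul_div_assoc, div_self (D.form_root_ne_zero x hx), mul_one, two_smul, sub_add_cancel_left]
    at this

theorem form_ne_zero {x : E} (hx : x ∈ D.roots) : D.form x ≠ 0 := fun h =>
  D.form_root_ne_zero x hx (by rw [h]; rfl)

theorem isPos_or_isPos_neg {x : E} (hx : x ∈ D.roots) : D.IsPos x ∨ D.IsPos (-x) := by
  obtain ⟨c, -, hs, hc⟩ := exists_coord_eq hx
  refine hs.imp (fun h => ⟨hx, fun y => ?_⟩) (fun h => ⟨neg_mem_roots hx, fun y => ?_⟩)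
  · rw [hc, Complex.ofReal_re]; exact h y
  · rw [map_neg, hc, Complex.neg_re, Complex.ofReal_re]; exact neg_nonneg.2 (h y)

theorem exists_coord_ne_zero {x : E} (hx : x ∈ D.roots) : ∃ y, (D.coord y x).re ≠ 0 := by
  obtain ⟨c, hx', -, hc⟩ := exists_coord_eq hx
  by_contra! h
  refine D.roots_ne_zero x hx ?_
  have : c = 0 := Finsupp.ext fun y => by simpa [hc] using h y
  rw [hx', this, Finsupp.sum_zero_index]

theorem IsPos.not_neg {x : E} (h : D.IsPos x) : ¬ D.IsPos (-x) := by
  intro h'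
  obtain ⟨y, hy⟩ := exists_coord_ne_zero h.1
  have h1 := h.2 y
  have h2 := h'.2 y
  rw [map_neg, Complex.neg_re] at h2
  exact hy (le_antisymm (by linarith) h1)

theorem isPos_of_not_neg {x : E} (hx : x ∈ D.roots) (h : ¬ D.IsPos (-x)) : D.IsPos x :=
  (isPos_or_isPos_neg hx).resolve_right h

theorem isPos_simple {x : E} (hx : x ∈ D.simple) : D.IsPos x := by
  refine ⟨D.simple_subset hx, fun y => ?_⟩
  by_cases h : (⟨x, hx⟩ : D.simple) = y
  · rw [← h, D.coord_self ⟨x, hx⟩]; simp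
  · rw [D.coord_of_ne (z := ⟨x, hx⟩) h]; simp

/-- A complex linear form whose real part is nonpositive on the simple roots has this property
on all positive roots. -/
theorem IsPos.re_nonpos {φ : E →ₗ[ℂ] ℂ} (hφ : ∀ x ∈ D.simple, (φ x).re ≤ 0) {x : E}
    (hx : D.IsPos x) : (φ x).re ≤ 0 := by
  obtain ⟨c, hx', -, hc⟩ := exists_coord_eq hx.1
  rw [hx', map_finsuppSum, Finsupp.sum, Complex.re_sum]
  refine Finset.sum_nonpos fun y _ => ?_
  rw [← Complex.coe_smul, map_smul, smul_eq_mul, Complex.re_ofReal_mul]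
  refine mul_nonpos_of_nonneg_of_nonpos ?_ (hφ y y.2)
  have := hx.2 y
  rwa [hc, Complex.ofReal_re] at this

variable (D) in
/-- There is a linear form that is positive on all positive roots. -/
theorem exists_pos_linForm :
    ∃ lam : E →ₗ[ℂ] ℂ, ∀ x, D.IsPos x → ∃ r : ℝ, 0 < r ∧ lam x = r := by
  have : Fintype D.simple := (D.roots_finite.subset D.simple_subset).fintype
  refine ⟨∑ y, D.coord y, fun x hx => ?_⟩
  obtain ⟨c, -, -, hc⟩ := exists_coord_eq hx.1
  have h0 : ∀ y, 0 ≤ c y := fun y => by simpa [hc] using hx.2 y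
  obtain ⟨y, hy⟩ := exists_coord_ne_zero hx.1
  refine ⟨∑ y, c y, Finset.sum_pos' (fun y _ => h0 y) ⟨y, Finset.mem_univ y, ?_⟩, ?_⟩
  · refine lt_of_le_of_ne (h0 y) fun h => hy ?_
    rw [hc, ← h]; simp
  · rw [LinearMap.sum_apply, Complex.ofReal_sum]
    exact Finset.sum_congr rfl fun y _ => hc y

/-- A simple reflection permutes the positive roots other than its own root. -/
theorem IsPos.refl_simple {x b : E} (hx : x ∈ D.simple) (hb : D.IsPos b) (hne : b ≠ x) :
    D.IsPos (D.lin (D.refl x) b) := by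
  have hxr := D.simple_subset hx
  rw [D.lin_refl x hxr]
  refine isPos_of_not_neg (D.reflection_mem x hxr b hb.1) fun hn => ?_
  obtain ⟨c, hb', -, hc⟩ := exists_coord_eq hb.1
  have h0 : ∀ y, 0 ≤ c y := fun y => by simpa [hc] using hb.2 y
  -- some other simple root occurs in `b`, and the reflection keeps its coefficient
  obtain ⟨y, hyx, hy⟩ : ∃ y : D.simple, (y : E) ≠ x ∧ c y ≠ 0 := by
    by_contra! h
    have h1 : b = c ⟨x, hx⟩ • x := by
      rw [hb', Finsupp.sum, Finset.sum_eq_single ⟨x, hx⟩]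
      · intro y _ hy
        rw [h y fun e => hy (Subtype.ext e), zero_smul]
      · intro hy
        rw [Finsupp.notMem_support_iff.1 hy, zero_smul]
    rcases D.eq_one_or_neg_one x hxr _ (h1 ▸ hb.1) with h2 | h2
    · rw [h2, one_smul] at h1; exact hne h1
    · have := h0 ⟨x, hx⟩; rw [h2] at this; linarith
  have h1 := hn.2 y
  have h2 : D.coord y x = 0 := D.coord_of_ne (z := ⟨x, hx⟩) fun e => hyx (by rw [← e])
  rw [map_neg, map_sub, map_smul, h2, smul_zero, sub_zero, hc, Complex.neg_re,
    Complex.ofReal_re] at h1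
  exact hy (le_antisymm (by linarith) (h0 y))

theorem lin_refl_self {x : E} (hx : x ∈ D.roots) : D.lin (D.refl x) x = -x := by
  rw [D.lin_refl x hx, mul_div_assoc, div_self (D.form_root_ne_zero x hx), mul_one, two_smul,
    sub_add_cancel_left]

theorem refl_mul_self {x : E} (hx : x ∈ D.roots) : D.refl x * D.refl x = 1 := by
  refine D.lin_injective (LinearEquiv.ext fun y => ?_)
  rw [map_mul, map_one]
  change D.lin (D.refl x) (D.lin (D.refl x) y) = y
  conv_lhs => rw [D.lin_refl x hx y, map_sub, map_smul, lin_refl_self hx, D.lin_refl x hx y]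
  rw [smul_neg, sub_neg_eq_add, sub_add_cancel]

theorem refl_neg {x : E} (hx : x ∈ D.roots) : D.refl (-x) = D.refl x := by
  refine D.lin_injective (LinearEquiv.ext fun y => ?_)
  rw [D.lin_refl x hx, D.lin_refl (-x) (neg_mem_roots hx)]
  simp only [map_neg, LinearMap.neg_apply, neg_neg, mul_neg, neg_div, smul_neg, neg_smul]

theorem refl_inv {x : E} (hx : x ∈ D.roots) : (D.refl x)⁻¹ = D.refl x :=
  inv_eq_of_mul_eq_one_left (refl_mul_self hx)

theorem form_lin_refl {x : E} (hx : x ∈ D.roots) (y z : E) :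
    D.form (D.lin (D.refl x) y) (D.lin (D.refl x) z) = D.form y z := by
  rw [D.lin_refl x hx, D.lin_refl x hx]
  have h0 := D.form_root_ne_zero x hx
  simp only [map_sub, map_smul, LinearMap.sub_apply, LinearMap.smul_apply, smul_eq_mul]
  rw [D.form_symm x z]
  field_simp
  ring

variable (D) in
/-- The product of the reflections along a word. -/
def wordProd (l : List E) : G := (l.map D.refl).prod

variable (D) in
/-- All letters of the word `l` are simple roots. -/
abbrev IsSimpleWord (l : List E) : Prop := ∀ x ∈ l, x ∈ D.simple

theorem wordProd_nil : D.wordProd [] = 1 := rfl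

theorem wordProd_cons (x : E) (l : List E) : D.wordProd (x :: l) = D.refl x * D.wordProd l := by
  rw [wordProd, List.map_cons, List.prod_cons, wordProd]

theorem wordProd_singleton (x : E) : D.wordProd [x] = D.refl x := by
  rw [wordProd_cons, wordProd_nil, mul_one]

theorem isSimpleWord_nil : D.IsSimpleWord [] := by simp [IsSimpleWord]

theorem isSimpleWord_cons {x : E} {l : List E} :
    D.IsSimpleWord (x :: l) ↔ x ∈ D.simple ∧ D.IsSimpleWord l := by simp [IsSimpleWord]

theorem isSimpleWord_append {l m : List E} :
    D.IsSimpleWord (l ++ m) ↔ D.IsSimpleWord l ∧ D.IsSimpleWord m := by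
  simp [IsSimpleWord, or_imp, forall_and]

theorem wordProd_append (l m : List E) : D.wordProd (l ++ m) = D.wordProd l * D.wordProd m := by
  simp only [wordProd, List.map_append, List.prod_append]

theorem lin_mul_apply (g h : G) (y : E) : D.lin (g * h) y = D.lin g (D.lin h y) := by
  rw [map_mul]; rfl

theorem lin_inv_lin (g : G) (y : E) : D.lin g⁻¹ (D.lin g y) = y := by
  rw [← lin_mul_apply, inv_mul_cancel, map_one]; rfl

theorem lin_lin_inv (g : G) (y : E) : D.lin g (D.lin g⁻¹ y) = y := by
  rw [← lin_mul_apply, mul_inv_cancel, map_one]; rfl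

theorem wordProd_reverse {l : List E} (hl : ∀ x ∈ l, x ∈ D.roots) :
    D.wordProd l.reverse = (D.wordProd l)⁻¹ := by
  rw [wordProd, wordProd, List.prod_inv_reverse, List.map_reverse, List.map_map]
  congr 2
  exact List.map_congr_left fun x hx => (refl_inv (hl x hx)).symm

variable (D) in
theorem exists_isWord (w : G) : ∃ l : List E, (∀ x ∈ l, x ∈ D.roots) ∧ D.wordProd l = w := by
  have hw : w ∈ Subgroup.closure (D.refl '' D.roots) := by rw [D.closure_refl]; trivial
  induction hw using Subgroup.closure_induction with
  | mem x hx =>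
    obtain ⟨y, hy, rfl⟩ := hx
    exact ⟨[y], by simpa using hy, wordProd_singleton y⟩
  | one => exact ⟨[], by simp, rfl⟩
  | mul x y _ _ hx hy =>
    obtain ⟨l, hl, rfl⟩ := hx
    obtain ⟨m, hm, rfl⟩ := hy
    exact ⟨l ++ m, by simpa [or_imp, forall_and] using ⟨hl, hm⟩, wordProd_append l m⟩
  | inv x _ hx =>
    obtain ⟨l, hl, rfl⟩ := hx
    exact ⟨l.reverse, by simpa using hl, wordProd_reverse hl⟩

theorem form_lin (g : G) (y z : E) : D.form (D.lin g y) (D.lin g z) = D.form y z := by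
  obtain ⟨l, hl, rfl⟩ := D.exists_isWord g
  induction l with
  | nil => rw [wordProd_nil, map_one]; rfl
  | cons x l ih =>
    rw [wordProd_cons, lin_mul_apply, lin_mul_apply,
      form_lin_refl (hl x (by simp))]
    exact ih fun y hy => hl y (by simp [hy])

theorem lin_mem_roots (g : G) {x : E} (hx : x ∈ D.roots) : D.lin g x ∈ D.roots := by
  obtain ⟨l, hl, rfl⟩ := D.exists_isWord g
  induction l with
  | nil => rwa [wordProd_nil, map_one]
  | cons y l ih =>
    have hy := hl y (by simp)
    rw [wordProd_cons, lin_mul_apply, D.lin_refl y hy]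
    exact D.reflection_mem y hy _ (ih fun y hy => hl y (by simp [hy]))

theorem conj_refl (g : G) {x : E} (hx : x ∈ D.roots) :
    g * D.refl x * g⁻¹ = D.refl (D.lin g x) := by
  refine D.lin_injective (LinearEquiv.ext fun y => ?_)
  rw [lin_mul_apply, lin_mul_apply, D.lin_refl x hx, D.lin_refl _ (lin_mem_roots g hx), map_sub,
    map_smul, lin_lin_inv, form_lin]
  rw [← form_lin (D := D) g (D.lin g⁻¹ y) x, lin_lin_inv]

/-- The strong exchange property. -/
theorem strong_exchange {l : List E} (hl : D.IsSimpleWord l) {b : E} (hb : D.IsPos b)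
    (hn : D.IsPos (-D.lin (D.wordProd l) b)) :
    ∃ l₁ y l₂, l = l₁ ++ y :: l₂ ∧ D.wordProd (l₁ ++ l₂) = D.wordProd l * D.refl b := by
  induction l with
  | nil =>
    rw [wordProd_nil, map_one] at hn
    exact absurd hn hb.not_neg
  | cons x t ih =>
    have hx : x ∈ D.simple := hl x (by simp)
    have ht : D.IsSimpleWord t := fun y hy => hl y (by simp [hy])
    rw [wordProd_cons] at hn ⊢
    by_cases h : D.IsPos (-D.lin (D.wordProd t) b)
    · obtain ⟨l₁, y, l₂, rfl, h2⟩ := ih ht h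
      refine ⟨x :: l₁, y, l₂, rfl, ?_⟩
      rw [List.cons_append, wordProd_cons, mul_assoc, h2]
    · have hp := isPos_of_not_neg (lin_mem_roots _ hb.1) h
      have h1 : D.lin (D.wordProd t) b = x := by
        by_contra hne
        rw [lin_mul_apply] at hn
        exact (IsPos.refl_simple hx hp hne).not_neg hn
      refine ⟨[], x, t, rfl, ?_⟩
      have h2 := conj_refl (D.wordProd t) hb.1
      rw [h1] at h2
      rw [← h2, List.nil_append, inv_mul_cancel_right, mul_assoc, refl_mul_self hb.1, mul_one]

/-! ### Reduced words -/

theorem length_wordProd_le {l : List E} (hl : D.IsSimpleWord l) :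
    D.length (D.wordProd l) ≤ l.length :=
  Nat.sInf_le ⟨l, ⟨hl, rfl⟩, rfl⟩

theorem length_one : D.length (1 : G) = 0 :=
  Nat.le_zero.1 (length_wordProd_le (D := D) (l := []) isSimpleWord_nil)

variable (D) in
/-- `l` is a reduced expression of its product. -/
abbrev IsRed (l : List E) : Prop := D.IsReducedWord l (D.wordProd l)

theorem isRed_iff {l : List E} : D.IsRed l ↔ D.IsSimpleWord l ∧
    l.length = D.length (D.wordProd l) :=
  ⟨fun h => ⟨h.1.1, h.2⟩, fun h => ⟨⟨h.1, rfl⟩, h.2⟩⟩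

section Generated

variable (hgen : ∀ w, ∃ l, D.IsReducedWord l w)
include hgen

theorem exists_isRed (w : G) : ∃ l, D.IsRed l ∧ D.wordProd l = w := by
  obtain ⟨l, ⟨hl, rfl⟩, h⟩ := hgen w
  exact ⟨l, ⟨⟨hl, rfl⟩, h⟩, rfl⟩

theorem length_mul_le (w u : G) : D.length (w * u) ≤ D.length w + D.length u := by
  obtain ⟨l, ⟨⟨hl, -⟩, h⟩, rfl⟩ := exists_isRed hgen w
  obtain ⟨m, ⟨⟨hm, -⟩, h'⟩, rfl⟩ := exists_isRed hgen u
  rw [← h, ← h', ← List.length_append, ← wordProd_append]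
  exact length_wordProd_le (isSimpleWord_append.2 ⟨hl, hm⟩)

theorem length_inv_le (w : G) : D.length w⁻¹ ≤ D.length w := by
  obtain ⟨l, ⟨⟨hl, -⟩, h⟩, rfl⟩ := exists_isRed hgen w
  rw [← h, ← wordProd_reverse fun x hx => D.simple_subset (hl x hx),
    ← List.length_reverse]
  exact length_wordProd_le fun x hx => hl x (List.mem_reverse.1 hx)

theorem length_inv (w : G) : D.length w⁻¹ = D.length w :=
  le_antisymm (length_inv_le hgen w) (by simpa using length_inv_le hgen w⁻¹)

theorem IsRed.append_left {l m : List E} (h : D.IsRed (l ++ m)) : D.IsRed l := by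
  obtain ⟨h1, h2⟩ := isRed_iff.1 h
  obtain ⟨hl, hm⟩ := isSimpleWord_append.1 h1
  have h3 := length_mul_le hgen (D.wordProd l) (D.wordProd m)
  rw [← wordProd_append, ← h2, List.length_append] at h3
  have := length_wordProd_le hm
  exact isRed_iff.2 ⟨hl, le_antisymm (by omega) (length_wordProd_le hl)⟩

theorem IsRed.append_right {l m : List E} (h : D.IsRed (l ++ m)) : D.IsRed m := by
  obtain ⟨h1, h2⟩ := isRed_iff.1 h
  obtain ⟨hl, hm⟩ := isSimpleWord_append.1 h1
  have h3 := length_mul_le hgen (D.wordProd l) (D.wordProd m)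
  rw [← wordProd_append, ← h2, List.length_append] at h3
  have := length_wordProd_le hl
  exact isRed_iff.2 ⟨hm, le_antisymm (by omega) (length_wordProd_le hm)⟩

theorem IsRed.tail {x : E} {l : List E} (h : D.IsRed (x :: l)) : D.IsRed l :=
  IsRed.append_right hgen (l := [x]) h

theorem length_mul_refl_lt {w : G} {b : E} (hb : D.IsPos b) (hn : D.IsPos (-D.lin w b)) :
    D.length (w * D.refl b) < D.length w := by
  obtain ⟨l, ⟨⟨hl, -⟩, h⟩, rfl⟩ := exists_isRed hgen w
  obtain ⟨l₁, y, l₂, rfl, h2⟩ := strong_exchange hl hb hn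
  rw [← h2, ← h]
  refine (length_wordProd_le ?_).trans_lt ?_
  · simp only [IsSimpleWord, List.mem_append, List.mem_cons] at hl ⊢
    exact fun x hx => hl x (hx.imp id Or.inr)
  · simp

theorem length_le_length_mul_refl_add_one (w : G) {x : E} (hx : x ∈ D.simple) :
    D.length w ≤ D.length (w * D.refl x) + 1 := by
  have h1 : D.length (D.refl x) ≤ 1 := by
    have := length_wordProd_le (isSimpleWord_cons.2 ⟨hx, isSimpleWord_nil⟩)
    rwa [wordProd_singleton] at this
  have h2 := length_mul_le hgen (w * D.refl x) (D.refl x)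
  rw [mul_assoc, refl_mul_self (D.simple_subset hx), mul_one] at h2
  omega

theorem length_mul_refl_of_neg {w : G} {x : E} (hx : x ∈ D.simple) (hn : D.IsPos (-D.lin w x)) :
    D.length (w * D.refl x) + 1 = D.length w :=
  le_antisymm (length_mul_refl_lt hgen (isPos_simple hx) hn)
    (length_le_length_mul_refl_add_one hgen w hx)

theorem length_mul_refl_of_pos {w : G} {x : E} (hx : x ∈ D.simple) (hp : D.IsPos (D.lin w x)) :
    D.length (w * D.refl x) = D.length w + 1 := by
  have h := length_mul_refl_of_neg hgen (w := w * D.refl x) hx (by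
    rwa [lin_mul_apply, lin_refl_self (D.simple_subset hx), map_neg, neg_neg])
  rw [mul_assoc, refl_mul_self (D.simple_subset hx), mul_one] at h
  exact h.symm

theorem isRed_append_singleton {l : List E} (hl : D.IsRed l) {x : E} (hx : x ∈ D.simple)
    (hp : D.IsPos (D.lin (D.wordProd l) x)) : D.IsRed (l ++ [x]) := by
  refine isRed_iff.2 ⟨isSimpleWord_append.2 ⟨hl.1.1,
    isSimpleWord_cons.2 ⟨hx, isSimpleWord_nil⟩⟩, ?_⟩
  have h1 := length_mul_refl_of_pos hgen hx hp
  rw [wordProd_append, List.length_append, hl.2, wordProd_singleton, h1]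
  rfl

theorem isRed_cons {l : List E} (hl : D.IsRed l) {x : E} (hx : x ∈ D.simple)
    (hp : D.IsPos (D.lin (D.wordProd l)⁻¹ x)) : D.IsRed (x :: l) := by
  refine isRed_iff.2 ⟨List.forall_mem_cons.2 ⟨hx, hl.1.1⟩, ?_⟩
  have h1 := length_mul_refl_of_pos hgen hx hp
  rw [← length_inv hgen, mul_inv_rev, inv_inv, refl_inv (D.simple_subset hx),
    length_inv hgen, ← hl.2] at h1
  rw [wordProd_cons, h1, List.length_cons]

theorem eq_one_of_forall_isPos {w : G} (h : ∀ x ∈ D.simple, D.IsPos (D.lin w x)) : w = 1 := by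
  obtain ⟨l, ⟨⟨hl, -⟩, h'⟩, rfl⟩ := exists_isRed hgen w
  rcases List.eq_nil_or_concat' l with rfl | ⟨m, x, rfl⟩
  · rfl
  · exfalso
    obtain ⟨hm, hx⟩ := isSimpleWord_append.1 hl
    have hx : x ∈ D.simple := hx x (by simp)
    have h1 := length_mul_refl_of_pos hgen hx (h x hx)
    have h2 := length_wordProd_le hm
    rw [← h', wordProd_append, wordProd_singleton, mul_assoc,
      refl_mul_self (D.simple_subset hx), mul_one, List.length_append, List.length_singleton] at h1
    omega

/-- The longest element is the only one that sends all simple roots to negative roots. -/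
theorem eq_of_forall_isPos_neg {w u : G} (hw : ∀ x ∈ D.simple, D.IsPos (-D.lin w x))
    (hu : ∀ x ∈ D.simple, D.IsPos (-D.lin u x)) : u = w := by
  have key : ∀ v : G, (∀ x ∈ D.simple, D.IsPos (-D.lin v x)) →
      ∀ b, D.IsPos b → D.IsPos (-D.lin v b) := by
    intro v hv b hb
    refine ⟨neg_mem_roots (lin_mem_roots v hb.1), fun y => ?_⟩
    rw [map_neg, Complex.neg_re, neg_nonneg]
    refine hb.re_nonpos (φ := D.coord y ∘ₗ (D.lin v : E →ₗ[ℂ] E)) fun x hx => ?_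
    have := (hv x hx).2 y
    rwa [map_neg, Complex.neg_re, neg_nonneg] at this
  have h1 : ∀ x ∈ D.simple, D.IsPos (D.lin (u * w⁻¹) x) := by
    intro x hx
    have h2 : D.IsPos (-D.lin w⁻¹ x) := by
      by_contra hc
      have h3 := key w hw _ (isPos_of_not_neg (lin_mem_roots _ (D.simple_subset hx)) hc)
      rw [lin_lin_inv] at h3
      exact (isPos_simple hx).not_neg h3
    have h4 := key u hu _ h2
    rwa [map_neg, neg_neg, ← lin_mul_apply] at h4
  exact mul_inv_eq_one.1 (eq_one_of_forall_isPos hgen h1)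

end Generated

/-! ### Deletions of letters -/

variable (D) in
/-- The words obtained from `l` by the deletion of a letter, each together with the root `β` for
which the product of the shortened word is the product of `l` times the reflection in `β`. -/
def deletions : List E → List (E × List E)
  | [] => []
  | x :: l => (D.lin (D.wordProd l)⁻¹ x, l) :: (deletions l).map fun q => (q.1, x :: q.2)

theorem deletions_spec {l : List E} (hl : D.IsSimpleWord l) {q : E × List E}
    (hq : q ∈ D.deletions l) : q.1 ∈ D.roots ∧ D.IsSimpleWord q.2 ∧ q.2.length + 1 = l.length ∧
      D.wordProd q.2 = D.wordProd l * D.refl q.1 ∧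
      D.form q.1 q.1 * (q.2.map fun x => D.form x x).prod = (l.map fun x => D.form x x).prod := by
  induction l generalizing q with
  | nil => simp [deletions] at hq
  | cons x l ih =>
    have hx : x ∈ D.simple := hl x (by simp)
    have ht : D.IsSimpleWord l := fun y hy => hl y (by simp [hy])
    rw [deletions, List.mem_cons, List.mem_map] at hq
    rcases hq with rfl | ⟨q, hq, rfl⟩
    · refine ⟨lin_mem_roots _ (D.simple_subset hx), ht, rfl, ?_, ?_⟩
      · change D.wordProd l = _
        rw [← conj_refl _ (D.simple_subset hx), wordProd_cons, inv_inv, ← mul_assoc, ← mul_assoc,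
          mul_inv_cancel_right, refl_mul_self (D.simple_subset hx), one_mul]
      · rw [form_lin, List.map_cons, List.prod_cons]
    · obtain ⟨h1, h2, h3, h4, h5⟩ := ih ht hq
      refine ⟨h1, List.forall_mem_cons.2 ⟨hx, h2⟩, by simp [h3], ?_, ?_⟩
      · rw [wordProd_cons, h4, ← mul_assoc, wordProd_cons]
      · simp only [List.map_cons, List.prod_cons]
        rw [← h5]
        ring

section Generated

variable (hgen : ∀ w, ∃ l, D.IsReducedWord l w)
include hgen

/-- For a reduced expression `l` of `w`, the roots that belong to the deletions of letters are the
positive roots made negative by `w`, without repetition. -/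
theorem nodup_and_mem_deletions {l : List E} (hl : D.IsRed l) :
    ((D.deletions l).map Prod.fst).Nodup ∧ ∀ c, c ∈ (D.deletions l).map Prod.fst ↔
      D.IsPos c ∧ D.IsPos (-D.lin (D.wordProd l) c) := by
  induction l with
  | nil =>
    refine ⟨List.nodup_nil, fun c => ?_⟩
    simp only [deletions, List.map_nil, List.not_mem_nil, false_iff, not_and]
    intro h
    rw [wordProd_nil, map_one]
    exact h.not_neg
  | cons x l ih =>
    have hx : x ∈ D.simple := hl.1.1 x (by simp)
    have hl' := hl.tail hgen
    obtain ⟨ih1, ih2⟩ := ih hl'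
    set b := D.lin (D.wordProd l)⁻¹ x with hb
    have hbr : b ∈ D.roots := lin_mem_roots _ (D.simple_subset hx)
    have hlb : D.lin (D.wordProd l) b = x := lin_lin_inv _ _
    have hbpos : D.IsPos b := by
      refine isPos_of_not_neg hbr fun hn => ?_
      have h1 := length_mul_refl_lt hgen (w := D.wordProd l) hn (by
        rw [map_neg, neg_neg, hlb]; exact isPos_simple hx)
      have h2 := conj_refl (D.wordProd l) hbr
      rw [hlb, mul_inv_eq_iff_eq_mul, ← wordProd_cons] at h2
      rw [refl_neg hbr, h2, ← hl.2, ← hl'.2, List.length_cons] at h1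
      omega
    have hmap : (D.deletions (x :: l)).map Prod.fst = b :: (D.deletions l).map Prod.fst := by
      rw [deletions, List.map_cons, List.map_map]; rfl
    rw [hmap]
    refine ⟨List.nodup_cons.2 ⟨fun h => ?_, ih1⟩, fun c => ?_⟩
    · have := ((ih2 b).1 h).2
      rw [hlb] at this
      exact (isPos_simple hx).not_neg this
    · rw [List.mem_cons, ih2, wordProd_cons, lin_mul_apply]
      constructor
      · rintro (rfl | ⟨h1, h2⟩)
        · rw [hlb, lin_refl_self (D.simple_subset hx), neg_neg]
          exact ⟨hbpos, isPos_simple hx⟩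
        · refine ⟨h1, ?_⟩
          rw [← map_neg]
          refine IsPos.refl_simple hx h2 fun he => ?_
          have h3 : c = -b := by
            rw [hb, ← he, map_neg, neg_neg, lin_inv_lin]
          rw [h3] at h1
          exact hbpos.not_neg h1
      · rintro ⟨h1, h2⟩
        by_cases h : D.IsPos (-D.lin (D.wordProd l) c)
        · exact Or.inr ⟨h1, h⟩
        · have hp := isPos_of_not_neg (lin_mem_roots _ h1.1) h
          left
          by_contra hne
          refine (IsPos.refl_simple hx hp fun he => hne ?_).not_neg h2
          rw [hb, ← he, lin_inv_lin]

/-! ### Parabolic subgroups -/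

/-- A reduced expression of a shortest representative of a coset of the parabolic subgroup
generated by the reflections in `I`, followed by a shortest expression in the letters `I`, is
reduced. -/
theorem IsShort.isRed_append {I : Set E} (hI : I ⊆ D.simple) {w : G}
    (hw : D.IsShort (Subgroup.closure (D.refl '' I)) w) {l : List E} (hl : D.IsReducedWord l w)
    (m : List E) (hm : ∀ x ∈ m, x ∈ I)
    (hmin : ∀ m' : List E, (∀ x ∈ m', x ∈ I) → D.wordProd m' = D.wordProd m →
      m.length ≤ m'.length) : D.IsRed (l ++ m) := by
  obtain ⟨⟨hl1, hlw⟩, hl2⟩ := hl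
  change D.wordProd l = w at hlw
  subst hlw
  have hmem : ∀ k : List E, (∀ x ∈ k, x ∈ I) →
      D.wordProd k ∈ Subgroup.closure (D.refl '' I) := fun k hk =>
    list_prod_mem fun g hg => by
      obtain ⟨x, hx, rfl⟩ := List.mem_map.1 hg
      exact Subgroup.subset_closure ⟨x, hk x hx, rfl⟩
  induction m using List.reverseRecOn with
  | nil => rw [List.append_nil]; exact isRed_iff.2 ⟨hl1, hl2⟩
  | append_singleton m x ih =>
    have hxI : x ∈ I := hm x (by simp)
    have hmI : ∀ y ∈ m, y ∈ I := fun y hy => hm y (by simp [hy])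
    have ih' := ih hmI fun m' hm' he => by
      have := hmin (m' ++ [x]) (by
        intro y hy
        rcases List.mem_append.1 hy with hy | hy
        · exact hm' y hy
        · rw [List.mem_singleton.1 hy]; exact hxI) (by rw [wordProd_append, he, wordProd_append])
      simpa using this
    rw [← List.append_assoc]
    refine isRed_append_singleton hgen ih' (hI hxI) ?_
    refine isPos_of_not_neg (lin_mem_roots _ (D.simple_subset (hI hxI))) fun hn => ?_
    obtain ⟨l₁, y, l₂, he, hp⟩ := strong_exchange ih'.1.1 (isPos_simple (hI hxI)) hn
    -- the exchanged letter belongs to `m`, contrary to the minimality of `m ++ [x]`, or to `l`,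
    -- and then `w` is not the shortest element of its coset
    have case1 : ∀ a, m = a ++ y :: l₂ → l₁ = l ++ a → False := by
      rintro a rfl rfl
      have h1 := hmin (a ++ l₂) (fun z hz => hmI z (by
        rcases List.mem_append.1 hz with hz | hz <;> simp [hz])) (by
          rw [List.append_assoc, wordProd_append, wordProd_append l, mul_assoc] at hp
          rw [mul_left_cancel hp, wordProd_append _ [x], wordProd_singleton])
      simp only [List.length_append, List.length_cons, List.length_nil] at h1
      omega
    rcases List.append_eq_append_iff.1 he with ⟨a, h1, h2⟩ | ⟨a, h1, h2⟩
    · exact case1 a h2 h1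
    · cases a with
      | nil =>
        rw [List.append_nil] at h1
        exact case1 [] h2.symm (by rw [h1, List.append_nil])
      | cons z a =>
        have h2' : y :: l₂ = z :: (a ++ m) := h2
        obtain ⟨rfl, rfl⟩ := List.cons.inj h2'
        subst h1
        rw [← List.append_assoc, wordProd_append, wordProd_append _ m, mul_assoc] at hp
        have h3 := hw (D.wordProd m * D.refl x * (D.wordProd m)⁻¹) (mul_mem (mul_mem (hmem m hmI)
          (Subgroup.subset_closure ⟨x, hxI, rfl⟩)) (inv_mem (hmem m hmI)))
        rw [← mul_assoc, ← hp, mul_inv_cancel_right] at h3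
        have h4 : D.IsSimpleWord (l₁ ++ a) := fun t ht => hl1 t (by
          rcases List.mem_append.1 ht with ht | ht <;> simp [ht])
        have h5 := length_wordProd_le h4
        simp only [List.length_append, List.length_cons] at hl2 h5
        omega

end Generated

section Chosen

variable {red : G → List E} (hred : ∀ w, D.IsReducedWord (red w) w)
include hred

theorem generated_of_red (w : G) : ∃ l, D.IsReducedWord l w := ⟨red w, hred w⟩

theorem wordProd_red (w : G) : D.wordProd (red w) = w := (hred w).1.2

theorem isRed_red (w : G) : D.IsRed (red w) := by
  have h := hred w
  rw [IsRed, wordProd_red hred]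
  exact h

end Chosen

theorem exists_word_of_mem_closure {I : Set E} (hI : I ⊆ D.roots) {h : G}
    (hh : h ∈ Subgroup.closure (D.refl '' I)) :
    ∃ m : List E, (∀ x ∈ m, x ∈ I) ∧ D.wordProd m = h := by
  induction hh using Subgroup.closure_induction with
  | mem x hx =>
    obtain ⟨y, hy, rfl⟩ := hx
    exact ⟨[y], by simpa using hy, wordProd_singleton y⟩
  | one => exact ⟨[], by simp, rfl⟩
  | mul x y _ _ hx hy =>
    obtain ⟨l, hl, rfl⟩ := hx
    obtain ⟨m, hm, rfl⟩ := hy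
    exact ⟨l ++ m, by simpa [or_imp, forall_and] using ⟨hl, hm⟩, wordProd_append l m⟩
  | inv x _ hx =>
    obtain ⟨l, hl, rfl⟩ := hx
    exact ⟨l.reverse, by simpa using hl, wordProd_reverse fun x hx => hI (hl x hx)⟩

end LocalReflectionGroup

/-! ### Divided differences -/

namespace LocalReflectionGroup

variable {E : Type*} [NormedAddCommGroup E] [NormedSpace ℂ E] [FiniteDimensional ℂ E]
  {G V : Type*} [Group G] [Group V] [TopologicalSpace V] [ChartedSpace E V]
  [MulDistribMulAction G V] {D : LocalReflectionGroup E G V}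

theorem gamma_mul_cancel {x : E} (hx : x ∈ D.roots) {f g : HolGerm E (1 : V)}
    (h : D.gamma x * f = D.gamma x * g) : f = g := by
  refine sub_eq_zero.1 (D.eq_zero_of_linForm_mul_eq_zero (form_ne_zero hx) ?_)
  rw [← gamma_eq_linForm, mul_sub, h, sub_self]

/-- A linear operator that commutes with the linear forms up to the twist by an element of `G`,
and that vanishes on the constants, is zero: it sends all germs to germs that vanish to every
order. -/
theorem eq_zero_of_twisted {T : HolGerm E (1 : V) → HolGerm E (1 : V)} (hlin : IsLinearMap ℂ T)
    {w : G}
    (hT : ∀ lam f, T (D.linForm lam * f) = D.linForm (lam ∘ₗ (D.lin w : E →ₗ[ℂ] E)) * T f)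
    (h1 : T 1 = 0) (f : HolGerm E (1 : V)) : T f = 0 := by
  have key : ∀ k f, D.VanishesToOrder k (T f) := by
    intro k
    induction k with
    | zero => exact fun f => D.vanishesToOrder_zero _
    | succ k ih =>
      intro f
      have h2 : ev (f + (-ev f) • 1) = 0 := by
        rw [← evHom_apply, map_add, map_smul, map_one, smul_eq_mul, mul_one, evHom_apply,
          add_neg_cancel]
      have h3 : ∀ g ∈ Ideal.span (Set.range D.linForm), ∀ a,
          D.VanishesToOrder (k + 1) (T (a * g)) := by
        intro g hg
        induction hg using Submodule.span_induction with
        | mem g hg =>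
          obtain ⟨lam, rfl⟩ := hg
          intro a
          rw [mul_comm a, hT, add_comm k]
          exact (D.vanishesToOrder_linForm _).mul (ih _)
        | zero => intro a; rw [mul_zero, hlin.map_zero]; exact .zero _
        | add x y _ _ hx hy => intro a; rw [mul_add, hlin.map_add]; exact (hx a).add (hy a)
        | smul b x _ hx => intro a; rw [smul_eq_mul, ← mul_assoc]; exact hx _
      have h4 := h3 _ (D.mem_span_linForm h2) 1
      rwa [one_mul, hlin.map_add, hlin.map_smul, h1, smul_zero, add_zero] at h4
  exact D.eq_zero_of_vanishesToOrder fun k => key k f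

variable [HolAction E G V]

theorem gamma_mul_dividedDiff {x : E} (hx : x ∈ D.roots) (f : HolGerm E (1 : V)) :
    D.gamma x * D.dividedDiff x f = f - act (D.refl x) f := by
  have h : ∃ k, D.gamma x * k =
      f - pull (groupMap E (D.refl x)⁻¹) (smul_one (D.refl x)⁻¹) f := by
    obtain ⟨Φ, hΦ, rfl⟩ := D.exists_germOf f
    obtain ⟨k, hk⟩ := D.exists_linForm_mul_eq_sub hΦ LinearMap.id
      (D.lin (D.refl x)⁻¹ : E →ₗ[ℂ] E) (D.form x) ((2 / D.form x x) • x) (fun y => by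
        rw [refl_inv hx]
        change y - D.lin (D.refl x) y = _
        rw [D.lin_refl x hx, sub_sub_cancel, smul_smul, D.form_symm y x]
        congr 1
        ring) hΦ (analyticAt_comp_linear hΦ _)
    exact ⟨k, hk.trans (congrArg _ (D.act_germOf _ hΦ).symm)⟩
  rw [dividedDiff, dif_pos h]
  exact h.choose_spec

theorem dividedDiff_eq {x : E} (hx : x ∈ D.roots) {f k : HolGerm E (1 : V)}
    (h : D.gamma x * k = f - act (D.refl x) f) : D.dividedDiff x f = k :=
  gamma_mul_cancel hx ((gamma_mul_dividedDiff hx f).trans h.symm)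

theorem act_refl_eq {x : E} (hx : x ∈ D.roots) (f : HolGerm E (1 : V)) :
    act (D.refl x) f = f - D.gamma x * D.dividedDiff x f := by
  rw [gamma_mul_dividedDiff hx, sub_sub_cancel]

theorem dividedDiff_add {x : E} (hx : x ∈ D.roots) (f g : HolGerm E (1 : V)) :
    D.dividedDiff x (f + g) = D.dividedDiff x f + D.dividedDiff x g := by
  refine dividedDiff_eq hx ?_
  rw [mul_add, gamma_mul_dividedDiff hx, gamma_mul_dividedDiff hx, map_add]
  ring

theorem dividedDiff_smul {x : E} (hx : x ∈ D.roots) (c : ℂ) (f : HolGerm E (1 : V)) :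
    D.dividedDiff x (c • f) = c • D.dividedDiff x f := by
  refine dividedDiff_eq hx ?_
  rw [mul_smul_comm, gamma_mul_dividedDiff hx, map_smul, smul_sub]

variable (D) in
/-- The divided difference for a root, as a linear map. -/
def dividedDiffLin (x : D.roots) : HolGerm E (1 : V) →ₗ[ℂ] HolGerm E (1 : V) where
  toFun := D.dividedDiff x
  map_add' := dividedDiff_add x.2
  map_smul' := dividedDiff_smul x.2

theorem dividedDiffLin_apply {x : E} (hx : x ∈ D.roots) (f : HolGerm E (1 : V)) :
    D.dividedDiffLin ⟨x, hx⟩ f = D.dividedDiff x f := rfl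

theorem dividedDiff_eq_zero_iff {x : E} (hx : x ∈ D.roots) {f : HolGerm E (1 : V)} :
    D.dividedDiff x f = 0 ↔ act (D.refl x) f = f := by
  refine ⟨fun h => by rw [act_refl_eq hx, h, mul_zero, sub_zero], fun h => ?_⟩
  exact dividedDiff_eq hx (by rw [h, mul_zero, sub_self])

/-- The twisted Leibniz rule. -/
theorem dividedDiff_mul {x : E} (hx : x ∈ D.roots) (f g : HolGerm E (1 : V)) :
    D.dividedDiff x (f * g) =
      D.dividedDiff x f * g + act (D.refl x) f * D.dividedDiff x g := by
  refine dividedDiff_eq hx ?_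
  rw [mul_add, ← mul_assoc, gamma_mul_dividedDiff hx, mul_left_comm, gamma_mul_dividedDiff hx,
    map_mul]
  ring

theorem dividedDiff_linForm {x : E} (hx : x ∈ D.roots) (lam : E →ₗ[ℂ] ℂ) :
    D.dividedDiff x (D.linForm lam) = (2 * lam x / D.form x x) • 1 := by
  refine dividedDiff_eq hx ?_
  rw [mul_smul_comm, mul_one, act_linForm, gamma_eq_linForm, ← linForm_smul, ← linForm_sub]
  congr 1
  ext y
  rw [refl_inv hx]
  change _ = lam y - lam (D.lin (D.refl x) y)
  rw [D.lin_refl x hx, map_sub, map_smul, sub_sub_cancel, D.form_symm y x, LinearMap.smul_apply,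
    smul_eq_mul, smul_eq_mul]
  ring

theorem act_gamma {x : E} (hx : x ∈ D.roots) : act (D.refl x) (D.gamma x) = -D.gamma x := by
  rw [gamma_eq_linForm, act_linForm, ← linForm_neg]
  congr 1
  ext y
  rw [refl_inv hx]
  change D.form x (D.lin (D.refl x) y) = -D.form x y
  have h1 := form_lin (D := D) (D.refl x) x y
  rw [lin_refl_self hx, map_neg, LinearMap.neg_apply] at h1
  rw [← h1, neg_neg]

theorem dividedDiff_dividedDiff {x : E} (hx : x ∈ D.roots) (f : HolGerm E (1 : V)) :
    D.dividedDiff x (D.dividedDiff x f) = 0 := by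
  rw [dividedDiff_eq_zero_iff hx]
  refine gamma_mul_cancel hx ?_
  have h1 := congrArg (act (D.refl x)) (gamma_mul_dividedDiff hx f)
  rw [map_mul, act_gamma hx, map_sub, ← act_mul, refl_mul_self hx, act_one, neg_mul] at h1
  rw [gamma_mul_dividedDiff hx, ← neg_sub, ← h1, neg_neg]

theorem dividedDiffWord_cons (x : E) (l : List E) (f : HolGerm E (1 : V)) :
    D.dividedDiffWord (x :: l) f = D.dividedDiff x (D.dividedDiffWord l f) := rfl

theorem dividedDiffWord_append (l m : List E) (f : HolGerm E (1 : V)) :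
    D.dividedDiffWord (l ++ m) f = D.dividedDiffWord l (D.dividedDiffWord m f) :=
  List.foldr_append

theorem isLinearMap_dividedDiffWord {l : List E} (hl : D.IsSimpleWord l) :
    IsLinearMap ℂ (D.dividedDiffWord l : HolGerm E (1 : V) → HolGerm E (1 : V)) := by
  induction l with
  | nil => exact ⟨fun _ _ => rfl, fun _ _ => rfl⟩
  | cons x l ih =>
    obtain ⟨hx, hl⟩ := isSimpleWord_cons.1 hl
    have hx := D.simple_subset hx
    have ih := ih hl
    refine ⟨fun f g => ?_, fun c f => ?_⟩
    · rw [dividedDiffWord_cons, ih.map_add, dividedDiff_add hx]; rfl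
    · rw [dividedDiffWord_cons, ih.map_smul, dividedDiff_smul hx]; rfl

variable (D) in
/-- The composition of divided differences along a word in the simple roots, as a linear map. -/
def dividedDiffWordLin {l : List E} (hl : D.IsSimpleWord l) :
    HolGerm E (1 : V) →ₗ[ℂ] HolGerm E (1 : V) := (isLinearMap_dividedDiffWord hl).mk'

theorem dividedDiffWordLin_apply {l : List E} (hl : D.IsSimpleWord l) (f : HolGerm E (1 : V)) :
    D.dividedDiffWordLin hl f = D.dividedDiffWord l f := rfl

theorem dividedDiff_zero {x : E} (hx : x ∈ D.roots) : D.dividedDiff x 0 = 0 :=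
  map_zero (D.dividedDiffLin ⟨x, hx⟩)

theorem dividedDiffWord_zero {l : List E} (hl : D.IsSimpleWord l) : D.dividedDiffWord l 0 = 0 :=
  map_zero (D.dividedDiffWordLin hl)

theorem dividedDiffWord_one {l : List E} (hl : D.IsSimpleWord l) (h : l ≠ []) :
    D.dividedDiffWord l 1 = 0 := by
  rcases List.eq_nil_or_concat' l with rfl | ⟨m, x, rfl⟩
  · exact absurd rfl h
  · obtain ⟨hm, hx⟩ := isSimpleWord_append.1 hl
    have h1 : D.dividedDiffWord [x] 1 = 0 :=
      (dividedDiff_eq_zero_iff (D.simple_subset (hx x (by simp)))).2 (map_one _)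
    rw [dividedDiffWord_append, h1, dividedDiffWord_zero hm]

/-- The Leibniz rule for the multiplication by a linear form: besides the twisted product there is
one term for each deletion of a letter. -/
theorem dividedDiffWord_linForm_mul {l : List E} (hl : D.IsSimpleWord l) (lam : E →ₗ[ℂ] ℂ)
    (f : HolGerm E (1 : V)) :
    D.dividedDiffWord l (D.linForm lam * f) =
      D.linForm (lam ∘ₗ (D.lin (D.wordProd l)⁻¹ : E →ₗ[ℂ] E)) * D.dividedDiffWord l f +
      ((D.deletions l).map fun q =>
        (2 * lam q.1 / D.form q.1 q.1) • D.dividedDiffWord q.2 f).sum := by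
  induction l with
  | nil =>
    have h1 : lam ∘ₗ (D.lin (D.wordProd [])⁻¹ : E →ₗ[ℂ] E) = lam := by
      rw [wordProd_nil, inv_one, map_one]; rfl
    rw [h1, deletions, List.map_nil, List.sum_nil, add_zero]
    rfl
  | cons x l ih =>
    obtain ⟨hx, hl⟩ := isSimpleWord_cons.1 hl
    have hx := D.simple_subset hx
    have h1 : lam ∘ₗ (D.lin (D.wordProd (x :: l))⁻¹ : E →ₗ[ℂ] E) =
        (lam ∘ₗ (D.lin (D.wordProd l)⁻¹ : E →ₗ[ℂ] E)) ∘ₗ (D.lin (D.refl x)⁻¹ : E →ₗ[ℂ] E) := by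
      rw [wordProd_cons, mul_inv_rev, map_mul]; rfl
    rw [dividedDiffWord_cons, ih hl, dividedDiff_add hx, dividedDiff_mul hx, dividedDiff_linForm hx,
      act_linForm, ← h1, deletions, List.map_cons, List.sum_cons, List.map_map,
      ← dividedDiffLin_apply hx (List.sum _), map_list_sum, List.map_map, smul_one_mul,
      dividedDiffWord_cons, form_lin]
    have h2 : (D.dividedDiffLin ⟨x, hx⟩ ∘ fun q : E × List E =>
        (2 * lam q.1 / D.form q.1 q.1) • D.dividedDiffWord q.2 f) =
        ((fun q : E × List E => (2 * lam q.1 / D.form q.1 q.1) • D.dividedDiffWord q.2 f) ∘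
          fun q => (q.1, x :: q.2)) := by
      funext q
      exact map_smul (D.dividedDiffLin ⟨x, hx⟩) _ _
    rw [h2]
    change _ + _ + _ = _ + ((2 * lam (D.lin (D.wordProd l)⁻¹ x) / _) • _ + _)
    rw [LinearMap.comp_apply]
    change (2 * lam (D.lin (D.wordProd l)⁻¹ x) / _) • _ + _ + _ = _
    ring

section Generated

variable (hgen : ∀ w, ∃ l, D.IsReducedWord l w)
include hgen

/-- Divided differences along words of the same length with the same product are equal, and they
are zero if the words are not reduced.  Both facts are proved together, by induction on the length:
for reduced words, the deletions of letters give the same terms in the Leibniz rule, so the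
difference of the two operators is covered by `eq_zero_of_twisted`. -/
theorem dividedDiffWord_aux (n : ℕ) (l : List E) (hl : D.IsSimpleWord l) (hn : l.length = n) :
    (¬ D.IsRed l → ∀ f : HolGerm E (1 : V), D.dividedDiffWord l f = 0) ∧
    ∀ m : List E, D.IsSimpleWord m → m.length = n → D.wordProd l = D.wordProd m →
      ∀ f : HolGerm E (1 : V), D.dividedDiffWord l f = D.dividedDiffWord m f := by
  induction n generalizing l with
  | zero =>
    rw [List.length_eq_zero_iff] at hn
    subst hn
    refine ⟨fun h => absurd (isRed_iff.2 ⟨hl, ?_⟩) h, fun m _ hm _ f => ?_⟩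
    · rw [wordProd_nil, length_one]; rfl
    · rw [List.length_eq_zero_iff.1 hm]
  | succ n ih =>
    have part1 : ∀ l : List E, D.IsSimpleWord l → l.length = n + 1 → ¬ D.IsRed l →
        ∀ f : HolGerm E (1 : V), D.dividedDiffWord l f = 0 := by
      intro l hl hn hr f
      obtain _ | ⟨x, t⟩ := l
      · simp at hn
      obtain ⟨hx, ht⟩ := isSimpleWord_cons.1 hl
      have htn : t.length = n := by simpa using hn
      by_cases htr : D.IsRed t
      · -- the letter `x` can be moved to the front of `t`
        have h1 : D.IsPos (-D.lin (D.wordProd t)⁻¹ x) := by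
          by_contra h
          exact hr (isRed_cons hgen htr hx (isPos_of_not_neg
            (lin_mem_roots _ (D.simple_subset hx)) h))
        obtain ⟨l₁, y, l₂, rfl, h2⟩ := strong_exchange ht h1 (by
          rw [map_neg, neg_neg, lin_lin_inv]; exact isPos_simple hx)
        have h3 := conj_refl (D.wordProd (l₁ ++ y :: l₂)) h1.1
        rw [map_neg, lin_lin_inv, refl_neg (D.simple_subset hx), mul_inv_eq_iff_eq_mul] at h3
        rw [h3] at h2
        have h4 : D.IsSimpleWord (x :: (l₁ ++ l₂)) := isSimpleWord_cons.2 ⟨hx, fun z hz => ht z (by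
          rcases List.mem_append.1 hz with hz | hz <;> simp [hz])⟩
        have h5 : (x :: (l₁ ++ l₂)).length = n := by simpa [add_assoc] using htn
        rw [dividedDiffWord_cons, (ih _ ht htn).2 (x :: (l₁ ++ l₂)) h4 h5 (by
          rw [wordProd_cons, h2, ← mul_assoc, refl_mul_self (D.simple_subset hx), one_mul]),
          dividedDiffWord_cons, dividedDiff_dividedDiff (D.simple_subset hx)]
      · rw [dividedDiffWord_cons, (ih t ht htn).1 htr, dividedDiff_zero (D.simple_subset hx)]
    refine ⟨part1 l hl hn, fun m hm hmn he => ?_⟩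
    by_cases hr : D.IsRed l
    · have hr' : D.IsRed m := isRed_iff.2 ⟨hm, by rw [hmn, ← he, ← hn, hr.2]⟩
      have hperm : ((D.deletions l).map Prod.fst).Perm ((D.deletions m).map Prod.fst) := by
        obtain ⟨h1, h2⟩ := nodup_and_mem_deletions hgen hr
        obtain ⟨h3, h4⟩ := nodup_and_mem_deletions hgen hr'
        rw [List.perm_ext_iff_of_nodup h1 h3]
        intro c
        rw [h2, h4, he]
      classical
      -- by induction, `∂` is a function of the product for words with `n` letters
      let X : G → HolGerm E (1 : V) → HolGerm E (1 : V) := fun g =>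
        if h : ∃ k : List E, D.IsSimpleWord k ∧ k.length = n ∧ D.wordProd k = g
        then D.dividedDiffWord h.choose else 0
      have hX : ∀ k : List E, D.IsSimpleWord k → k.length = n →
          ∀ f, D.dividedDiffWord k f = X (D.wordProd k) f := by
        intro k hk hkn f
        have h : ∃ k' : List E, D.IsSimpleWord k' ∧ k'.length = n ∧
          D.wordProd k' = D.wordProd k := ⟨k, hk, hkn, rfl⟩
        simp only [X, dif_pos h]
        exact (ih k hk hkn).2 _ h.choose_spec.1 h.choose_spec.2.1 h.choose_spec.2.2.symm f
      have hsum : ∀ k : List E, D.IsSimpleWord k → k.length = n + 1 → ∀ (lam : E →ₗ[ℂ] ℂ) f,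
          ((D.deletions k).map fun q =>
            (2 * lam q.1 / D.form q.1 q.1) • D.dividedDiffWord q.2 f).sum =
          (((D.deletions k).map Prod.fst).map fun b =>
            (2 * lam b / D.form b b) • X (D.wordProd k * D.refl b) f).sum := by
        intro k hk hkn lam f
        rw [List.map_map]
        congr 1
        refine List.map_congr_left fun q hq => ?_
        obtain ⟨-, h2, h3, h4, -⟩ := deletions_spec hk hq
        rw [hX q.2 h2 (by omega), h4]
        rfl
      have h1 := isLinearMap_dividedDiffWord (D := D) hl
      have h2 := isLinearMap_dividedDiffWord (D := D) hm
      refine fun f => sub_eq_zero.1 (eq_zero_of_twisted (D := D)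
        (T := fun f => D.dividedDiffWord l f - D.dividedDiffWord m f) (w := (D.wordProd l)⁻¹)
        ⟨fun f g => ?_, fun c f => ?_⟩ (fun lam f => ?_) ?_ f)
      · rw [h1.map_add, h2.map_add, add_sub_add_comm]
      · rw [h1.map_smul, h2.map_smul, smul_sub]
      · rw [dividedDiffWord_linForm_mul hl, dividedDiffWord_linForm_mul hm, hsum l hl hn,
          hsum m hm hmn, he, (hperm.map _).sum_eq]
        ring
      · rw [dividedDiffWord_one hl, dividedDiffWord_one hm, sub_self]
        · rintro rfl; simp at hmn
        · rintro rfl; simp at hn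
    · have hr' : ¬ D.IsRed m := fun h => hr (isRed_iff.2 ⟨hl, by rw [hn, he, ← hmn, h.2]⟩)
      intro f
      rw [part1 l hl hn hr, part1 m hm hmn hr']

theorem dividedDiffWord_eq_zero {l : List E} (hl : D.IsSimpleWord l) (hr : ¬ D.IsRed l)
    (f : HolGerm E (1 : V)) : D.dividedDiffWord l f = 0 :=
  (dividedDiffWord_aux hgen _ l hl rfl).1 hr f

/-- The divided difference along a reduced word depends only on the product of the word. -/
theorem dividedDiffWord_congr {l m : List E} {w : G} (hl : D.IsReducedWord l w)
    (hm : D.IsReducedWord m w) (f : HolGerm E (1 : V)) :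
    D.dividedDiffWord l f = D.dividedDiffWord m f :=
  (dividedDiffWord_aux hgen _ l hl.1.1 rfl).2 m hm.1.1 (hm.2.trans hl.2.symm)
    (hl.1.2.trans hm.1.2.symm) f

end Generated

end LocalReflectionGroup

/-! ### Independence of the functionals -/

theorem exists_sum_mul_eq {R n : Type*} [CommRing R] [Fintype n] [DecidableEq n]
    {M : Matrix n n R} (hM : IsUnit M.det) (F : n → R) :
    ∃ a : n → R, ∀ i, ∑ j, M i j * a j = F i := by
  have h : M.mulVec (M⁻¹.mulVec F) = F := by
    rw [Matrix.mulVec_mulVec, Matrix.mul_nonsing_inv _ hM, Matrix.one_mulVec]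
  exact ⟨_, fun i => congrFun h i⟩

theorem eq_zero_of_forall_sum_mul_eq_zero {R n : Type*} [CommRing R] [Fintype n] [DecidableEq n]
    {M : Matrix n n R} (hM : IsUnit M.det) {v : n → R} (h : ∀ i, ∑ j, M i j * v j = 0) :
    v = 0 := by
  have h1 : M⁻¹.mulVec (M.mulVec v) = 0 := by
    rw [show M.mulVec v = 0 from funext h, Matrix.mulVec_zero]
  rwa [Matrix.mulVec_mulVec, Matrix.nonsing_inv_mul _ hM, Matrix.one_mulVec] at h1

namespace LocalReflectionGroup

variable {E : Type*} [NormedAddCommGroup E] [NormedSpace ℂ E] [FiniteDimensional ℂ E]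
  {G V : Type*} [Group G] [Group V] [TopologicalSpace V] [ChartedSpace E V]
  [MulDistribMulAction G V] [HolAction E G V] {D : LocalReflectionGroup E G V}

open ComplexOrder in
/-- If `λ` is positive on the positive roots and `l` is a reduced word of length `n`, then
`ev ∘ ∂_l` does not vanish at the power `λⁿ`.  The factor `∏ (x, x)` over the letters corrects the
signs if the form is not positive. -/
theorem ev_dividedDiffWord_pow (hgen : ∀ w, ∃ l, D.IsReducedWord l w) {lam : E →ₗ[ℂ] ℂ}
    (hlam : ∀ x, D.IsPos x → 0 < lam x) (n : ℕ) {l : List E} (hl : D.IsSimpleWord l)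
    (hn : l.length = n) :
    0 ≤ (l.map fun x => D.form x x).prod * ev (D.dividedDiffWord l (D.linForm lam ^ n)) ∧
      (D.IsRed l →
        0 < (l.map fun x => D.form x x).prod * ev (D.dividedDiffWord l (D.linForm lam ^ n))) := by
  induction n generalizing l with
  | zero =>
    rw [List.length_eq_zero_iff.1 hn]
    have h : ev (D.dividedDiffWord [] (D.linForm lam ^ 0)) = 1 := by
      rw [pow_zero]; exact ev_one
    rw [h]
    simp
  | succ n ih =>
    by_cases hr : D.IsRed l
    · have key : (l.map fun x => D.form x x).prod *
          ev (D.dividedDiffWord l (D.linForm lam ^ (n + 1))) =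
          ((D.deletions l).map fun q => 2 * lam q.1 * ((q.2.map fun x => D.form x x).prod *
            ev (D.dividedDiffWord q.2 (D.linForm lam ^ n)))).sum := by
        rw [pow_succ', dividedDiffWord_linForm_mul hl, ← evHom_apply, map_add, map_mul,
          evHom_apply, ev_linForm, zero_mul, zero_add, map_list_sum, List.map_map,
          ← List.sum_map_mul_left]
        congr 1
        refine List.map_congr_left fun q hq => ?_
        obtain ⟨h1, -, -, -, h5⟩ := deletions_spec hl hq
        rw [← h5, Function.comp_apply, ← evHom_apply, map_smul, smul_eq_mul, evHom_apply]
        field_simp [D.form_root_ne_zero _ h1]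
      have hpos : ∀ q ∈ D.deletions l, 0 < 2 * lam q.1 := fun q hq =>
        mul_pos two_pos (hlam _ (((nodup_and_mem_deletions hgen hr).2 _).1
          (List.mem_map_of_mem hq)).1)
      have hnn : ∀ q ∈ D.deletions l, 0 ≤ 2 * lam q.1 * ((q.2.map fun x => D.form x x).prod *
            ev (D.dividedDiffWord q.2 (D.linForm lam ^ n))) := fun q hq => by
        obtain ⟨-, h2, h3, -, -⟩ := deletions_spec hl hq
        exact mul_nonneg (hpos q hq).le (ih h2 (by omega)).1
      suffices h : 0 < ((D.deletions l).map fun q => 2 * lam q.1 *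
          ((q.2.map fun x => D.form x x).prod *
            ev (D.dividedDiffWord q.2 (D.linForm lam ^ n)))).sum by
        rw [key]; exact ⟨h.le, fun _ => h⟩
      obtain _ | ⟨x, t⟩ := l
      · simp at hn
      rw [deletions, List.map_cons, List.sum_cons]
      refine add_pos_of_pos_of_nonneg (mul_pos (hpos _ (by rw [deletions]; simp))
        ((ih (isSimpleWord_cons.1 hl).2 (by simpa using hn)).2 (hr.tail hgen)))
        (List.sum_nonneg fun y hy => ?_)
      obtain ⟨q, hq, rfl⟩ := List.mem_map.1 hy
      exact hnn q (by rw [deletions]; exact List.mem_cons_of_mem _ hq)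
    · rw [dividedDiffWord_eq_zero hgen hl hr]
      rw [ev_zero, mul_zero]
      exact ⟨le_rfl, fun h => absurd h hr⟩

open ComplexOrder in
theorem exists_ev_dividedDiffWord_ne_zero (hgen : ∀ w, ∃ l, D.IsReducedWord l w) {l : List E}
    (hl : D.IsRed l) : ∃ f : HolGerm E (1 : V), ev (D.dividedDiffWord l f) ≠ 0 := by
  obtain ⟨lam, hlam⟩ := D.exists_pos_linForm
  have hlam' : ∀ x, D.IsPos x → 0 < lam x := fun x hx => by
    obtain ⟨r, hr, h⟩ := hlam x hx
    rw [h]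
    exact Complex.zero_lt_real.2 hr
  exact ⟨_, right_ne_zero_of_mul
    ((ev_dividedDiffWord_pow hgen hlam' _ hl.1.1 rfl).2 hl).ne'⟩

section Chosen

variable {red : G → List E} (hred : ∀ w, D.IsReducedWord (red w) w)
include hred

theorem dividedDiffWord_eq_red {l : List E} (hl : D.IsRed l) (f : HolGerm E (1 : V)) :
    D.dividedDiffWord l f = D.dividedDiffWord (red (D.wordProd l)) f :=
  dividedDiffWord_congr (generated_of_red hred) hl (hred _) f

theorem dividedDiffWord_red_dividedDiff_of_pos {w : G} {x : E} (hx : x ∈ D.simple)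
    (hp : D.IsPos (D.lin w x)) (f : HolGerm E (1 : V)) :
    D.dividedDiffWord (red w) (D.dividedDiff x f) =
      D.dividedDiffWord (red (w * D.refl x)) f := by
  have h := dividedDiffWord_eq_red hred (isRed_append_singleton (generated_of_red hred)
    (isRed_red hred w) hx (by rwa [wordProd_red hred])) f
  rw [dividedDiffWord_append, wordProd_append, wordProd_red hred, wordProd_singleton] at h
  exact h

theorem dividedDiffWord_red_dividedDiff_of_neg {w : G} {x : E} (hx : x ∈ D.simple)
    (hn : D.IsPos (-D.lin w x)) (f : HolGerm E (1 : V)) :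
    D.dividedDiffWord (red w) (D.dividedDiff x f) = 0 := by
  have h : D.dividedDiffWord (red w ++ [x]) f = 0 := by
    refine dividedDiffWord_eq_zero (generated_of_red hred)
      (isSimpleWord_append.2 ⟨(hred w).1.1, isSimpleWord_cons.2 ⟨hx, isSimpleWord_nil⟩⟩)
      (fun hr => ?_) f
    have h1 := length_mul_refl_lt (generated_of_red hred) (isPos_simple hx) hn
    have h2 := hr.2
    rw [wordProd_append, wordProd_red hred, wordProd_singleton, List.length_append,
      (hred w).2] at h2
    omega
  rwa [dividedDiffWord_append] at h

theorem act_eq_of_forall_simple {f : HolGerm E (1 : V)}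
    (h : ∀ x ∈ D.simple, D.dividedDiff x f = 0) (g : G) : act g f = f := by
  rw [← wordProd_red hred g]
  have hg : D.IsSimpleWord (red g) := (hred g).1.1
  generalize red g = l at hg
  induction l with
  | nil => rw [wordProd_nil, act_one]
  | cons x l ih =>
    obtain ⟨hx, hl⟩ := isSimpleWord_cons.1 hg
    rw [wordProd_cons, act_mul, ih hl, ← dividedDiff_eq_zero_iff (D.simple_subset hx), h x hx]

variable [Fintype G]

/-- The functionals `ev ∘ ∂_w`, `w ∈ G`, on `𝒪_e` are linearly independent.  The composition with
`∂_x` turns a relation between them into a relation between those of larger length, so the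
coefficients vanish by descending induction on the length. -/
theorem eq_zero_of_sum_mul_ev_eq_zero (c : G → ℂ)
    (hc : ∀ f : HolGerm E (1 : V), ∑ w, c w * ev (D.dividedDiffWord (red w) f) = 0) : c = 0 := by
  classical
  have hgen := generated_of_red hred
  obtain ⟨N, hN⟩ : ∃ N, ∀ w : G, D.length w < N :=
    ⟨(Finset.univ.sup D.length) + 1, fun w => Nat.lt_succ_of_le (Finset.le_sup (Finset.mem_univ w))⟩
  have key : ∀ k n, n + k = N → ∀ c : G → ℂ,
      (∀ f : HolGerm E (1 : V), ∑ w, c w * ev (D.dividedDiffWord (red w) f) = 0) →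
      (∀ w, D.length w < n → c w = 0) → c = 0 := by
    intro k
    induction k with
    | zero =>
      intro n hn c _ h0
      exact funext fun w => h0 w (by have := hN w; omega)
    | succ k ih =>
      intro n hn c hc h0
      have ascent : ∀ w, (∃ x ∈ D.simple, D.IsPos (D.lin w x)) → c w = 0 := by
        rintro w ⟨x, hx, hp⟩
        by_cases hw : D.length w < n
        · exact h0 w hw
        have hxr := D.simple_subset hx
        have hsq : ∀ u : G, u * D.refl x * D.refl x = u := fun u => by
          rw [mul_assoc, refl_mul_self hxr, mul_one]
        have hc' := ih (n + 1) (by omega)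
          (fun u => if D.IsPos (-D.lin u x) then c (u * D.refl x) else 0) (fun f => ?_)
          (fun u hu => ?_)
        · have h1 := congrFun hc' (w * D.refl x)
          have h2 : D.IsPos (-D.lin (w * D.refl x) x) := by
            rwa [lin_mul_apply, lin_refl_self hxr, map_neg, neg_neg]
          simpa only [if_pos h2, hsq, Pi.zero_apply] using h1
        · refine (Fintype.sum_equiv (Equiv.mulRight (D.refl x)) _ _ fun u => ?_).trans
            (hc (D.dividedDiff x f))
          rw [Equiv.coe_mulRight]
          have h1 : D.lin (u * D.refl x) x = -D.lin u x := by
            rw [lin_mul_apply, lin_refl_self hxr, map_neg]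
          by_cases hu : D.IsPos (-D.lin u x)
          · rw [if_pos hu, dividedDiffWord_red_dividedDiff_of_pos hred hx (by rwa [h1]), hsq]
          · have h2 := isPos_of_not_neg (lin_mem_roots u hxr) hu
            rw [if_neg hu, zero_mul,
              dividedDiffWord_red_dividedDiff_of_neg hred hx (by rwa [h1, neg_neg])]
            rw [ev_zero, mul_zero]
        · by_cases hn : D.IsPos (-D.lin u x)
          · rw [if_pos hn]
            exact h0 _ (by have := length_mul_refl_of_neg hgen hx hn; omega)
          · exact if_neg hn
      -- only the coefficient of the longest element is left
      funext w
      by_contra hw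
      have hneg : ∀ u, c u ≠ 0 → ∀ x ∈ D.simple, D.IsPos (-D.lin u x) := fun u hu x hx => by
        by_contra h
        exact hu (ascent u ⟨x, hx, isPos_of_not_neg (lin_mem_roots u (D.simple_subset hx)) h⟩)
      obtain ⟨f, hf⟩ := exists_ev_dividedDiffWord_ne_zero (V := V) hgen (isRed_red hred w)
      have h1 := hc f
      rw [Finset.sum_eq_single w] at h1
      · exact (mul_ne_zero hw hf) h1
      · intro u _ hu
        by_contra h
        exact hu (eq_of_forall_isPos_neg hgen (hneg w hw) (hneg u (left_ne_zero_of_mul h)))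
      · intro h; exact absurd (Finset.mem_univ w) h
  exact key N 0 (by omega) c hc (fun w hw => absurd hw (Nat.not_lt_zero _))

/-- There are germs dual to the functionals `ev ∘ ∂_w`. -/
theorem exists_dual_germs [DecidableEq G] : ∃ b : G → HolGerm E (1 : V), ∀ w u,
    ev (D.dividedDiffWord (red w) (b u)) = if w = u then 1 else 0 := by
  let T : HolGerm E (1 : V) →ₗ[ℂ] (G → ℂ) := LinearMap.pi fun w =>
    (evHom (1 : V)).toLinearMap ∘ₗ D.dividedDiffWordLin (hred w).1.1
  have hT : LinearMap.range T = ⊤ := by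
    by_contra hne
    obtain ⟨φ, hφ, hle⟩ := Submodule.exists_le_ker_of_lt_top _ (lt_top_iff_ne_top.2 hne)
    refine hφ ?_
    have h1 := eq_zero_of_sum_mul_ev_eq_zero (V := V) hred
      (fun w => φ (fun j => if w = j then 1 else 0)) (fun f => ?_)
    · refine LinearMap.ext fun v => ?_
      rw [LinearMap.pi_apply_eq_sum_univ φ v]
      simp only [funext_iff, Pi.zero_apply] at h1
      simp [h1]
    · have h2 : φ (T f) = 0 := hle ⟨f, rfl⟩
      rw [LinearMap.pi_apply_eq_sum_univ φ] at h2
      refine Eq.trans ?_ h2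
      exact Finset.sum_congr rfl fun w _ => mul_comm _ _
  have h := fun u => LinearMap.range_eq_top.1 hT (fun w => if w = u then 1 else 0)
  choose b hb using h
  exact ⟨b, fun w u => congrFun (hb u) w⟩

/-- The germs dual to the functionals `ev ∘ ∂_w` generate `𝒪_e` over the invariants. -/
theorem exists_eq_sum_invariant_mul {b : G → HolGerm E (1 : V)} [DecidableEq G]
    (hb : ∀ w u, ev (D.dividedDiffWord (red w) (b u)) = if w = u then 1 else 0)
    (f : HolGerm E (1 : V)) : ∃ a : G → HolGerm E (1 : V), (∀ u (g : G), act g (a u) = a u) ∧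
      (∀ u, ev (a u) = ev (D.dividedDiffWord (red u) f)) ∧ f = ∑ u, a u * b u := by
  let M : Matrix G G (HolGerm E (1 : V)) := .of fun w u => D.dividedDiffWord (red w) (b u)
  have hM1 : (evHom (1 : V)).toRingHom.mapMatrix M = 1 := by
    ext w u
    rw [Matrix.one_apply]
    exact hb w u
  have hdet : IsUnit M.det := by
    refine isUnit_of_evHom_ne_zero ?_
    have h1 : evHom (1 : V) M.det = ((evHom (1 : V)).toRingHom.mapMatrix M).det :=
      RingHom.map_det _ _
    rw [h1, hM1, Matrix.det_one]
    exact one_ne_zero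
  obtain ⟨a, ha'⟩ : ∃ a : G → HolGerm E (1 : V),
      ∀ w, ∑ u, D.dividedDiffWord (red w) (b u) * a u = D.dividedDiffWord (red w) f :=
    exists_sum_mul_eq hdet fun w => D.dividedDiffWord (red w) f
  refine ⟨a, fun u g => ?_, fun w => ?_, ?_⟩
  · refine act_eq_of_forall_simple hred (fun x hx => ?_) g
    have hxr := D.simple_subset hx
    -- `∂_x ∂_w` is again one of the operators `∂_u`, or zero
    have h1 : ∀ w, ∑ u, D.dividedDiff x (D.dividedDiffWord (red w) (b u)) * a u =
        D.dividedDiff x (D.dividedDiffWord (red w) f) := by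
      intro w
      simp only [← dividedDiffWord_cons]
      by_cases hr : D.IsRed (x :: red w)
      · simp only [dividedDiffWord_eq_red hred hr]
        exact ha' _
      · have hs : D.IsSimpleWord (x :: red w) := isSimpleWord_cons.2 ⟨hx, (hred w).1.1⟩
        simp only [dividedDiffWord_eq_zero (generated_of_red hred) hs hr, zero_mul,
          Finset.sum_const_zero]
    have h2 : ∀ w, ∑ u, act (D.refl x) (D.dividedDiffWord (red w) (b u)) * D.dividedDiff x (a u)
        = 0 := by
      intro w
      have h3 := congrArg (D.dividedDiffLin ⟨x, hxr⟩) (ha' w)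
      rw [map_sum] at h3
      simp only [dividedDiffLin_apply, dividedDiff_mul hxr] at h3
      rwa [Finset.sum_add_distrib, h1, add_eq_left] at h3
    let s : HolGerm E (1 : V) →+* HolGerm E (1 : V) := (act (D.refl x)).toRingEquiv.toRingHom
    have hdet' : IsUnit (s.mapMatrix M).det := by
      rw [← RingHom.map_det]
      exact hdet.map s
    exact congrFun (eq_zero_of_forall_sum_mul_eq_zero hdet'
      (v := fun u => D.dividedDiff x (a u)) h2) u
  · rw [← ha' w, ← evHom_apply, ← evHom_apply, map_sum]
    simp only [map_mul, evHom_apply, hb]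
    simp
  · have h1 : red 1 = [] := List.length_eq_zero_iff.1 ((hred 1).2.trans length_one)
    have h2 := ha' 1
    rw [h1] at h2
    exact h2.symm.trans (Finset.sum_congr rfl fun u _ => mul_comm _ _)

end Chosen

end LocalReflectionGroup

/-! ### Invariants of parabolic subgroups -/

namespace LocalReflectionGroup

section Words

variable {E : Type*} [NormedAddCommGroup E] [NormedSpace ℂ E]
  {G V : Type*} [Group G] [Group V] [TopologicalSpace V] [ChartedSpace E V]
  [MulDistribMulAction G V] {D : LocalReflectionGroup E G V}

theorem isShort_one (H : Subgroup G) : D.IsShort H 1 := fun h _ => by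
  rw [length_one]; exact Nat.zero_le _

variable (D) in
theorem exists_isShort_mul (H : Subgroup G) (w : G) :
    ∃ u h, D.IsShort H u ∧ h ∈ H ∧ w = u * h := by
  classical
  have hex : ∃ n, ∃ h ∈ H, D.length (w * h) = n := ⟨_, 1, one_mem H, rfl⟩
  obtain ⟨h, hh, hn⟩ := Nat.find_spec hex
  refine ⟨w * h, h⁻¹, fun k hk => ?_, inv_mem hh, by simp⟩
  rw [hn, mul_assoc]
  exact Nat.find_min' hex ⟨_, mul_mem hh hk, rfl⟩

theorem exists_minimal_word {I : Set E} (hI : I ⊆ D.simple) {h : G}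
    (hh : h ∈ Subgroup.closure (D.refl '' I)) :
    ∃ m : List E, (∀ x ∈ m, x ∈ I) ∧ D.wordProd m = h ∧
      ∀ m' : List E, (∀ x ∈ m', x ∈ I) → D.wordProd m' = D.wordProd m → m.length ≤ m'.length := by
  classical
  have hex : ∃ n, ∃ m : List E, (∀ x ∈ m, x ∈ I) ∧ D.wordProd m = h ∧ m.length = n := by
    obtain ⟨m, h1, h2⟩ := exists_word_of_mem_closure (hI.trans D.simple_subset) hh
    exact ⟨_, m, h1, h2, rfl⟩
  obtain ⟨m, h1, h2, h3⟩ := Nat.find_spec hex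
  refine ⟨m, h1, h2, fun m' h1' h2' => ?_⟩
  rw [h3]
  exact Nat.find_min' hex ⟨m', h1', h2'.trans h2, rfl⟩

/-- A reduced expression of the longest element of a parabolic subgroup. -/
theorem exists_longest_word [Finite G] (hgen : ∀ w, ∃ l, D.IsReducedWord l w) {I : Set E}
    (hI : I ⊆ D.simple) : ∃ m : List E, D.IsSimpleWord m ∧ (∀ x ∈ I, ¬ D.IsRed (x :: m)) ∧
      ∀ w, D.IsShort (Subgroup.closure (D.refl '' I)) w → ∀ l, D.IsReducedWord l w →
        D.IsRed (l ++ m) := by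
  set H := Subgroup.closure (D.refl '' I)
  obtain ⟨h, hh, hmax⟩ := Set.exists_max_image (H : Set G) D.length (Set.toFinite _) ⟨1, one_mem H⟩
  obtain ⟨m, hm, hmh, hmin⟩ := exists_minimal_word hI hh
  have hshort : ∀ w, D.IsShort H w → ∀ l, D.IsReducedWord l w → D.IsRed (l ++ m) :=
    fun w hw l hl => hw.isRed_append hgen hI hl m hm hmin
  have hmred : D.IsRed m := hshort 1 (isShort_one H) [] ⟨⟨by simp, rfl⟩, length_one.symm⟩
  refine ⟨m, hmred.1.1, fun x hx hr => ?_, hshort⟩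
  have h1 := hmax (D.refl x * h) (mul_mem (Subgroup.subset_closure ⟨x, hx, rfl⟩) hh)
  have h2 := hr.2
  rw [wordProd_cons, hmh, List.length_cons, hmred.2, hmh] at h2
  omega

section Act

variable [HolAction E G V]

theorem act_eq_of_mem_closure {I : Set E} {f : HolGerm E (1 : V)}
    (h : ∀ x ∈ I, act (D.refl x) f = f) {g : G} (hg : g ∈ Subgroup.closure (D.refl '' I)) :
    act g f = f := by
  induction hg using Subgroup.closure_induction with
  | mem x hx =>
    obtain ⟨y, hy, rfl⟩ := hx
    exact h y hy
  | one => exact act_one f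
  | mul x y _ _ hx hy => rw [act_mul, hy, hx]
  | inv x _ hx =>
    conv_lhs => rw [← hx]
    rw [← act_mul, inv_mul_cancel, act_one]

end Act

end Words

variable {E : Type*} [NormedAddCommGroup E] [NormedSpace ℂ E] [FiniteDimensional ℂ E]
  {G V : Type*} [Group G] [Group V] [TopologicalSpace V] [ChartedSpace E V]
  [MulDistribMulAction G V] [HolAction E G V] {D : LocalReflectionGroup E G V}

/-- Divided differences are linear over the invariants of `G`. -/
theorem dividedDiffWord_invariant_mul {l : List E} (hl : D.IsSimpleWord l)
    {a : HolGerm E (1 : V)} (ha : ∀ g : G, act g a = a) (f : HolGerm E (1 : V)) :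
    D.dividedDiffWord l (a * f) = a * D.dividedDiffWord l f := by
  induction l with
  | nil => rfl
  | cons x l ih =>
    obtain ⟨hx, hl⟩ := isSimpleWord_cons.1 hl
    have hx := D.simple_subset hx
    rw [dividedDiffWord_cons, ih hl, dividedDiff_mul hx, (dividedDiff_eq_zero_iff hx).2 (ha _), ha,
      zero_mul, zero_add, dividedDiffWord_cons]

section Chosen

variable {red : G → List E} (hred : ∀ w, D.IsReducedWord (red w) w)
include hred

/-- The functionals `ev ∘ ∂_w`, for the elements `w` that are not shortest in their cosets,
vanish on the invariants of the parabolic subgroup. -/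
theorem dividedDiffWord_eq_zero_of_not_isShort {I : Set E} (hI : I ⊆ D.simple) {w : G}
    (hw : ¬ D.IsShort (Subgroup.closure (D.refl '' I)) w) {f : HolGerm E (1 : V)}
    (hf : ∀ g ∈ Subgroup.closure (D.refl '' I), act g f = f) :
    D.dividedDiffWord (red w) f = 0 := by
  have hgen := generated_of_red hred
  obtain ⟨u, h, hu, hh, rfl⟩ := exists_isShort_mul D (Subgroup.closure (D.refl '' I)) w
  obtain ⟨m, hm, rfl, hmin⟩ := exists_minimal_word hI hh
  have hr := hu.isRed_append hgen hI (hred u) m hm hmin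
  have h1 := dividedDiffWord_eq_red hred hr f
  rw [wordProd_append, wordProd_red hred] at h1
  rw [← h1]
  rcases List.eq_nil_or_concat' m with rfl | ⟨m, x, rfl⟩
  · rw [wordProd_nil, mul_one] at hw
    exact absurd hu hw
  · have hx : x ∈ I := hm x (by simp)
    have h2 : D.dividedDiffWord [x] f = 0 := (dividedDiff_eq_zero_iff
      (D.simple_subset (hI hx))).2 (hf _ (Subgroup.subset_closure ⟨x, hx, rfl⟩))
    rw [← List.append_assoc] at hr ⊢
    rw [dividedDiffWord_append, h2, dividedDiffWord_zero (hr.append_left hgen).1.1]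

variable [Fintype G]

/-- The functionals `ev ∘ ∂_w`, for the shortest representatives `w` of the cosets of a parabolic
subgroup, are independent on the invariants of this subgroup: the divided difference for the
longest element of the subgroup maps the germs dual to all functionals to invariants. -/
theorem exists_invariant_ev_eq {I : Set E} (hI : I ⊆ D.simple) (c : G → ℂ) :
    ∃ f : HolGerm E (1 : V), (∀ g ∈ Subgroup.closure (D.refl '' I), act g f = f) ∧
      ∀ w, D.IsShort (Subgroup.closure (D.refl '' I)) w →
        ev (D.dividedDiffWord (red w) f) = c w := by
  classical
  have hgen := generated_of_red hred
  obtain ⟨m, hm, hmax, hmr⟩ := exists_longest_word hgen hI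
  obtain ⟨b, hb⟩ := exists_dual_germs (V := V) hred
  refine ⟨D.dividedDiffWord m (∑ u, c (u * (D.wordProd m)⁻¹) • b u), fun g hg => ?_,
    fun w hw => ?_⟩
  · refine act_eq_of_mem_closure (fun x hx => ?_) hg
    rw [← dividedDiff_eq_zero_iff (D.simple_subset (hI hx)), ← dividedDiffWord_cons]
    exact dividedDiffWord_eq_zero hgen (isSimpleWord_cons.2 ⟨hI hx, hm⟩) (hmax x hx) _
  · have hr := hmr w hw _ (hred w)
    rw [← dividedDiffWord_append, dividedDiffWord_eq_red hred hr, ← dividedDiffWordLin_apply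
      (hred _).1.1, map_sum, ← evHom_apply, map_sum]
    simp only [map_smul, dividedDiffWordLin_apply, evHom_apply, hb, smul_eq_mul, mul_ite, mul_one,
      mul_zero]
    rw [Finset.sum_ite_eq, if_pos (Finset.mem_univ _), wordProd_append, wordProd_red hred,
      mul_inv_cancel_right]

/-- An invariant germ of a parabolic subgroup that is annihilated by the functionals `ev ∘ ∂_w`
belongs to the ideal generated by the `G`-invariant germs that vanish at the identity: its expansion
in the dual germs has such coefficients, and the dual germs can be averaged over the subgroup. -/
theorem exists_eq_sum_of_ev_eq_zero {I : Set E} (hI : I ⊆ D.simple) {f : HolGerm E (1 : V)}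
    (hf : ∀ g ∈ Subgroup.closure (D.refl '' I), act g f = f)
    (h0 : ∀ w, D.IsShort (Subgroup.closure (D.refl '' I)) w →
      ev (D.dividedDiffWord (red w) f) = 0) :
    ∃ a b : G → HolGerm E (1 : V), (∀ u (g : G), act g (a u) = a u) ∧ (∀ u, ev (a u) = 0) ∧
      (∀ u, ∀ g ∈ Subgroup.closure (D.refl '' I), act g (b u) = b u) ∧ f = ∑ u, a u * b u := by
  classical
  obtain ⟨b, hb⟩ := exists_dual_germs (V := V) hred
  obtain ⟨a, ha, hea, hfa⟩ := exists_eq_sum_invariant_mul hred hb f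
  set H := Subgroup.closure (D.refl '' I)
  have hcard : (Fintype.card H : ℂ) ≠ 0 := Nat.cast_ne_zero.2 Fintype.card_ne_zero
  refine ⟨a, fun u => (Fintype.card H : ℂ)⁻¹ • ∑ h : H, act (h : G) (b u), ha, fun u => ?_,
    fun u g hg => ?_, ?_⟩
  · rw [hea]
    by_cases hu : D.IsShort H u
    · exact h0 u hu
    · rw [dividedDiffWord_eq_zero_of_not_isShort hred hI hu hf, ev_zero]
  · rw [map_smul, map_sum]
    congr 1
    refine Fintype.sum_equiv (Equiv.mulLeft (⟨g, hg⟩ : H)) _ _ fun h => ?_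
    rw [← act_mul]
    rfl
  · have h1 : ∀ h : H, ∑ u, a u * act (h : G) (b u) = f := fun h => by
      conv_rhs => rw [← hf h h.2, hfa, map_sum]
      exact Finset.sum_congr rfl fun u _ => by rw [map_mul, ha]
    have h2 : ∑ h : H, ∑ u, a u * act (h : G) (b u) = (Fintype.card H : ℂ) • f := by
      rw [Finset.sum_congr rfl fun h _ => h1 h, Finset.sum_const, Finset.card_univ,
        Nat.cast_smul_eq_nsmul]
    rw [Finset.sum_comm] at h2
    calc f = (Fintype.card H : ℂ)⁻¹ • ((Fintype.card H : ℂ) • f) := (inv_smul_smul₀ hcard f).symm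
      _ = _ := by
        rw [← h2, Finset.smul_sum]
        exact Finset.sum_congr rfl fun u _ => by
          rw [mul_smul_comm]
          exact congrArg _ (Finset.mul_sum _ _ _).symm

end Chosen

end LocalReflectionGroup

/-! ### Invariant families of germs -/

section Orbits

variable {G V : Type*} [Group G] [MulAction G V]

theorem smul_mem_orbit_iff (ξ : V) (g : G) (x : V) :
    g • x ∈ MulAction.orbit G ξ ↔ x ∈ MulAction.orbit G ξ := by
  rw [← MulAction.orbit_eq_iff, MulAction.orbit_smul, MulAction.orbit_eq_iff]

theorem exists_smul_eq {o : MulAction.orbitRel.Quotient G V} (x y : o.orbit) :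
    ∃ g : G, g • (x : V) = y := by
  have hx := MulAction.orbitRel.Quotient.mem_orbit.1 x.2
  have hy := MulAction.orbitRel.Quotient.mem_orbit.1 y.2
  have h : MulAction.orbitRel G V y x := Quotient.exact (hy.trans hx.symm)
  exact h

end Orbits

section Families

section Restriction

variable {E : Type*} [NormedAddCommGroup E] [NormedSpace ℂ E]
  {V : Type*} [TopologicalSpace V] [ChartedSpace E V]

open Classical in
/-- The family of germs that is equal to `F` on the set `Y`, and zero elsewhere. -/
def restrictTo (Y : Set V) (F : Π x : V, HolGerm E x) (x : V) : HolGerm E x :=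
  if x ∈ Y then F x else 0

theorem restrictTo_of_mem {Y : Set V} (F : Π x : V, HolGerm E x) {x : V} (h : x ∈ Y) :
    restrictTo Y F x = F x := if_pos h

theorem restrictTo_of_notMem {Y : Set V} (F : Π x : V, HolGerm E x) {x : V} (h : x ∉ Y) :
    restrictTo Y F x = 0 := if_neg h

end Restriction

variable {E : Type*} [NormedAddCommGroup E] [NormedSpace ℂ E]
  {G : Type*} [Group G]
  {V : Type*} [Group V] [TopologicalSpace V] [ChartedSpace E V]
  [MulDistribMulAction G V] [HolAction E G V]

variable (G) in
open Classical in
/-- The family of germs supported on the orbit of `ξ` that is obtained by moving the germ `f`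
at `ξ` along the orbit.  It depends on the choice of the elements of `G`, unless `f` is invariant
under the stabilizer of `ξ`. -/
def spread (ξ : V) (f : HolGerm E ξ) (x : V) : HolGerm E x :=
  if h : ∃ g : G, g • x = ξ then pull (groupMap E h.choose) h.choose_spec f else 0

theorem spread_eq {ξ : V} {f : HolGerm E ξ}
    (hf : ∀ (g : G) (h : g • ξ = ξ), pull (groupMap E g) h f = f) (g : G) {x : V}
    (h : g • x = ξ) : spread G ξ f x = pull (groupMap E g) h f := by
  have hex : ∃ g : G, g • x = ξ := ⟨g, h⟩
  rw [spread, dif_pos hex]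
  set k := hex.choose
  have hk : k • x = ξ := hex.choose_spec
  have h1 : (k * g⁻¹) • ξ = ξ := by rw [← h, mul_smul, inv_smul_smul, hk, h]
  conv_rhs => rw [← hf _ h1]
  refine (pull_pull _ _ _ _ _ _ (fun t => ?_) f).symm
  change k • t = (k * g⁻¹) • g • t
  rw [mul_smul, inv_smul_smul]

theorem spread_self {ξ : V} {f : HolGerm E ξ}
    (hf : ∀ (g : G) (h : g • ξ = ξ), pull (groupMap E g) h f = f) : spread G ξ f ξ = f := by
  rw [spread_eq hf 1 (one_smul G ξ), hf]

theorem isInvariant_spread {ξ : V} {f : HolGerm E ξ}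
    (hf : ∀ (g : G) (h : g • ξ = ξ), pull (groupMap E g) h f = f) :
    IsInvariant E G (spread G ξ f) := by
  intro g x y h
  replace h : g • x = y := h
  by_cases hy : ∃ k : G, k • y = ξ
  · obtain ⟨k, hk⟩ := hy
    have hx : (k * g) • x = ξ := by rw [mul_smul, h, hk]
    rw [spread_eq hf k hk, spread_eq hf _ hx]
    exact pull_pull _ _ _ _ _ _ (fun t => mul_smul k g t) f
  · have hx : ¬ ∃ k : G, k • x = ξ := by
      rintro ⟨k, hk⟩
      exact hy ⟨k * g⁻¹, by rw [← h, mul_smul, inv_smul_smul, hk]⟩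
    rw [spread, spread, dif_neg hx, dif_neg hy, map_zero]

theorem mem_invGerm_iff {ξ : V} {f : HolGerm E ξ} : f ∈ invGerm E G ξ ↔
    ∀ (g : G) (h : g • ξ = ξ), pull (groupMap E g) h f = f := by
  refine ⟨?_, fun h => ⟨spread G ξ f, isInvariant_spread h, spread_self h⟩⟩
  rintro ⟨F, hF, rfl⟩ g h
  exact hF g ξ ξ h

theorem IsInvariant.restrictTo {Y : Set V} (hY : ∀ (g : G), ∀ x, g • x ∈ Y ↔ x ∈ Y)
    {F : Π x : V, HolGerm E x} (hF : IsInvariant E G F) : IsInvariant E G (restrictTo Y F) := by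
  intro g x y h
  have h1 := hY g x
  rw [show g • x = y from h] at h1
  by_cases hx : x ∈ Y
  · rw [restrictTo_of_mem F hx, restrictTo_of_mem F (h1.2 hx), hF]
  · rw [restrictTo_of_notMem F hx, restrictTo_of_notMem F fun hy => hx (h1.1 hy), map_zero]

theorem restrictTo_orbit_mem [Finite G] {W : Set V} {ξ : V} (h : MulAction.orbit G ξ ⊆ W)
    {F : Π x : V, HolGerm E x} (hF : IsInvariant E G F) :
    restrictTo (MulAction.orbit G ξ) F ∈ invSections E G W := by
  refine ⟨hF.restrictTo (smul_mem_orbit_iff ξ), (Set.finite_range fun g : G => g • ξ).subset ?_,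
    fun x hx => restrictTo_of_notMem F fun hx' => hx (h hx')⟩
  intro x hx
  by_contra hc
  exact hx (restrictTo_of_notMem F hc)

end Families

/-! ### The fibres and their duals -/

section Fibres

variable {E : Type*} [NormedAddCommGroup E] [NormedSpace ℂ E]
  {G : Type*} [Group G]
  {V : Type*} [Group V] [TopologicalSpace V] [ChartedSpace E V] [LieGroup 𝓘(ℂ, E) ω V]
  [MulDistribMulAction G V] [HolAction E G V]

/-- Translation of germs to the identity is compatible with the action of stabilizers. -/
theorem pull_leftTrans_pull_groupMap {ξ : V} (g : G) (h : g • ξ = ξ) (f : HolGerm E ξ) :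
    pull (leftTrans E ξ) (leftTrans_one ξ) (pull (groupMap E g) h f) =
      act g⁻¹ (pull (leftTrans E ξ) (leftTrans_one ξ) f) := by
  have h1 : ((leftTrans E ξ).trans (groupMap E g)) 1 = ξ := by
    change g • (ξ * 1) = ξ
    rw [mul_one, h]
  refine (pull_pull _ _ ((leftTrans E ξ).trans (groupMap E g)) _ _ h1 (fun t => rfl) f).trans
    (pull_pull _ _ _ _ _ _ (fun t => ?_) f).symm
  change g • (ξ * t) = ξ * g⁻¹⁻¹ • t
  rw [smul_mul', h, inv_inv]

theorem mem_invGerm_iff_act {ξ : V} {f : HolGerm E ξ} : f ∈ invGerm E G ξ ↔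
    ∀ g ∈ MulAction.stabilizer G ξ, act g (pull (leftTrans E ξ) (leftTrans_one ξ) f) =
      pull (leftTrans E ξ) (leftTrans_one ξ) f := by
  rw [mem_invGerm_iff]
  refine ⟨fun H g hg => ?_, fun H g hg => ?_⟩
  · have := pull_leftTrans_pull_groupMap g⁻¹ (inv_mem hg) f
    rw [H g⁻¹ (inv_mem hg), inv_inv] at this
    exact this.symm
  · refine (pull (leftTrans E ξ) (leftTrans_one ξ)).injective ?_
    rw [pull_leftTrans_pull_groupMap, H g⁻¹ (inv_mem hg)]

omit [LieGroup 𝓘(ℂ, E) ω V] in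
theorem mem_invGerm_one_iff {f : HolGerm E (1 : V)} : f ∈ invGerm E G (1 : V) ↔
    ∀ g : G, act g f = f := by
  rw [mem_invGerm_iff]
  exact ⟨fun H g => H g⁻¹ (smul_one _), fun H g _ => by
    have := H g⁻¹
    simp only [act, inv_inv] at this
    exact this⟩

variable (E) in
/-- An invariant element of the sum of the fibres over an orbit is given by its component at any
point of the orbit. -/
def fibreInvEval (o : MulAction.orbitRel.Quotient G V) (ξ : o.orbit) :
    fibreInv E o →ₗ[ℂ] Fibre E G (ξ : V) where
  toFun e := e.1 ξ
  map_add' _ _ := rfl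
  map_smul' _ _ := rfl

theorem fibreInvEval_bijective (o : MulAction.orbitRel.Quotient G V) (ξ : o.orbit) :
    Function.Bijective (fibreInvEval E o ξ) := by
  constructor
  · intro e e' h
    refine Subtype.ext (funext fun x => ?_)
    obtain ⟨g, hg⟩ := exists_smul_eq x ξ
    rw [← e.2 g x ξ hg, ← e'.2 g x ξ hg]
    exact congrArg _ h
  · intro c
    obtain ⟨⟨_, F, hF, rfl⟩, rfl⟩ := Ideal.Quotient.mk_surjective c
    exact ⟨⟨fun x => Ideal.Quotient.mk _ ⟨F x, F, hF, rfl⟩,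
      fun g x y h => congrArg (Ideal.Quotient.mk (fibreIdeal E G (x : V)))
        (Subtype.ext (hF g x y h))⟩, rfl⟩

theorem exists_linearEquiv_of_ker_eq {K M A B : Type*} [Field K] [AddCommGroup M] [Module K M]
    [AddCommGroup A] [Module K A] [AddCommGroup B] [Module K B] {p : M →ₗ[K] A} {q : M →ₗ[K] B}
    (hp : Function.Surjective p) (hq : Function.Surjective q)
    (h : LinearMap.ker p = LinearMap.ker q) : ∃ e : A ≃ₗ[K] B, ∀ m, e (p m) = q m := by
  refine ⟨(p.quotKerEquivOfSurjective hp).symm.trans ((Submodule.quotEquivOfEq _ _ h).trans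
    (q.quotKerEquivOfSurjective hq)), fun m => ?_⟩
  have h1 : (p.quotKerEquivOfSurjective hp).symm (p m) = Submodule.Quotient.mk m := by
    rw [LinearEquiv.symm_apply_eq]; rfl
  rw [LinearEquiv.trans_apply, h1]
  rfl

variable [FiniteDimensional ℂ E] [Finite G] {D : LocalReflectionGroup E G V}

open LocalReflectionGroup in
/-- The fibre at a point with parabolic stabilizer has coordinates given by the functionals
`ev_e ∘ ∂_w ∘ φ_ξ⁻¹`, where `w` is a shortest element of its coset. -/
theorem exists_fibre_linearEquiv {red : G → List E} (hred : ∀ w, D.IsReducedWord (red w) w)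
    {ξ : V} (hpar : D.IsParabolic (MulAction.stabilizer G ξ)) :
    ∃ e : Fibre E G ξ ≃ₗ[ℂ] ({w : G // D.IsShort (MulAction.stabilizer G ξ) w} → ℂ),
      ∀ f w, e (Ideal.Quotient.mk _ f) w = D.functional (red w) ξ (f : HolGerm E ξ) := by
  have := Fintype.ofFinite G
  obtain ⟨I, hI, hH⟩ := hpar
  set τ := pull (leftTrans E ξ) (leftTrans_one ξ)
  let T : invGerm E G ξ →ₗ[ℂ] ({w : G // D.IsShort (MulAction.stabilizer G ξ) w} → ℂ) :=
    LinearMap.pi fun w => (evHom (1 : V)).toLinearMap ∘ₗ D.dividedDiffWordLin (hred w).1.1 ∘ₗ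
      (τ : HolGerm E ξ →ₐ[ℂ] HolGerm E (1 : V)).toLinearMap ∘ₗ (invGerm E G ξ).val.toLinearMap
  have hTapp : ∀ f w, T f w = ev (D.dividedDiffWord (red w) (τ f)) := fun f w => rfl
  have hmem : ∀ b, (∀ g ∈ MulAction.stabilizer G ξ, act g b = b) →
      τ.symm b ∈ invGerm E G ξ := fun b hb => by
    rw [mem_invGerm_iff_act]
    intro g hg
    change act g (τ (τ.symm b)) = τ (τ.symm b)
    rw [τ.apply_symm_apply, hb g hg]
  let q : invGerm E G ξ →ₗ[ℂ] Fibre E G ξ := (Ideal.Quotient.mkₐ ℂ (fibreIdeal E G ξ)).toLinearMap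
  have hq : Function.Surjective q := Ideal.Quotient.mk_surjective
  have hT : Function.Surjective T := by
    intro c
    classical
    obtain ⟨f, hf, hfc⟩ := exists_invariant_ev_eq (V := V) hred hI
      (fun w => if h : D.IsShort (MulAction.stabilizer G ξ) w then c ⟨w, h⟩ else 0)
    rw [← hH] at hf hfc
    refine ⟨⟨τ.symm f, hmem f hf⟩, funext fun w => ?_⟩
    rw [hTapp]
    change ev (D.dividedDiffWord (red w) (τ (τ.symm f))) = _
    rw [τ.apply_symm_apply, hfc w w.2, dif_pos w.2]
  have hker : LinearMap.ker q = LinearMap.ker T := by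
    ext f
    rw [LinearMap.mem_ker, LinearMap.mem_ker]
    have h1 : q f = 0 ↔ f ∈ fibreIdeal E G ξ := Ideal.Quotient.eq_zero_iff_mem
    rw [h1]
    constructor
    · intro hf
      have key : ∀ x ∈ fibreIdeal E G ξ, ∀ a, T (a * x) = 0 := by
        intro x hx
        induction hx using Submodule.span_induction with
        | mem x hx =>
          obtain ⟨f', hf', h0, hx⟩ := hx
          intro a
          funext w
          have h2 : τ (a * x : invGerm E G ξ) = f' * τ a := by
            rw [mul_comm a x, MulMemClass.coe_mul, map_mul]
            exact congrArg (· * _) hx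
          rw [hTapp, h2, dividedDiffWord_invariant_mul (hred w).1.1 (mem_invGerm_one_iff.1 hf'),
            ← evHom_apply, map_mul, evHom_apply, h0, zero_mul]
          rfl
        | zero => intro a; rw [mul_zero, map_zero]
        | add x y _ _ hx hy => intro a; rw [mul_add, map_add, hx, hy, add_zero]
        | smul b x _ hx => intro a; rw [smul_eq_mul, ← mul_assoc]; exact hx _
      have := key f hf 1
      rwa [one_mul] at this
    · intro hf
      obtain ⟨a, b, ha, ha0, hb, hfab⟩ := exists_eq_sum_of_ev_eq_zero (V := V) hred hI
        (f := τ f) (hH ▸ mem_invGerm_iff_act.1 f.2) (fun w hw => by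
          rw [← hH] at hw
          rw [← hTapp f ⟨w, hw⟩, hf]; rfl)
      rw [← hH] at hb
      have h2 : f = ∑ u, (⟨τ.symm (b u), hmem _ (hb u)⟩ : invGerm E G ξ) *
          ⟨τ.symm (a u), hmem _ fun g _ => ha u g⟩ := by
        refine Subtype.ext (τ.injective ?_)
        rw [hfab, AddSubmonoidClass.coe_finsetSum, map_sum]
        refine Finset.sum_congr rfl fun u _ => ?_
        rw [MulMemClass.coe_mul, map_mul, τ.apply_symm_apply, τ.apply_symm_apply, mul_comm]
      rw [h2]
      refine sum_mem fun u _ => Ideal.mul_mem_left _ _ (Ideal.subset_span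
        ⟨a u, mem_invGerm_one_iff.2 (ha u), ha0 u, τ.apply_symm_apply _⟩)
  obtain ⟨e, he⟩ := exists_linearEquiv_of_ker_eq hq hT hker
  exact ⟨e, fun f w => congrFun (he f) w⟩

/-- The functionals `ev_e ∘ ∂_w ∘ φ_ξ⁻¹` form a basis of the dual space of `𝔼^G` for the orbit
of a point `ξ` with parabolic stabilizer. -/
theorem exists_dual_basis {red : G → List E} (hred : ∀ w, D.IsReducedWord (red w) w)
    {o : MulAction.orbitRel.Quotient G V} {ξ : V} (hξ : ξ ∈ o.orbit)
    (hpar : D.IsParabolic (MulAction.stabilizer G ξ)) (W : Set V) :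
    ∃ b : Module.Basis {w : G // D.IsShort (MulAction.stabilizer G ξ) w} ℂ
        (Module.Dual ℂ (fibreInv E o)), ∀ w (F : invSections E G W),
      b w (toFibre E G W o F) = D.functional (red w) ξ (F.1 ξ) := by
  classical
  obtain ⟨e, he⟩ := exists_fibre_linearEquiv hred hpar
  let e' := (LinearEquiv.ofBijective (fibreInvEval E o ⟨ξ, hξ⟩)
    (fibreInvEval_bijective o ⟨ξ, hξ⟩)).trans e
  refine ⟨(Module.Basis.ofEquivFun e').dualBasis, fun w F => ?_⟩
  rw [Module.Basis.dualBasis_apply, Module.Basis.ofEquivFun_repr_apply]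
  exact he _ w

end Fibres

/-! ### The action of the skew-group ring on families of germs -/

section SkewAction

variable {E : Type*} [NormedAddCommGroup E] [NormedSpace ℂ E]
  {V : Type*} [Group V] [TopologicalSpace V] [ChartedSpace E V] [LieGroup 𝓘(ℂ, E) ω V]

omit [Group V] [LieGroup 𝓘(ℂ, E) ω V] in
theorem toMero_injective :
    Function.Injective (toMero : (Π x : V, HolGerm E x) → Π x : V, MeroGerm E x) := by
  intro F F' h
  funext x
  exact IsFractionRing.injective (HolGerm E x) (MeroGerm E x) (congrFun h x)

omit [Group V] [LieGroup 𝓘(ℂ, E) ω V] in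
theorem toMero_add (F F' : Π x : V, HolGerm E x) : toMero (F + F') = toMero F + toMero F' :=
  funext fun _ => map_add _ _ _

omit [Group V] [LieGroup 𝓘(ℂ, E) ω V] in
theorem toMero_mul (F F' : Π x : V, HolGerm E x) : toMero (F * F') = toMero F * toMero F' :=
  funext fun _ => map_mul _ _ _

omit [Group V] [LieGroup 𝓘(ℂ, E) ω V] in
theorem toMero_smul (c : ℂ) (F : Π x : V, HolGerm E x) : toMero (c • F) = c • toMero F :=
  funext fun x => (IsScalarTower.toAlgHom ℂ (HolGerm E x) (MeroGerm E x)).toLinearMap.map_smul c (F x)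

theorem phi_add (ξ : V) (F F' : Π x : V, MeroGerm E x) : phi ξ (F + F') = phi ξ F + phi ξ F' :=
  funext fun x => map_add (pullMero (x := x) (y := ξ⁻¹ * x) (leftTrans E ξ⁻¹)
    (leftTrans_inv_apply ξ x)) _ _

theorem phi_mul_apply (ξ : V) (F F' : Π x : V, MeroGerm E x) :
    phi ξ (F * F') = phi ξ F * phi ξ F' :=
  funext fun x => map_mul (pullMero (x := x) (y := ξ⁻¹ * x) (leftTrans E ξ⁻¹)
    (leftTrans_inv_apply ξ x)) _ _

theorem phi_smul (ξ : V) (c : ℂ) (F : Π x : V, MeroGerm E x) : phi ξ (c • F) = c • phi ξ F :=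
  funext fun x => map_smul (pullMero (x := x) (y := ξ⁻¹ * x) (leftTrans E ξ⁻¹)
    (leftTrans_inv_apply ξ x)) c _

variable {Gim : Subgroup V}

theorem skewAct_single (ξ : Gim) (f : meroFun E V) (F : Π x : V, MeroGerm E x) :
    skewAct (SkewMonoidAlgebra.single ξ f) F = f.1 * phi (ξ : V) F :=
  SkewMonoidAlgebra.sum_single_index (zero_mul _)

theorem skewAct_zero (F : Π x : V, MeroGerm E x) : skewAct (0 : SkewRing E Gim) F = 0 :=
  SkewMonoidAlgebra.sum_zero_index

theorem skewAct_add (A B : SkewRing E Gim) (F : Π x : V, MeroGerm E x) :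
    skewAct (A + B) F = skewAct A F + skewAct B F :=
  SkewMonoidAlgebra.sum_add_index' (fun _ => zero_mul _) (fun _ _ _ => add_mul _ _ _)

theorem skewAct_smul (c : ℂ) (A : SkewRing E Gim) (F : Π x : V, MeroGerm E x) :
    skewAct (c • A) F = c • skewAct A F := by
  induction A using SkewMonoidAlgebra.induction_on with
  | zero => rw [smul_zero, skewAct_zero, smul_zero]
  | single ξ f =>
    rw [SkewMonoidAlgebra.smul_single, skewAct_single, skewAct_single]
    exact smul_mul_assoc _ _ _
  | add A B hA hB => rw [smul_add, skewAct_add, skewAct_add, hA, hB, smul_add]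

theorem skewAct_one (F : Π x : V, MeroGerm E x) : skewAct (1 : SkewRing E Gim) F = F := by
  rw [SkewMonoidAlgebra.one_def, skewAct_single]
  change 1 * phi (1 : V) F = F
  rw [phi_one, one_mul]

theorem skewAct_add_right (A : SkewRing E Gim) (F F' : Π x : V, MeroGerm E x) :
    skewAct A (F + F') = skewAct A F + skewAct A F' := by
  induction A using SkewMonoidAlgebra.induction_on with
  | zero => simp only [skewAct_zero, add_zero]
  | single ξ f => simp only [skewAct_single, phi_add, mul_add]
  | add A B hA hB => rw [skewAct_add, skewAct_add, skewAct_add, hA, hB, add_add_add_comm]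

theorem skewAct_smul_right (A : SkewRing E Gim) (c : ℂ) (F : Π x : V, MeroGerm E x) :
    skewAct A (c • F) = c • skewAct A F := by
  induction A using SkewMonoidAlgebra.induction_on with
  | zero => simp only [skewAct_zero, smul_zero]
  | single ξ f => simp only [skewAct_single, phi_smul, mul_smul_comm]
  | add A B hA hB => rw [skewAct_add, skewAct_add, hA, hB, smul_add]

theorem skewAct_zero_right (A : SkewRing E Gim) : skewAct A (0 : Π x : V, MeroGerm E x) = 0 := by
  have := skewAct_smul_right A 0 (0 : Π x : V, MeroGerm E x)
  rwa [zero_smul, zero_smul] at this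

theorem skewAct_mul (A B : SkewRing E Gim) (F : Π x : V, MeroGerm E x) :
    skewAct (A * B) F = skewAct A (skewAct B F) := by
  induction A using SkewMonoidAlgebra.induction_on with
  | zero => rw [zero_mul, skewAct_zero, skewAct_zero]
  | single ξ f =>
    induction B using SkewMonoidAlgebra.induction_on with
    | zero => rw [mul_zero, skewAct_zero, skewAct_zero_right]
    | single η f' =>
      rw [SkewMonoidAlgebra.single_mul_single, skewAct_single, skewAct_single, skewAct_single,
        phi_mul_apply, ← mul_assoc]
      exact congrArg (_ * ·) (phi_mul (ξ : V) η F)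
    | add A B hA hB => rw [mul_add, skewAct_add, hA, hB, skewAct_add, skewAct_add_right]
  | add A B hA hB => rw [add_mul, skewAct_add, hA, hB, skewAct_add]

/-- The value of `A F` at a point depends on the values of `F` at finitely many points only. -/
theorem exists_finite_skewAct_eq_zero (A : SkewRing E Gim) (x : V) : ∃ P : Set V, P.Finite ∧
    ∀ F : Π x : V, MeroGerm E x, (∀ y ∈ P, F y = 0) → skewAct A F x = 0 := by
  induction A using SkewMonoidAlgebra.induction_on with
  | zero => exact ⟨∅, Set.finite_empty, fun F _ => by rw [skewAct_zero]; rfl⟩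
  | single ξ f =>
    refine ⟨{(ξ : V)⁻¹ * x}, Set.finite_singleton _, fun F hF => ?_⟩
    rw [skewAct_single, Pi.mul_apply, phi, hF _ rfl, map_zero, mul_zero]
  | add A B hA hB =>
    obtain ⟨P, hP, h⟩ := hA
    obtain ⟨P', hP', h'⟩ := hB
    refine ⟨P ∪ P', hP.union hP', fun F hF => ?_⟩
    rw [skewAct_add, Pi.add_apply, h F fun y hy => hF y (Or.inl hy),
      h' F fun y hy => hF y (Or.inr hy), add_zero]

/-- The family of the left translates `φ_x(r)` of a germ `r` at the identity. -/
def translates (r : HolGerm E (1 : V)) (x : V) : HolGerm E x :=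
  pull (leftTrans E x⁻¹) (inv_mul_cancel x) r

theorem phi_translates (ξ : V) (r : HolGerm E (1 : V)) :
    phi ξ (toMero (translates r)) = toMero (translates r) := by
  funext x
  refine (pullMero_algebraMap _ _ _).trans (congrArg _ ?_)
  refine pull_pull _ _ _ _ _ _ (fun t => ?_) r
  simp only [leftTrans_inv_apply]
  group

/-- The action of the skew-group ring is linear over the germs at the identity, which act on
families of germs by their translates. -/
theorem skewAct_translates_mul (A : SkewRing E Gim) (r : HolGerm E (1 : V))
    (F : Π x : V, MeroGerm E x) :
    skewAct A (toMero (translates r) * F) = toMero (translates r) * skewAct A F := by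
  induction A using SkewMonoidAlgebra.induction_on with
  | zero => rw [skewAct_zero, skewAct_zero, mul_zero]
  | single ξ f =>
    rw [skewAct_single, skewAct_single, phi_mul_apply, phi_translates, mul_left_comm]
  | add A B hA hB => rw [skewAct_add, skewAct_add, hA, hB, mul_add]

end SkewAction

/-! ### Families of germs and the fibres -/

section Sections

variable {E : Type*} [NormedAddCommGroup E] [NormedSpace ℂ E]
  {G : Type*} [Group G]
  {V : Type*} [Group V] [TopologicalSpace V] [ChartedSpace E V] [LieGroup 𝓘(ℂ, E) ω V]
  [MulDistribMulAction G V] [HolAction E G V]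

theorem isInvariant_translates {r : HolGerm E (1 : V)} (hr : r ∈ invGerm E G (1 : V)) :
    IsInvariant E G (translates r) := by
  intro g x y h
  have h1 : g • (1 : V) = 1 := smul_one g
  have h2 := mem_invGerm_iff.1 hr g h1
  have h3 : ((groupMap E g).trans (leftTrans E y⁻¹)) x = (1 : V) := by
    change y⁻¹ * (groupMap E g x) = 1
    rw [h, inv_mul_cancel]
  refine (pull_pull _ _ ((groupMap E g).trans (leftTrans E y⁻¹)) _ _ h3 (fun t => rfl) r).trans ?_
  conv_rhs => rw [translates, ← h2]
  refine (pull_pull _ _ _ _ _ _ (fun t => ?_) r).symm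
  change y⁻¹ * g • t = g • (x⁻¹ * t)
  rw [smul_mul', smul_inv', show g • x = y from h]

variable {W : Set V}

variable (E G) in
/-- The projection of `𝔒^G|_W` to the fibre at a point. -/
def fibreAt (W : Set V) (x : V) : invSections E G W →ₗ[ℂ] Fibre E G x where
  toFun F := Ideal.Quotient.mk (fibreIdeal E G x) ⟨F.1 x, F.1, F.2.1, rfl⟩
  map_add' _ _ := rfl
  map_smul' _ _ := rfl

theorem fibreAt_eq_zero_iff {x : V} {F : invSections E G W} :
    fibreAt E G W x F = 0 ↔ (⟨F.1 x, F.1, F.2.1, rfl⟩ : invGerm E G x) ∈ fibreIdeal E G x :=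
  Ideal.Quotient.eq_zero_iff_mem

theorem fibreAt_congr {x : V} {F F' : invSections E G W} (h : F.1 x = F'.1 x) :
    fibreAt E G W x F = fibreAt E G W x F' := congrArg (Ideal.Quotient.mk _) (Subtype.ext h)

theorem fibreAt_eq_zero_of_eq_zero {x : V} {F : invSections E G W} (h : F.1 x = 0) :
    fibreAt E G W x F = 0 := (fibreAt_congr (F' := 0) h).trans (map_zero _)

theorem fibreAt_eq_zero_of_smul {F : invSections E G W} (g : G) {x : V}
    (h : fibreAt E G W (g • x) F = 0) : fibreAt E G W x F = 0 := by
  have h1 : fibreMap E g (rfl : g • x = g • x) (fibreAt E G W (g • x) F) = fibreAt E G W x F :=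
    congrArg (Ideal.Quotient.mk (fibreIdeal E G x)) (Subtype.ext (F.2.1 g x _ rfl))
  rw [← h1, h, map_zero]

theorem toFibre_eq_zero_iff {o : MulAction.orbitRel.Quotient G V} {F : invSections E G W} :
    toFibre E G W o F = 0 ↔ ∀ x ∈ o.orbit, fibreAt E G W x F = 0 :=
  ⟨fun h x hx => congrFun (congrArg Subtype.val h) ⟨x, hx⟩,
    fun h => Subtype.ext (funext fun x => h x x.2)⟩

/-- The product of a family with the translates of an invariant germ at the identity. -/
def translatesMul {r : HolGerm E (1 : V)} (hr : r ∈ invGerm E G (1 : V))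
    (F : invSections E G W) : invSections E G W :=
  ⟨translates r * F.1, fun g x y h => by
    change pull (groupMap E g) h (translates r y * F.1 y) = translates r x * F.1 x
    rw [map_mul, isInvariant_translates hr g x y h, F.2.1 g x y h],
    F.2.2.1.subset fun x hx hc => hx (by
      change translates r x * F.1 x = 0
      rw [hc, mul_zero]),
    fun x hx => by
      change translates r x * F.1 x = 0
      rw [F.2.2.2 x hx, mul_zero]⟩

theorem pull_translates (r : HolGerm E (1 : V)) (x : V) :
    pull (leftTrans E x) (leftTrans_one x) (translates r x) = r := by
  have h1 : ((leftTrans E x).trans (leftTrans E x⁻¹)) 1 = (1 : V) := by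
    change x⁻¹ * (x * 1) = 1
    rw [mul_one, inv_mul_cancel]
  refine (pull_pull _ _ ((leftTrans E x).trans (leftTrans E x⁻¹)) _ _ h1 (fun t => rfl) r).trans
    (pull_id _ _ (fun t => ?_) r)
  exact inv_mul_cancel_left x t

theorem translates_pull {x : V} (f : HolGerm E x) :
    translates (pull (leftTrans E x) (leftTrans_one x) f) x = f :=
  (pull (leftTrans E x) (leftTrans_one x)).injective (pull_translates _ x)

theorem fibreAt_translatesMul {r : HolGerm E (1 : V)} (hr : r ∈ invGerm E G (1 : V))
    (h0 : ev r = 0) (F : invSections E G W) (x : V) :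
    fibreAt E G W x (translatesMul hr F) = 0 := by
  rw [fibreAt_eq_zero_iff]
  have h1 : (⟨translates r x, _, isInvariant_translates hr, rfl⟩ : invGerm E G x) ∈
      fibreIdeal E G x := Ideal.subset_span ⟨r, hr, h0, pull_translates r x⟩
  exact Ideal.mul_mem_right (⟨F.1 x, F.1, F.2.1, rfl⟩ : invGerm E G x) _ h1

variable [Finite G]

/-- A family of germs whose components in all fibres vanish is a sum of products of families with
translates of invariant germs at the identity that vanish there. -/
theorem mem_span_translatesMul (hW : ∀ x ∈ W, MulAction.orbit G x ⊆ W) (F : invSections E G W)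
    (hF : ∀ x, fibreAt E G W x F = 0) :
    F ∈ Submodule.span ℂ {K : invSections E G W |
      ∃ (r : HolGerm E (1 : V)) (hr : r ∈ invGerm E G (1 : V)) (K' : invSections E G W),
        ev r = 0 ∧ K = translatesMul hr K'} := by
  set N := Submodule.span ℂ {K : invSections E G W |
      ∃ (r : HolGerm E (1 : V)) (hr : r ∈ invGerm E G (1 : V)) (K' : invSections E G W),
        ev r = 0 ∧ K = translatesMul hr K'} with hN
  obtain ⟨n, hn⟩ : ∃ n, n = {x | F.1 x ≠ 0}.ncard := ⟨_, rfl⟩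
  induction n using Nat.strong_induction_on generalizing F with
  | _ n ih =>
    by_cases hF0 : ∀ x, F.1 x = 0
    · rw [show F = 0 from Subtype.ext (funext hF0)]
      exact zero_mem _
    obtain ⟨ξ, hξ⟩ := not_forall.1 hF0
    have hξW : ξ ∈ W := by
      by_contra h
      exact hξ (F.2.2.2 ξ h)
    -- on the orbit of `ξ`, the family `F` coincides with an element `K` of the span
    obtain ⟨K, hKN, hKξ, hK0⟩ : ∃ K ∈ N, K.1 ξ = F.1 ξ ∧
        ∀ x, x ∉ MulAction.orbit G ξ → K.1 x = 0 := by
      obtain ⟨k, a, f, hsum⟩ := Submodule.mem_span_set'.1 (fibreAt_eq_zero_iff.1 (hF ξ))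
      choose A hA hAξ using fun i => (a i).2
      choose r hr h0 hfr using fun i => (f i).2
      refine ⟨∑ i, translatesMul (hr i)
        ⟨_, restrictTo_orbit_mem (hW ξ hξW) (hA i)⟩, sum_mem fun i _ => Submodule.subset_span
          ⟨r i, hr i, _, h0 i, rfl⟩, ?_, fun x hx => ?_⟩
      · rw [AddSubmonoidClass.coe_finsetSum, Finset.sum_apply]
        have h1 := congrArg Subtype.val hsum
        rw [AddSubmonoidClass.coe_finsetSum] at h1
        refine Eq.trans (Finset.sum_congr rfl fun i _ => ?_) h1
        change translates (r i) ξ * restrictTo _ (A i) ξ = (a i : HolGerm E ξ) * (f i).1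
        rw [restrictTo_of_mem _ (MulAction.mem_orbit_self ξ), hAξ, ← hfr, translates_pull, mul_comm]
      · rw [AddSubmonoidClass.coe_finsetSum, Finset.sum_apply]
        refine Finset.sum_eq_zero fun i _ => ?_
        change translates (r i) x * restrictTo _ (A i) x = 0
        rw [restrictTo_of_notMem _ hx, mul_zero]
    have hKorb : ∀ x ∈ MulAction.orbit G ξ, K.1 x = F.1 x := by
      rintro x ⟨g, rfl⟩
      have h1 : g⁻¹ • g • ξ = ξ := inv_smul_smul g ξ
      refine ((pull (groupMap E g) (x := ξ) (y := g • ξ) rfl)).injective ?_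
      exact (K.2.1 g ξ _ rfl).trans (hKξ.trans (F.2.1 g ξ _ rfl).symm)
    have hKfib : ∀ x, fibreAt E G W x K = 0 := by
      intro x
      by_cases hx : x ∈ MulAction.orbit G ξ
      · rw [fibreAt_congr (hKorb x hx), hF]
      · exact fibreAt_eq_zero_of_eq_zero (hK0 x hx)
    have hsub : {x | (F - K).1 x ≠ 0} ⊂ {x | F.1 x ≠ 0} := by
      refine ⟨fun x hx => ?_, fun h => ?_⟩
      · intro hc
        refine hx ?_
        change F.1 x - K.1 x = 0
        by_cases hxo : x ∈ MulAction.orbit G ξ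
        · rw [hKorb x hxo, sub_self]
        · rw [hc, hK0 x hxo, sub_self]
      · exact h hξ (sub_eq_zero.2 hKξ.symm)
    have h1 := ih _ (hn ▸ Set.ncard_lt_ncard hsub F.2.2.1) (F - K)
      (fun x => by rw [map_sub, hF, hKfib, sub_self]) rfl
    have h2 := add_mem h1 hKN
    rwa [sub_add_cancel] at h2

end Sections

/-! ### Transposition -/

section Transpose

open MulOpposite in
/-- If the elements of an algebra `R` act on `S` so that composition with them preserves a space
`M` of functionals on `S`, then `M` is a right `R`-module in a unique way. -/
theorem existsUnique_transpose {K R M S : Type*} [Field K] [Semiring R] [Algebra K R]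
    [AddCommGroup M] [Module K M] [AddCommGroup S] [Module K S] (p : M →ₗ[K] S →ₗ[K] K)
    (hp : Function.Injective p) (T : R →ₐ[K] Module.End K S)
    (h : ∀ A α, ∃ β, p β = p α ∘ₗ T A) :
    ∃! ρ : Rᵐᵒᵖ →ₐ[K] Module.End K M, ∀ A α, p (ρ (op A) α) = p α ∘ₗ T A := by
  choose f hf using h
  let r (A : Rᵐᵒᵖ) : Module.End K M :=
    { toFun := f (unop A)
      map_add' := fun α β => hp (by
        rw [map_add, hf, hf, hf, map_add, LinearMap.add_comp])
      map_smul' := fun c α => hp (by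
        rw [RingHom.id_apply, map_smul, hf, hf, map_smul, LinearMap.smul_comp]) }
  have hr : ∀ A α, p (r A α) = p α ∘ₗ T (unop A) := fun A α => hf _ _
  let ρ : Rᵐᵒᵖ →ₐ[K] Module.End K M := AlgHom.ofLinearMap
    { toFun := r
      map_add' := fun A B => LinearMap.ext fun α => hp (by
        rw [LinearMap.add_apply, map_add, hr, hr, hr, unop_add, map_add, LinearMap.comp_add])
      map_smul' := fun c A => LinearMap.ext fun α => hp (by
        rw [RingHom.id_apply, LinearMap.smul_apply, map_smul, hr, hr, unop_smul, map_smul,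
          LinearMap.comp_smul]) }
    (LinearMap.ext fun α => hp (by
      change p (r 1 α) = p α
      rw [hr, unop_one, map_one]
      rfl))
    (fun A B => LinearMap.ext fun α => hp (by
      change p (r (A * B) α) = p (r A (r B α))
      rw [hr, hr, hr, unop_mul, map_mul]
      rfl))
  refine ⟨ρ, fun A α => hr (op A) α, fun ρ' h' => AlgHom.ext fun A => LinearMap.ext fun α => hp ?_⟩
  exact (h' (unop A) α).trans (hr A α).symm

theorem exists_eq_sum_of_forall_eq_zero {K S ι : Type*} [Field K] [AddCommGroup S] [Module K S]
    [Fintype ι] {M : ι → Type*} [∀ i, AddCommGroup (M i)] [∀ i, Module K (M i)]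
    (f : ∀ i, S →ₗ[K] M i) (δ : S →ₗ[K] K) (h : ∀ s, (∀ i, f i s = 0) → δ s = 0) :
    ∃ g : ∀ i, Module.Dual K (M i), ∀ s, δ s = ∑ i, g i (f i s) := by
  classical
  have hδ : δ ∈ (LinearMap.ker (LinearMap.pi f)).dualAnnihilator :=
    (Submodule.mem_dualAnnihilator _).2 fun s hs => h s fun i => congrFun hs i
  rw [← LinearMap.range_dualMap_eq_dualAnnihilator_ker] at hδ
  obtain ⟨g, rfl⟩ := hδ
  refine ⟨fun i => g ∘ₗ LinearMap.single K M i, fun s => ?_⟩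
  simp only [LinearMap.comp_apply]
  rw [← map_sum]
  exact congrArg g (Finset.univ_sum_single fun i => f i s).symm

end Transpose

section Module

variable {E : Type*} [NormedAddCommGroup E] [NormedSpace ℂ E]
  {G : Type*} [Group G]
  {V : Type*} [Group V] [TopologicalSpace V] [ChartedSpace E V] [LieGroup 𝓘(ℂ, E) ω V]
  [MulDistribMulAction G V] [HolAction E G V] {W : Set V}

section Action

variable {Gim : Subgroup V} {𝒜 : Subalgebra ℂ (SkewRing E Gim)}

/-- An algebra of skew operators that preserve `𝔒^G|_W` acts on this space. -/
theorem exists_algHom_end (h𝒜 : ∀ A ∈ 𝒜, Preserves E G W A) :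
    ∃ T : 𝒜 →ₐ[ℂ] Module.End ℂ (invSections E G W), ∀ (A : 𝒜) (F : invSections E G W),
      skewAct (A : SkewRing E Gim) (toMero F.1) = toMero (T A F).1 := by
  choose f hfm hf using fun (A : 𝒜) (F : invSections E G W) => h𝒜 A A.2 F.1 F.2
  have hinj : ∀ {F F' : invSections E G W}, toMero F.1 = toMero F'.1 → F = F' :=
    fun h => Subtype.ext (toMero_injective h)
  let r (A : 𝒜) : Module.End ℂ (invSections E G W) :=
    { toFun := fun F => ⟨f A F, hfm A F⟩
      map_add' := fun F F' => hinj (by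
        refine (hf _ _).symm.trans ?_
        refine (congrArg (skewAct _) (toMero_add _ _)).trans ?_
        refine (skewAct_add_right _ _ _).trans ?_
        rw [hf, hf]
        exact (toMero_add _ _).symm)
      map_smul' := fun c F => hinj (by
        refine (hf _ _).symm.trans ?_
        refine (congrArg (skewAct _) (toMero_smul c _)).trans ?_
        refine (skewAct_smul_right _ _ _).trans ?_
        rw [hf]
        exact (toMero_smul c _).symm) }
  have hr : ∀ (A : 𝒜) F, toMero (r A F).1 = skewAct (A : SkewRing E Gim) (toMero F.1) :=
    fun A F => (hf A F).symm
  refine ⟨AlgHom.ofLinearMap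
    { toFun := r
      map_add' := fun A B => LinearMap.ext fun F => hinj ?_
      map_smul' := fun c A => LinearMap.ext fun F => hinj ?_ }
    (LinearMap.ext fun F => hinj ?_) (fun A B => LinearMap.ext fun F => hinj ?_),
    fun A F => (hr A F).symm⟩
  · refine (hr _ _).trans ((skewAct_add _ _ _).trans ?_)
    rw [← hr, ← hr]
    exact (toMero_add _ _).symm
  · refine (hr _ _).trans ((skewAct_smul _ _ _).trans ?_)
    rw [← hr]
    exact (toMero_smul c _).symm
  · exact (hr _ _).trans (skewAct_one _)
  · refine (hr _ _).trans ((skewAct_mul _ _ _).trans ?_)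
    rw [← hr, ← hr]
    rfl

end Action

variable [Finite G]

/-- An operator that is linear over the invariant germs at the identity induces a map from the
fibres at the points on which it depends. -/
theorem fibreAt_eq_zero_of_commute (hW : ∀ x ∈ W, MulAction.orbit G x ⊆ W)
    (T : Module.End ℂ (invSections E G W))
    (hT : ∀ (r : HolGerm E (1 : V)) (hr : r ∈ invGerm E G (1 : V)) (F : invSections E G W),
      T (translatesMul hr F) = translatesMul hr (T F))
    {x : V} {P : Set V} (hP : ∀ F : invSections E G W, (∀ y ∈ P, F.1 y = 0) → (T F).1 x = 0)
    {F : invSections E G W} (hF : ∀ y ∈ P, fibreAt E G W y F = 0) :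
    fibreAt E G W x (T F) = 0 := by
  set Y : Set V := {y | ∃ g : G, g • y ∈ P} with hY
  have hYinv : ∀ (g : G) (y : V), g • y ∈ Y ↔ y ∈ Y := fun g y =>
    ⟨fun ⟨k, hk⟩ => ⟨k * g, by rwa [mul_smul]⟩,
      fun ⟨k, hk⟩ => ⟨k * g⁻¹, by rwa [mul_smul, inv_smul_smul]⟩⟩
  -- the part of `F` on the orbits of `P` has zero components in all fibres
  let F₁ : invSections E G W := ⟨restrictTo Y F.1, F.2.1.restrictTo hYinv,
    F.2.2.1.subset fun y hy hc => hy (by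
      by_cases h : y ∈ Y
      · rw [restrictTo_of_mem _ h, hc]
      · rw [restrictTo_of_notMem _ h]),
    fun y hy => by
      by_cases h : y ∈ Y
      · rw [restrictTo_of_mem _ h, F.2.2.2 y hy]
      · rw [restrictTo_of_notMem _ h]⟩
  have h1 : ∀ y, fibreAt E G W y F₁ = 0 := by
    intro y
    by_cases h : y ∈ Y
    · obtain ⟨g, hg⟩ := id h
      rw [fibreAt_congr (F' := F) (restrictTo_of_mem _ h)]
      exact fibreAt_eq_zero_of_smul g (hF _ hg)
    · exact fibreAt_eq_zero_of_eq_zero (restrictTo_of_notMem _ h)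
  have h2 : fibreAt E G W x (T F₁) = 0 := by
    have h4 := mem_span_translatesMul hW F₁ h1
    clear_value F₁
    clear h1
    induction h4 using Submodule.span_induction with
    | mem K hK =>
      obtain ⟨r, hr, K', h0, rfl⟩ := hK
      rw [hT]
      exact fibreAt_translatesMul hr h0 _ x
    | zero => rw [map_zero, map_zero]
    | add K K' _ _ hK hK' => rw [map_add, map_add, hK, hK', add_zero]
    | smul c K _ hK => rw [map_smul, map_smul, hK, smul_zero]
  have h3 : fibreAt E G W x (T (F - F₁)) = 0 := by
    refine fibreAt_eq_zero_of_eq_zero (hP _ fun y hy => ?_)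
    have hyY : y ∈ Y := ⟨1, by rwa [one_smul]⟩
    exact sub_eq_zero.2 (restrictTo_of_mem _ hyY).symm
  rw [← sub_add_cancel F F₁, map_add, map_add, h2, h3, add_zero]

section MStar

omit [Finite G]

variable (E) in
/-- A functional on the fibre over an orbit, as an element of `M*(G, W)`. -/
def MStar.lof (o : OrbitsIn G W) : Module.Dual ℂ (fibreInv E o.1) →ₗ[ℂ] MStar E G W := by
  classical
  exact DirectSum.lof ℂ (OrbitsIn G W) (fun o => Module.Dual ℂ (fibreInv E o.1)) o

variable (E) in
/-- The component of an element of `M*(G, W)` at an orbit. -/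
def MStar.component (o : OrbitsIn G W) : MStar E G W →ₗ[ℂ] Module.Dual ℂ (fibreInv E o.1) :=
  DirectSum.component ℂ (OrbitsIn G W) (fun o => Module.Dual ℂ (fibreInv E o.1)) o

theorem MStar.component_lof_self (o : OrbitsIn G W) (φ : Module.Dual ℂ (fibreInv E o.1)) :
    MStar.component E o (MStar.lof E o φ) = φ := by
  classical
  exact DirectSum.component.lof_self ℂ (M := fun o : OrbitsIn G W => Module.Dual ℂ (fibreInv E o.1))
    o φ

theorem MStar.component_lof_of_ne {o o' : OrbitsIn G W} (h : o' ≠ o)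
    (φ : Module.Dual ℂ (fibreInv E o'.1)) : MStar.component E o (MStar.lof E o' φ) = 0 := by
  classical
  exact DirectSum.of_eq_of_ne (β := fun o : OrbitsIn G W => Module.Dual ℂ (fibreInv E o.1))
    o' o φ h.symm

theorem MStar.ext {α β : MStar E G W} (h : ∀ o : OrbitsIn G W, MStar.component E o α = MStar.component E o β) :
    α = β :=
  DFinsupp.ext h

theorem pairing_lof (o : OrbitsIn G W) (φ : Module.Dual ℂ (fibreInv E o.1))
    (F : invSections E G W) : pairing E G W (MStar.lof E o φ) F = φ (toFibre E G W o.1 F) := by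
  classical
  have h := DirectSum.toModule_lof ℂ (M := fun o : OrbitsIn G W => Module.Dual ℂ (fibreInv E o.1))
    (φ := fun o => (toFibre E G W o.1).dualMap) o φ
  exact LinearMap.congr_fun h F

theorem MStar.induction {p : MStar E G W → Prop} (zero : p 0)
    (lof : ∀ (o : OrbitsIn G W) (φ : Module.Dual ℂ (fibreInv E o.1)), p (MStar.lof E o φ))
    (add : ∀ α β, p α → p β → p (α + β)) (α : MStar E G W) : p α := by
  classical
  exact DirectSum.induction_on (β := fun o : OrbitsIn G W => Module.Dual ℂ (fibreInv E o.1))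
    α zero lof add

end MStar

omit [Finite G] in
/-- The elements of `M*(G, W)`, as functionals on `𝔒^G|_W`, are the functionals that factor
through finitely many fibres. -/
theorem mem_range_pairing_iff (hW : ∀ x ∈ W, MulAction.orbit G x ⊆ W)
    (δ : invSections E G W →ₗ[ℂ] ℂ) : δ ∈ LinearMap.range (pairing E G W) ↔
      ∃ P : Set V, P.Finite ∧ ∀ F, (∀ x ∈ P, fibreAt E G W x F = 0) → δ F = 0 := by
  classical
  constructor
  · rintro ⟨α, rfl⟩
    induction α using MStar.induction with
    | zero => exact ⟨∅, Set.finite_empty, fun F _ => by rw [map_zero]; rfl⟩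
    | lof o φ =>
      obtain ⟨x, hx⟩ := MulAction.orbitRel.Quotient.nonempty_orbit o.1
      refine ⟨{x}, Set.finite_singleton x, fun F hF => ?_⟩
      have h0 : toFibre E G W o.1 F = 0 := toFibre_eq_zero_iff.2 fun y hy => by
        obtain ⟨g, hg⟩ := exists_smul_eq (⟨y, hy⟩ : o.1.orbit) ⟨x, hx⟩
        exact fibreAt_eq_zero_of_smul g (hF _ hg)
      rw [pairing_lof, h0, map_zero]
    | add α β hα hβ =>
      obtain ⟨P, hP, h⟩ := hα
      obtain ⟨P', hP', h'⟩ := hβ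
      refine ⟨P ∪ P', hP.union hP', fun F hF => ?_⟩
      rw [map_add, LinearMap.add_apply, h F fun y hy => hF y (Or.inl hy),
        h' F fun y hy => hF y (Or.inr hy), add_zero]
  · rintro ⟨P, hP, h⟩
    have := hP.to_subtype
    have : Finite {x // x ∈ P ∧ x ∈ W} :=
      Finite.of_injective (fun x : {x // x ∈ P ∧ x ∈ W} => (⟨x.1, x.2.1⟩ : P))
        fun x y hxy => Subtype.ext (congrArg (fun z : P => z.1) hxy)
    have := Fintype.ofFinite {x // x ∈ P ∧ x ∈ W}
    let o (i : {x // x ∈ P ∧ x ∈ W}) : OrbitsIn G W :=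
      ⟨Quotient.mk _ i.1, by
        have := hW i.1 i.2.2
        rwa [← MulAction.orbitRel.Quotient.orbit_mk] at this⟩
    obtain ⟨g, hg⟩ := exists_eq_sum_of_forall_eq_zero
      (M := fun i => fibreInv E (o i).1) (fun i => toFibre E G W (o i).1) δ
      fun F hF => h F fun x hx => by
        by_cases hxW : x ∈ W
        · exact toFibre_eq_zero_iff.1 (hF ⟨x, hx, hxW⟩) x
            (MulAction.orbitRel.Quotient.mem_orbit.2 rfl)
        · exact fibreAt_eq_zero_of_eq_zero (F.2.2.2 x hxW)
    refine ⟨∑ i, MStar.lof E (o i) (g i), LinearMap.ext fun F => ?_⟩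
    rw [map_sum, LinearMap.sum_apply, hg]
    exact Finset.sum_congr rfl fun i _ => pairing_lof (o i) (g i) F

/-- The projections to the fibres over distinct orbits are jointly surjective: a family over one
orbit can be prescribed, and extended by zero. -/
theorem exists_toFibre_eq (o : OrbitsIn G W) (e : fibreInv E o.1) : ∃ F : invSections E G W,
    toFibre E G W o.1 F = e ∧ ∀ o' : OrbitsIn G W, o' ≠ o → toFibre E G W o'.1 F = 0 := by
  obtain ⟨x, hx⟩ := MulAction.orbitRel.Quotient.nonempty_orbit o.1
  obtain ⟨⟨_, F, hF, rfl⟩, he⟩ := Ideal.Quotient.mk_surjective (e.1 ⟨x, hx⟩)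
  have ho : o.1 = Quotient.mk _ x := (MulAction.orbitRel.Quotient.mem_orbit.1 hx).symm
  have horb : o.1.orbit = MulAction.orbit G x := by
    rw [ho, ← MulAction.orbitRel.Quotient.orbit_mk]
  refine ⟨⟨_, restrictTo_orbit_mem (horb ▸ o.2) hF⟩, ?_, fun o' ho' => ?_⟩
  · refine (fibreInvEval_bijective o.1 ⟨x, hx⟩).1 ?_
    refine Eq.trans ?_ he
    exact congrArg (Ideal.Quotient.mk _)
      (Subtype.ext (restrictTo_of_mem _ (MulAction.mem_orbit_self x)))
  · refine toFibre_eq_zero_iff.2 fun y hy => fibreAt_eq_zero_of_eq_zero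
      (restrictTo_of_notMem _ fun hy' => ho' (Subtype.ext ?_))
    rw [← horb] at hy'
    exact (MulAction.orbitRel.Quotient.mem_orbit.1 hy).symm.trans
      (MulAction.orbitRel.Quotient.mem_orbit.1 hy')

/-- Elements of `M*(G, W)` are determined by their values on `𝔒^G|_W`. -/
theorem pairing_injective : Function.Injective (pairing E G W) := by
  rw [injective_iff_map_eq_zero]
  intro α hα
  refine MStar.ext fun o => LinearMap.ext fun e => ?_
  obtain ⟨F, hF, hF'⟩ := exists_toFibre_eq o e
  have key : ∀ β : MStar E G W, pairing E G W β F = MStar.component E o β e := by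
    intro β
    induction β using MStar.induction with
    | zero => rw [map_zero, map_zero]; rfl
    | lof o' φ =>
      rw [pairing_lof]
      by_cases h : o' = o
      · subst h
        rw [hF, MStar.component_lof_self]
      · rw [hF' o' h, map_zero, MStar.component_lof_of_ne h]
        rfl
    | add β γ hβ hγ =>
      rw [map_add, map_add]
      exact congrArg₂ (· + ·) hβ hγ
  rw [← key, hα, map_zero]
  rfl

end Module

/-! ### The module structure and the basis -/

theorem dfinsuppBasis_apply {ι R : Type*} [Semiring R] {M : ι → Type*} [∀ i, AddCommMonoid (M i)]
    [∀ i, Module R (M i)] [DecidableEq ι] {η : ι → Type*} (b : ∀ i, Module.Basis (η i) R (M i))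
    (i : Σ i, η i) : DFinsupp.basis b i = DFinsupp.single i.1 (b i.1 i.2) := by
  obtain ⟨i, x⟩ := i
  refine Module.Basis.apply_eq_iff.2 (Finsupp.ext fun ⟨j, y⟩ => ?_)
  change (b j).repr (DFinsupp.single i (b i x) j) y = _
  classical
  by_cases h : i = j
  · subst h
    simp [Finsupp.single_apply]
  · rw [DFinsupp.single_eq_of_ne (Ne.symm h), Finsupp.single_eq_of_ne (by simp [Ne.symm h])]
    simp

section Semiorbit

variable {E : Type*} [NormedAddCommGroup E] [NormedSpace ℂ E]
  {G : Type*} [Group G]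
  {V : Type*} [Group V] [TopologicalSpace V] [ChartedSpace E V] [LieGroup 𝓘(ℂ, E) ω V]
  [MulDistribMulAction G V]

omit [TopologicalSpace V] [ChartedSpace E V] [LieGroup 𝓘(ℂ, E) ω V] in
theorem orbit_subset_semiOrbit {Gim : Subgroup V} (hGim : ∀ g : G, ∀ ξ ∈ Gim, g • ξ ∈ Gim) (v : V) :
    ∀ x ∈ semiOrbit G Gim v, MulAction.orbit G x ⊆ semiOrbit G Gim v := by
  rintro _ ⟨ξ, hξ, g, rfl⟩ _ ⟨k, rfl⟩
  exact ⟨k • ξ, hGim k ξ hξ, k * g, by rw [mul_smul]; exact smul_mul' k ξ (g • v)⟩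

variable [HolAction E G V] {W : Set V}

/-- Bases of the summands give a basis of `M*(G, W)`. -/
theorem exists_basis_MStar {η : OrbitsIn G W → Type*}
    (b : ∀ o : OrbitsIn G W, Module.Basis (η o) ℂ (Module.Dual ℂ (fibreInv E o.1))) :
    ∃ B : Module.Basis (Σ o, η o) ℂ (MStar E G W), ∀ i, B i = MStar.lof E i.1 (b i.1 i.2) := by
  classical
  exact ⟨DFinsupp.basis b, dfinsuppBasis_apply b⟩

variable [Finite G]

open MulOpposite in
/-- Transposition turns `M*(G, W)` into a right module over an algebra of skew operators that
preserve `𝔒^G|_W`. -/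
theorem existsUnique_transpose_skewAct (hW : ∀ x ∈ W, MulAction.orbit G x ⊆ W)
    {Gim : Subgroup V} {𝒜 : Subalgebra ℂ (SkewRing E Gim)}
    (h𝒜 : ∀ A ∈ 𝒜, Preserves E G W A) :
    ∃! ρ : 𝒜ᵐᵒᵖ →ₐ[ℂ] Module.End ℂ (MStar E G W),
      ∀ (A : 𝒜) (α : MStar E G W) (F F' : invSections E G W),
        skewAct (A : SkewRing E Gim) (toMero F.1) = toMero F'.1 →
          pairing E G W (ρ (op A) α) F = pairing E G W α F' := by
  obtain ⟨T, hT⟩ := exists_algHom_end h𝒜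
  have hmul : ∀ (A : 𝒜) (r : HolGerm E (1 : V)) (hr : r ∈ invGerm E G (1 : V))
      (F : invSections E G W), T A (translatesMul hr F) = translatesMul hr (T A F) := by
    intro A r hr F
    refine Subtype.ext (toMero_injective ((hT _ _).symm.trans ?_))
    refine (congrArg (skewAct _) (toMero_mul (translates r) F.1)).trans ?_
    refine (skewAct_translates_mul _ r _).trans ?_
    rw [hT]
    exact (toMero_mul _ _).symm
  have hfin : ∀ (A : 𝒜) (x : V), ∃ P : Set V, P.Finite ∧
      ∀ F : invSections E G W, (∀ y ∈ P, fibreAt E G W y F = 0) →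
        fibreAt E G W x (T A F) = 0 := by
    intro A x
    obtain ⟨P, hP, h⟩ := exists_finite_skewAct_eq_zero (A : SkewRing E Gim) x
    refine ⟨P, hP, fun F => fibreAt_eq_zero_of_commute hW (T A) (hmul A) fun F hF => ?_⟩
    have h1 := h (toMero F.1) fun y hy => by
      change algebraMap _ _ (F.1 y) = _
      rw [hF y hy, map_zero]
    rw [hT] at h1
    exact (IsFractionRing.injective (HolGerm E x) (MeroGerm E x)) (h1.trans (map_zero _).symm)
  have hrange : ∀ (A : 𝒜) (α : MStar E G W), ∃ β, pairing E G W β = pairing E G W α ∘ₗ T A := by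
    intro A α
    choose Q hQ hQA using hfin A
    obtain ⟨P, hP, h⟩ := (mem_range_pairing_iff hW _).1 ⟨α, rfl⟩
    refine (mem_range_pairing_iff hW _).2 ⟨⋃ x ∈ P, Q x, hP.biUnion fun x _ => hQ x,
      fun F hF => h _ fun x hx => hQA x F fun y hy => hF y (Set.mem_biUnion hx hy)⟩
  have hT' : ∀ (A : 𝒜) (F F' : invSections E G W),
      skewAct (A : SkewRing E Gim) (toMero F.1) = toMero F'.1 → F' = T A F :=
    fun A F F' h => Subtype.ext (toMero_injective (h.symm.trans (hT A F)))
  obtain ⟨ρ, hρ, huniq⟩ := existsUnique_transpose (pairing E G W) pairing_injective T hrange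
  refine ⟨ρ, fun A α F F' h => ?_, fun ρ' h' => huniq ρ' fun A α => LinearMap.ext fun F => ?_⟩
  · rw [hρ, hT' A F F' h]
    rfl
  · exact h' A α F _ (hT A F)

end Semiorbit

end LocRefl

end

open LocRefl in
theorem mainTheorem6
    {E : Type*} [NormedAddCommGroup E] [NormedSpace ℂ E] [FiniteDimensional ℂ E]
    {V : Type*} [Group V] [TopologicalSpace V] [ChartedSpace E V] [LieGroup 𝓘(ℂ, E) ω V]
    {G : Type*} [Group G] [Finite G] [MulDistribMulAction G V] [HolAction E G V]
    (D : LocalReflectionGroup E G V)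
    (Gim : Subgroup V) (hGim : ∀ g : G, ∀ ξ ∈ Gim, g • ξ ∈ Gim) (v : V)
    (𝒜 : Subalgebra ℂ (SkewRing E Gim))
    (h𝒜 : ∀ A ∈ 𝒜, Preserves E G (semiOrbit G Gim v) A)
    (red : G → List E) (hred : ∀ w, D.IsReducedWord (red w) w)
    (rep : OrbitsIn G (semiOrbit G Gim v) → V) (hrep : ∀ o, rep o ∈ o.1.orbit)
    (hpar : ∀ o, D.IsParabolic (MulAction.stabilizer G (rep o))) :
    (∃! ρ : 𝒜ᵐᵒᵖ →ₐ[ℂ] Module.End ℂ (MStar E G (semiOrbit G Gim v)),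
      ∀ (A : 𝒜) (α : MStar E G (semiOrbit G Gim v)) (F F' : invSections E G (semiOrbit G Gim v)),
        skewAct (A : SkewRing E Gim) (toMero F.1) = toMero F'.1 →
          pairing E G (semiOrbit G Gim v) (ρ (MulOpposite.op A) α) F = pairing E G (semiOrbit G Gim v) α F') ∧
    ∃ b : Module.Basis
        (Σ o : OrbitsIn G (semiOrbit G Gim v),
          {w : G // D.IsShort (MulAction.stabilizer G (rep o)) w})
        ℂ (MStar E G (semiOrbit G Gim v)),
      ∀ i (F : invSections E G (semiOrbit G Gim v)),
        pairing E G (semiOrbit G Gim v) (b i) F = D.functional (red i.2.1) (rep i.1) (F.1 (rep i.1)) := by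
  refine ⟨existsUnique_transpose_skewAct (orbit_subset_semiOrbit hGim v) h𝒜, ?_⟩
  choose b hb using fun o : OrbitsIn G (semiOrbit G Gim v) =>
    exists_dual_basis hred (hrep o) (hpar o) (semiOrbit G Gim v)
  obtain ⟨B, hB⟩ := exists_basis_MStar b
  refine ⟨B, fun i F => ?_⟩
  rw [hB, pairing_lof, hb]
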